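/- Let $(\mathcal A,\tau,\tau',t)$ be a tracial real infinitesimal probability space: $\mathcal A$ is a unital algebra over $\mathbb C$; $a\mapsto a^t$ is a $\mathbb C$-linear map $\mathcal A\to\mathcal A$ with $(ab)^t=b^ta^t$ and $(a^t)^t=a$; $\tau,\tau':\mathcal A\to\mathbb C$ are linear with $\tau(1)=1$, $\tau(a^t)=\tau(a)$, $\tau'(1)=0$; and $\tau(ab)=\tau(ba)$, $\tau'(ab)=\tau'(ba)$ for all $a,b\in\mathcal A$. **Cumulants.** Let $NC(n)$ be the set of non-crossing partitions of $\{1,\dots,n\}$, and for $V=\{i_1<\dots<i_r\}$ write $(a_1,\dots,a_n\mid V)=(a_{i_1},\dots,a_{i_r})$. The free cumulants $\kappa_n$ of $\tau$ are defined inductively by $$\tau(a_1\cdots a_n)=\sum_{\pi\in NC(n)}\ \prod_{V\in\pi}\kappa_{|V|}(a_1,\dots,a_n\mid V)\qquad(n\ge 1).$$ On $[\pm n]=\{\pm1,\dots,\pm n\}$ let $\delta(k)=-k$ and $\Gamma=(1,\dots,n)(-n,\dots,-1)$, and let $\#(\sigma)$ be the number of cycles of a permutation $\sigma$, fixed points included.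 Let $S_{NC}^{\delta}(n,-n)$ be the set of permutations $\sigma$ of $[\pm n]$ such that some cycle of $\sigma$ meets both cycles of $\Gamma$, $\#(\sigma)+\#(\sigma^{-1}\Gamma)=2n$, and all cycles of $\sigma\delta$ have length $2$; it is empty for $n=1$. The cycles of such a $\sigma$ come in conjugate pairs $\{c,\delta c^{-1}\delta\}$. With $a_{-k}:=a_k^t$ for $1\le k\le n$, put $$\kappa_{\sigma/2}(a_1,\dots,a_n)=\prod_{\{c,c'\}}\kappa_r(a_{i_1},\dots,a_{i_r}),$$ the product over all conjugate pairs, where $c=(i_1,\dots,i_r)$ is either member of the pair (the factor does not depend on the choice of $c$ or of its first point). The real infinitesimal cumulants $\kappa'_n$ are defined inductively for $n\ge 1$ by $$\tau'(a_1\cdots a_n)=\sum_{\pi\in NC(n)}\ \sum_{V\in\pi}\kappa'_{|V|}(a_1,\dots,a_n\mid V)\prod_{W\in\pi,\,W\ne V}\kappa_{|W|}(a_1,\dots,a_n\mid W)+\sum_{\sigma\in S_{NC}^{\delta}(n,-n)}\kappa_{\sigma/2}(a_1,\dots,a_n);$$ in particular $\kappa'_1=\tau'$. **Real infinitesimal freeness.**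 Unital subalgebras $\mathcal A_1,\dots,\mathcal A_s\subseteq\mathcal A$ closed under $a\mapsto a^t$ are *real infinitesimally free* if for all $n\ge1$ and all $a_i\in\mathcal A_{j_i}$ ($1\le i\le n$) with $\tau(a_i)=0$ and $j_1\ne j_2,\ j_2\neq j_3,\dots,\ j_{n-1}\ne j_n$ one has 1. $\tau(a_1\cdots a_n)=0$; 2. if $n=2$, then $\tau'(a_1a_2)=0$; 3. if $n=2k-1\ge3$, then $\tau'(a_1\cdots a_n)=\tau(a_1a_n)\,\tau'(a_2\cdots a_{n-1})+\tau(a_1a_k^ta_n)\prod_{i=2}^{k-1}\tau(a_ia_{i+k-1}^t)$; 4. if $n=2k\ge4$, then $\tau'(a_1\cdots a_n)=\tau(a_1a_n)\,\tau'(a_2\cdots a_{n-1})+\prod_{i=1}^{k}\tau(a_ia_{i+k}^t)$. **Theorem.** Let $\mathcal A_1,\dots,\mathcal A_s\subseteq\mathcal A$ be unital subalgebras closed under $a\mapsto a^t$. The following are equivalent: (i) $\mathcal A_1,\dots,\mathcal A_s$ are real infinitesimally free. (ii) All mixed free cumulants and all mixed real infinitesimal cumulants vanish: for all $n\ge2$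 and all $a_i\in\mathcal A_{j_i}$ ($1\le i\le n$) such that $j_1,\dots,j_n$ are not all equal, $\kappa_n(a_1,\dots,a_n)=0$ and $\kappa'_n(a_1,\dots,a_n)=0$. -/

import Mathlib

open Finset

/-- A real infinitesimal (non-commutative) probability space `(A, τ, τ', t)` on a unital complex
algebra `A`: `t` is a linear, anti-multiplicative involution (the transpose), `τ` is a state, that
is, a unital linear functional with `τ(aᵗ) = τ(a)`, and `τ'` is a linear functional with
`τ'(1) = 0`. -/
structure RealInfProbSpace (A : Type*) [Ring A] [Algebra ℂ A] where
  t : A →ₗ[ℂ] A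
  t_mul : ∀ a b : A, t (a * b) = t b * t a
  t_t : ∀ a : A, t (t a) = a
  τ : A →ₗ[ℂ] ℂ
  τ_one : τ 1 = 1
  τ_t : ∀ a : A, τ (t a) = τ a
  τ' : A →ₗ[ℂ] ℂ
  τ'_one : τ' 1 = 0

/-! ### Non-crossing partitions and symmetric non-crossing annular permutations -/

/-- A partition of `{1, …, n}` is non-crossing if there are no `i < j < k < l` with `i, k` in one
block and `j, l` in another block. -/
def IsNoncrossing {n : ℕ} (π : Finpartition (univ : Finset (Fin n))) : Prop :=
  ∀ i j k l : Fin n, i < j → j < k → k < l →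
    ∀ V ∈ π.parts, ∀ W ∈ π.parts, i ∈ V → k ∈ V → j ∈ W → l ∈ W → V = W

open Classical in
/-- The set `NC(n)` of non-crossing partitions of `{1, …, n}`. -/
noncomputable def NC (n : ℕ) : Finset (Finpartition (univ : Finset (Fin n))) :=
  univ.filter IsNoncrossing

/-- The non-crossing partitions of `{1, …, n}` other than the one-block partition `1_n`. -/
noncomputable def properNC (n : ℕ) : Finset (Finpartition (univ : Finset (Fin n))) :=
  (NC n).filter fun π => univ ∉ π.parts

/-- The set `[±n] = {±1, …, ±n}`: `Sum.inl k` is the positive and `Sum.inr k` the negative copy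
of a point `k`. -/
abbrev PM (n : ℕ) : Type := Fin n ⊕ Fin n

/-- The permutation `δ(k) = -k` of `[±n]`. -/
def deltaPerm (n : ℕ) : Equiv.Perm (PM n) := Equiv.sumComm (Fin n) (Fin n)

/-- The long cycle `γ_n = (1, 2, …, n)`, acting trivially on the negative points. -/
def gammaPerm (n : ℕ) : Equiv.Perm (PM n) := Equiv.sumCongr (finRotate n) (Equiv.refl (Fin n))

/-- The permutation `γ_n δ γ_n⁻¹ δ = (1, …, n)(-n, …, -1)`. -/
def annulusPerm (n : ℕ) : Equiv.Perm (PM n) :=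
  gammaPerm n * deltaPerm n * (gammaPerm n)⁻¹ * deltaPerm n

/-- The number `#(σ)` of cycles of a permutation, fixed points included. -/
noncomputable def numCycles {α : Type*} (σ : Equiv.Perm α) : ℕ :=
  Nat.card (Quotient (Equiv.Perm.SameCycle.setoid σ))

/-- A permutation is a pairing if all of its cycles have length two. -/
def IsPairing {α : Type*} (p : Equiv.Perm α) : Prop :=
  ∀ x, p x ≠ x ∧ p (p x) = x

open Classical in
/-- The set `S_NC^δ(n, -n)` of symmetric non-crossing annular permutations: some cycle of `σ` meets
both cycles of `Γ = γ_n δ γ_n⁻¹ δ`, `#(σ) + #(σ⁻¹ Γ) = 2n`, and `σ δ` is a pairing. It is empty for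
`n ≤ 1`. -/
noncomputable def SNCdelta (n : ℕ) : Finset (Equiv.Perm (PM n)) :=
  univ.filter fun σ =>
    (∃ k l : Fin n, σ.SameCycle (Sum.inl k) (Sum.inr l)) ∧
    numCycles σ + numCycles (σ⁻¹ * annulusPerm n) = 2 * n ∧
    IsPairing (σ * deltaPerm n)

/-! ### Cumulants -/

theorem card_lt_of_mem_properNC {n : ℕ} {π : Finpartition (univ : Finset (Fin n))}
    (hπ : π ∈ properNC n) {V : Finset (Fin n)} (hV : V ∈ π.parts) : V.card < n := by
  have h : V ≠ univ := fun h => (Finset.mem_filter.mp hπ).2 (h ▸ hV)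
  simpa using Finset.card_lt_card (Finset.ssubset_univ_iff.mpr h)

/-- The restriction `(a_1, …, a_n | V)`: the entries with index in `V`, in increasing order. -/
def restr {A : Type*} {n : ℕ} (a : Fin n → A) (V : Finset (Fin n)) : Fin V.card → A :=
  fun i => a (V.orderEmbOfFin rfl i)

/-- The free cumulants `κ_n(a_1, …, a_n)` of `τ`, determined inductively by the moment-cumulant
formula `τ(a_1 ⋯ a_n) = ∑_{π ∈ NC(n)} ∏_{V ∈ π} κ_{|V|}(a_1, …, a_n | V)`, solved for the term of
the one-block partition. -/
noncomputable def freeCumulant {A : Type*} [Ring A] [Algebra ℂ A] (τ : A →ₗ[ℂ] ℂ) :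
    (n : ℕ) → (Fin n → A) → ℂ
  | n, a =>
    τ (List.ofFn a).prod -
      ∑ π : {π // π ∈ properNC n}, ∏ V : {V // V ∈ π.1.parts},
        freeCumulant τ V.1.card (restr a V.1)
termination_by n => n
decreasing_by exact card_lt_of_mem_properNC π.2 V.2

namespace RealInfProbSpace

variable {A : Type*} [Ring A] [Algebra ℂ A]

/-- The space is tracial if both `τ` and `τ'` are traces. -/
def IsTracial (P : RealInfProbSpace A) : Prop :=
  (∀ a b : A, P.τ (a * b) = P.τ (b * a)) ∧ (∀ a b : A, P.τ' (a * b) = P.τ' (b * a))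

/-- A point `k` of `[±n]` stands for `a_k`, and `-k` stands for `a_kᵗ`. -/
def signedEntry (P : RealInfProbSpace A) {n : ℕ} (a : Fin n → A) : PM n → A :=
  Sum.elim a fun k => P.t (a k)

/-- The free cumulant of the entries along the cycle of `σ` through `x`, listed from `x`:
`κ_r(a_x, a_{σ(x)}, …, a_{σ^{r-1}(x)})` with `r` the length of the cycle and `a_{-k} = a_kᵗ`. -/
noncomputable def cycleCumulant (P : RealInfProbSpace A) {n : ℕ} (σ : Equiv.Perm (PM n))
    (a : Fin n → A) (x : PM n) : ℂ :=
  freeCumulant P.τ (Function.minimalPeriod σ x)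
    fun i => P.signedEntry a ((σ ^ (i : ℕ)) x)

open Classical in
/-- `κ_{σ/2}(a_1, …, a_n)`: the product of cumulants with one factor for each conjugate pair
`{c, δ c⁻¹ δ}` of cycles of `σ`. From a pair we take the cycle through the positive point `i`,
where `i` is the least absolute value of the points of the pair, and list it from `i`.
(If `τ` is tracial, every other choice of a cycle of the pair and of its first point gives the
same factor.) -/
noncomputable def kappaHalf (P : RealInfProbSpace A) {n : ℕ} (σ : Equiv.Perm (PM n))
    (a : Fin n → A) : ℂ :=
  ∏ i ∈ univ.filter (fun i : Fin n => ∀ j : Fin n,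
      σ.SameCycle (Sum.inl i) (Sum.inl j) ∨ σ.SameCycle (Sum.inl i) (Sum.inr j) → i ≤ j),
    P.cycleCumulant σ a (Sum.inl i)

/-- The real infinitesimal cumulants `κ'_n(a_1, …, a_n)`, determined inductively by
`τ'(a_1 ⋯ a_n) = ∑_{π ∈ NC(n)} ∂κ_π(a_1, …, a_n) + ∑_{σ ∈ S_NC^δ(n, -n)} κ_{σ/2}(a_1, …, a_n)`,
`∂κ_π = ∑_{V ∈ π} κ'_{|V|}(a_1, …, a_n | V) ∏_{W ≠ V} κ_{|W|}(a_1, …, a_n | W)`,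
solved for the term of the one-block partition. As `S_NC^δ(1, -1)` is empty, `κ'_1 = τ'`. -/
noncomputable def infCumulant (P : RealInfProbSpace A) : (n : ℕ) → (Fin n → A) → ℂ
  | n, a =>
    P.τ' (List.ofFn a).prod -
      (∑ π : {π // π ∈ properNC n}, ∑ V : {V // V ∈ π.1.parts},
        infCumulant P V.1.card (restr a V.1) *
          ∏ W ∈ π.1.parts.erase V.1, freeCumulant P.τ W.card (restr a W)) -
      ∑ σ ∈ SNCdelta n, P.kappaHalf σ a
termination_by n => n
decreasing_by exact card_lt_of_mem_properNC π.2 V.2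

/-- All mixed free cumulants and all mixed real infinitesimal cumulants of the family `S` vanish:
`κ_n(a_1, …, a_n) = 0 = κ'_n(a_1, …, a_n)` whenever `n ≥ 2`, `a_i` lies in the subalgebra with
index `j_i`, and the indices `j_1, …, j_n` are not all equal. -/
def MixedCumulantsVanish (P : RealInfProbSpace A) {s : ℕ} (S : Fin s → Subalgebra ℂ A) : Prop :=
  ∀ (n : ℕ) (a : Fin n → A) (j : Fin n → Fin s), 2 ≤ n → (∀ i, a i ∈ S (j i)) →
    (∃ p q, j p ≠ j q) →
    freeCumulant P.τ n a = 0 ∧ P.infCumulant n a = 0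

end RealInfProbSpace

/-- The product `a_p a_{p+1} ⋯ a_q` (equal to `1` if `q < p`). -/
def segProd {A : Type*} [Monoid A] (a : ℕ → A) (p q : ℕ) : A :=
  ((List.range' p (q + 1 - p)).map a).prod

namespace RealInfProbSpace

variable {A : Type*} [Ring A] [Algebra ℂ A]

/-- Real infinitesimal freeness of a family of subalgebras: four conditions on all centred,
alternating tuples `a_1, …, a_n` (only the values of the sequences at `1, …, n` matter). As `τ'` is
scalar valued, `τ(a_1 τ'(a_2 ⋯ a_{n-1}) a_n)` is `τ(a_1 a_n) τ'(a_2 ⋯ a_{n-1})`. -/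
def IsRealInfFree (P : RealInfProbSpace A) {s : ℕ} (S : Fin s → Subalgebra ℂ A) : Prop :=
  ∀ (n : ℕ) (a : ℕ → A) (j : ℕ → Fin s), 1 ≤ n →
    (∀ i ∈ Icc 1 n, a i ∈ S (j i)) → (∀ i ∈ Icc 1 n, P.τ (a i) = 0) →
    (∀ i ∈ Ico 1 n, j i ≠ j (i + 1)) →
    P.τ (segProd a 1 n) = 0 ∧
    (n = 2 → P.τ' (a 1 * a 2) = 0) ∧
    (∀ k : ℕ, n + 1 = 2 * k → 3 ≤ n →
      P.τ' (segProd a 1 n) =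
        P.τ (a 1 * a n) * P.τ' (segProd a 2 (n - 1)) +
          P.τ (a 1 * P.t (a k) * a n) *
            ∏ i ∈ Icc 2 (k - 1), P.τ (a i * P.t (a (i + k - 1)))) ∧
    (∀ k : ℕ, n = 2 * k → 4 ≤ n →
      P.τ' (segProd a 1 n) =
        P.τ (a 1 * a n) * P.τ' (segProd a 2 (n - 1)) +
          ∏ i ∈ Icc 1 k, P.τ (a i * P.t (a (i + k))))

end RealInfProbSpace

set_option linter.unusedSectionVars false

/-! Every sum over partitions or permutations is turned into a recursion on words. A non-crossing
partition is built by following the block of the first letter: either the block ends, or it has a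
next letter and the gap in between carries a non-crossing partition of its own. This is `planarSum`.
The elements of S_NC^δ(n,-n) are the analogous objects on a Möbius band: there the block of the
first letter may also run through the crosscap, after which the gap is read backwards with
transposed letters in front of the remaining letters, and everything left is planar. This is
`crosscapSum`.

The combinatorial core is that the annular sum equals `crosscapSum` (`sum_kappaHalf`, from
`wordSumEval`). The points x and δx are removed from σ and from Γ at the same time. This cuts, joins
or twists the cycles of Γ, so the claim has to be proved for a Γ made from several words. The number
#(σ) + #(σ⁻¹Γ) acts as an Euler characteristic: its top value gives products of planar sums, the
next value gives exactly one crosscap, and joining two words falls below both.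

In dual numbers κ + εκ' the terms ∂κ_π are the ε-parts of products over blocks, so τ' of a product
is the ε-part of a planar sum plus a crosscap sum (`moment_infCumulant`). Traciality makes κ
invariant under rotation and conjugation, and κ' invariant under rotation
(`isDihedral_listCumulant`, `listInf_rotate`).

From (ii) to (i): when mixed cumulants vanish, almost nothing survives in an alternating centred
word, because a non-empty gap that is again alternating and centred has moment zero. There remain
the pair formed by the first and last letters with an infinitesimal interior, and one crosscap term,
which ties the first letter to the middle one and pairs the letters on both sides of it
(`momInf_even`, `momInf_odd`).

From (i) to (ii): the cumulants are compared with their restriction to monochromatic words, extended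
by zero (`monoPart`), by induction on the length. If the two agree on shorter words, their
difference at a word equals the difference of the two moments (`mom_sub_mom`, `momInf_sub_momInf`).
Neighbours of one colour can be multiplied together without changing either moment (`mom_merge`,
`momInf_merge`). In an alternating word the letters can be centred without changing the cumulants
(`shift_of_mom`, `shift_of_momInf`), and then freeness and the computation of the first implication
give the same value. No formula for cumulants with products as entries is needed. Letters carry the
index of their subalgebra, since an element may lie in several of them. -/

/-! ### Planar and crosscap sums over words -/

/-- The conjugate of a word: reverse the order and apply `t` to each letter. -/
def dag {X : Type*} (t : X → X) (L : List X) : List X := (L.map t).reverse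

section dag

variable {X : Type*} (t : X → X)

@[simp] theorem dag_nil : dag t [] = [] := rfl

@[simp] theorem dag_append (L M : List X) : dag t (L ++ M) = dag t M ++ dag t L := by
  simp [dag]

@[simp] theorem dag_cons (x : X) (L : List X) : dag t (x :: L) = dag t L ++ [t x] := by
  simp [dag]

@[simp] theorem length_dag (L : List X) : (dag t L).length = L.length := by
  simp [dag]

variable {t}

theorem dag_dag (ht : ∀ x, t (t x) = x) (L : List X) : dag t (dag t L) = L := by
  induction L with
  | nil => rfl
  | cons x L ih => simp [ih, ht]

theorem mem_dag (ht : ∀ x, t (t x) = x) {L : List X} {x : X} : x ∈ dag t L ↔ t x ∈ L := by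
  simp only [dag, List.mem_reverse, List.mem_map]
  exact ⟨fun ⟨y, hy, h⟩ => by rw [← h, ht]; exact hy, fun h => ⟨t x, h, ht x⟩⟩

end dag

section wordSums

variable {X R : Type*} [CommRing R]

/-- The sum, over all non-crossing partitions of the word `W` whose letters are lists, of the
products over the blocks of the values of `k` at the concatenation of the block. -/
def planarSum (k : List X → R) : List (List X) → R
  | [] => 1
  | L :: W => k L * planarSum k W + ∑ i : Fin W.length,
      planarSum k (W.take i) * planarSum k ((L ++ W[i]) :: W.drop (i + 1))
termination_by W => W.length
decreasing_by all_goals simp <;> first | omega | exact Fin.pos ‹_›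

/-- The analogue of `planarSum` for the partitions of the Möbius band whose complement is a union
of discs. -/
def crosscapSum (k : List X → R) (t : X → X) : List (List X) → R
  | [] => 0
  | L :: W => k L * crosscapSum k t W + ∑ i : Fin W.length,
      (planarSum k (W.take i) * crosscapSum k t ((L ++ W[i]) :: W.drop (i + 1)) +
        crosscapSum k t (W.take i) * planarSum k ((L ++ W[i]) :: W.drop (i + 1)) +
        planarSum k ((L ++ dag t W[i]) :: (dag (dag t) (W.take i) ++ W.drop (i + 1))))
termination_by W => W.length
decreasing_by all_goals simp <;> first | omega | exact Fin.pos ‹_›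

variable (k : List X → R) (t : X → X)

@[simp] theorem planarSum_nil : planarSum k [] = 1 := by rw [planarSum]

@[simp] theorem crosscapSum_nil : crosscapSum k t [] = 0 := by rw [crosscapSum]

/-- The head `L` is the part of its block read so far. The block ends there, or `W[i]` is its next
element; then `W.take i` is enclosed in a gap and cannot be connected to anything outside. -/
theorem planarSum_cons (L : List X) (W : List (List X)) :
    planarSum k (L :: W) = k L * planarSum k W + ∑ i : Fin W.length,
      planarSum k (W.take i) * planarSum k ((L ++ W[i]) :: W.drop (i + 1)) := by
  rw [planarSum]

/-- When the block reaches `W[i]` without meeting the crosscap, the crosscap lies on the outer side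
or in the gap: these are the first two terms of the sum. In the third the block runs through it.
Cutting there leaves a disc, along whose boundary the gap is traversed backwards before the rest of
the word. -/
theorem crosscapSum_cons (L : List X) (W : List (List X)) :
    crosscapSum k t (L :: W) = k L * crosscapSum k t W + ∑ i : Fin W.length,
      (planarSum k (W.take i) * crosscapSum k t ((L ++ W[i]) :: W.drop (i + 1)) +
        crosscapSum k t (W.take i) * planarSum k ((L ++ W[i]) :: W.drop (i + 1)) +
        planarSum k ((L ++ dag t W[i]) :: (dag (dag t) (W.take i) ++ W.drop (i + 1)))) := by
  rw [crosscapSum]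

/-- The sum over the words of `Ws` of the crosscap sum of one word times the planar sums of the
others. -/
def crosscapTotal : List (List (List X)) → R
  | [] => 0
  | W :: Ws => crosscapSum k t W * (Ws.map (planarSum k)).prod +
      planarSum k W * crosscapTotal Ws

end wordSums

/-! ### Cycle counts -/

section cycles

variable {α : Type*}

theorem sameCycle_lift {β : Type*} {σ : Equiv.Perm α} {f : α → β} (hf : ∀ z, f (σ z) = f z)
    {x y : α} (h : σ.SameCycle x y) : f x = f y := by
  obtain ⟨i, rfl⟩ := h
  induction i using Int.induction_on generalizing x with
  | zero => rfl
  | succ i ih => rw [zpow_add, zpow_one, Equiv.Perm.mul_apply, ← ih, hf]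
  | pred i ih =>
    rw [zpow_sub, zpow_one, Equiv.Perm.mul_apply, ← ih, ← hf (σ⁻¹ x)]; simp

theorem numCycles_one [Fintype α] : numCycles (1 : Equiv.Perm α) = Fintype.card α := by
  rw [numCycles, ← Nat.card_eq_fintype_card]
  refine Nat.card_congr ⟨Quotient.lift id fun a b h => ?_, fun x => ⟦x⟧, ?_, fun _ => rfl⟩
  · exact sameCycle_lift (f := id) (fun _ => rfl) h
  · intro q; induction q using Quotient.inductionOn; rfl

theorem numCycles_conj (σ τ : Equiv.Perm α) : numCycles (τ * σ * τ⁻¹) = numCycles σ := by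
  refine (Nat.card_congr (Quotient.congr τ fun a b => ?_)).symm
  change σ.SameCycle a b ↔ (τ * σ * τ⁻¹).SameCycle (τ a) (τ b)
  rw [Equiv.Perm.sameCycle_conj]; simp

/-- The transposition takes x out of its cycle and makes it a fixed point. All cycle counts below
reduce to this one move. -/
theorem numCycles_swap_mul [Finite α] [DecidableEq α] (σ : Equiv.Perm α) (x : α) (h : σ x ≠ x) :
    numCycles (Equiv.swap x (σ x) * σ) = numCycles σ + 1 := by
  set ρ := Equiv.swap x (σ x) * σ with hρ
  have hx : ρ x = x := by simp [hρ]
  have hz : ∀ z, z ≠ x → σ z ≠ x → ρ z = σ z := fun z h1 h2 => by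
    simp only [hρ, Equiv.Perm.mul_apply]
    exact Equiv.swap_apply_of_ne_of_ne h2 fun h => h1 (σ.injective h)
  have hz' : ∀ z, σ z = x → ρ z = σ x := fun z h1 => by simp [hρ, h1]
  classical
  -- The old cycle of x survives as the class of σ x, since x itself is now isolated. So the old
  -- classes inject into the new ones, and only the class of x is missed.
  let f : α → Quotient (Equiv.Perm.SameCycle.setoid ρ) := fun z => if z = x then ⟦σ x⟧ else ⟦z⟧
  have step : ∀ z, (⟦ρ z⟧ : Quotient (Equiv.Perm.SameCycle.setoid ρ)) = ⟦z⟧ := fun z =>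
    Quotient.sound (Equiv.Perm.sameCycle_apply_left.mpr (Equiv.Perm.SameCycle.refl _ _))
  have hf : ∀ z, f (σ z) = f z := fun z => by
    by_cases h1 : z = x
    · simp [f, h1]
    · by_cases h2 : σ z = x
      · simp only [f, h1, h2, if_true, if_false]; rw [← hz' z h2, step]
      · simp only [f, h1, h2, if_false]; rw [← hz z h1 h2, step]
  let F : Quotient (Equiv.Perm.SameCycle.setoid σ) → Quotient (Equiv.Perm.SameCycle.setoid ρ) :=
    Quotient.lift f fun a b hab => sameCycle_lift hf hab
  have hb : ∀ z, (⟦σ z⟧ : Quotient (Equiv.Perm.SameCycle.setoid σ)) = ⟦z⟧ := fun z =>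
    Quotient.sound (Equiv.Perm.sameCycle_apply_left.mpr (Equiv.Perm.SameCycle.refl _ _))
  let g : Quotient (Equiv.Perm.SameCycle.setoid ρ) → Quotient (Equiv.Perm.SameCycle.setoid σ) :=
    Quotient.lift (fun z => ⟦z⟧) fun a b hab => sameCycle_lift (σ := ρ) (fun z => by
      by_cases h1 : z = x
      · rw [h1, hx]
      · by_cases h2 : σ z = x
        · rw [hz' z h2, hb, ← h2, hb]
        · rw [hz z h1 h2, hb]) hab
  have hgF : ∀ q, g (F q) = q := fun q => by
    induction q using Quotient.inductionOn with
    | h z =>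
      change g (f z) = _
      by_cases h1 : z = x
      · simp only [f, h1, if_true]; exact hb x
      · simp only [f, h1, if_false]; rfl
  have hne : ∀ q, F q ≠ ⟦x⟧ := fun q => by
    have key : ∀ z, z ≠ x → (⟦z⟧ : Quotient (Equiv.Perm.SameCycle.setoid ρ)) ≠ ⟦x⟧ :=
      fun z h1 h2 => by
        have h3 := sameCycle_lift (σ := ρ) (f := fun z => z = x)
          (fun z => by
            refine propext ⟨fun h => ρ.injective (h.trans hx.symm), fun h => ?_⟩
            rw [h]; exact hx) (Quotient.exact h2)
        exact h1 (h3.mpr rfl)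
    induction q using Quotient.inductionOn with
    | h z =>
      change f z ≠ _
      by_cases h1 : z = x
      · simp only [f, h1, if_true]; exact key _ h
      · simp only [f, h1, if_false]; exact key _ h1
  let e : Option (Quotient (Equiv.Perm.SameCycle.setoid σ)) →
      Quotient (Equiv.Perm.SameCycle.setoid ρ) := fun o => o.elim ⟦x⟧ F
  have he : Function.Bijective e := by
    constructor
    · rintro (_ | p) (_ | q) h
      · rfl
      · exact absurd h.symm (hne q)
      · exact absurd h (hne p)
      · exact congrArg some (by rw [← hgF p, ← hgF q]; exact congrArg g h)
    · intro q
      induction q using Quotient.inductionOn with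
      | h z =>
        by_cases h1 : z = x
        · exact ⟨none, by rw [h1]; rfl⟩
        · exact ⟨some ⟦z⟧, by change f z = _; simp only [f, h1, if_false]⟩
  rw [numCycles, numCycles, ← Nat.card_congr (Equiv.ofBijective e he), Finite.card_option]

theorem numCycles_mul_swap [Finite α] [DecidableEq α] (σ : Equiv.Perm α) (x y : α) (h : σ y = x)
    (hxy : x ≠ y) : numCycles (σ * Equiv.swap x y) = numCycles σ + 1 := by
  rw [← numCycles_conj _ (Equiv.swap x y), ← numCycles_swap_mul σ y (by rwa [h])]
  congr 1
  rw [h, Equiv.swap_inv, mul_assoc, mul_assoc, Equiv.swap_mul_self, mul_one, Equiv.swap_comm]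

theorem numCycles_inv (σ : Equiv.Perm α) : numCycles σ⁻¹ = numCycles σ := by
  refine Nat.card_congr (Quotient.congr (Equiv.refl α) fun a b => ?_)
  exact Equiv.Perm.sameCycle_inv

/-- Each transposition that isolates a point flips the sign and adds one cycle. The formula serves
only for the parity argument in `exists_sameCycle_of_numCycles`. -/
theorem sign_eq_neg_one_pow [Fintype α] [DecidableEq α] (σ : Equiv.Perm α) :
    (Equiv.Perm.sign σ : ℤ) = (-1) ^ (Fintype.card α + numCycles σ) := by
  induction hn : σ.support.card using Nat.strong_induction_on generalizing σ with
  | _ n ih =>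
    by_cases h1 : σ = 1
    · rw [h1, numCycles_one, ← two_mul, pow_mul]; simp
    · obtain ⟨x, hx⟩ : ∃ x, σ x ≠ x := by
        by_contra! h; exact h1 (Equiv.ext h)
      have h2 := ih _ (by rw [← hn]; exact Equiv.Perm.card_support_swap_mul hx) _ rfl
      rw [numCycles_swap_mul σ x hx, Equiv.Perm.sign_mul, Equiv.Perm.sign_swap hx.symm] at h2
      rw [← add_assoc, pow_succ] at h2
      push_cast at h2
      linarith

end cycles

/-! ### Loops of a permutation -/

section loops

variable {α : Type*}

/-- The cycle of `σ` through `x`, listed from `x`. -/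
noncomputable def loopFrom (σ : Equiv.Perm α) (x : α) : List α :=
  (List.range (Function.minimalPeriod σ x)).map fun i => (σ ^ i) x

theorem isChain_cons_iff_pow (σ : Equiv.Perm α) (x : α) (l : List α) :
    List.IsChain (fun u v => v = σ u) (x :: l) ↔
      x :: l = (List.range (l.length + 1)).map fun i => (σ ^ i) x := by
  induction l generalizing x with
  | nil => simp
  | cons y l ih =>
    rw [List.isChain_cons_cons, ih, List.length_cons, List.range_succ_eq_map (n := l.length + 1)]
    simp only [List.map_cons, List.map_map, pow_zero, Equiv.Perm.one_apply, List.cons.injEq,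
      true_and]
    have e : (fun i => (σ ^ i) x) ∘ Nat.succ = fun i => (σ ^ i) (σ x) := by
      funext i; simp [pow_succ]
    rw [e]
    constructor
    · rintro ⟨rfl, h⟩; exact h
    · intro h
      have h2 : y = σ x := by
        rw [List.range_succ_eq_map] at h
        simpa using (List.cons.inj h).1
      exact ⟨h2, h2 ▸ h⟩

/-- This criterion identifies the loops of a modified permutation: a repetition-free list that
follows the permutation and closes up must be the whole cycle. -/
theorem loopFrom_eq_of_isChain {σ : Equiv.Perm α} {x : α} {l : List α} (hn : (x :: l).Nodup)
    (hc : List.IsChain (fun u v => v = σ u) (x :: l ++ [x])) : loopFrom σ x = x :: l := by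
  rw [List.cons_append, isChain_cons_iff_pow, List.length_append, List.length_singleton] at hc
  have hn' := List.nodup_iff_injective_getElem.mp hn
  have hget : ∀ i (hi : i < (x :: l).length), (x :: l)[i] = (σ ^ i) x := by
    intro i hi
    have h1 : (x :: (l ++ [x]))[i]? = some ((x :: l)[i]) := by
      rw [← List.cons_append, List.getElem?_append_left hi, List.getElem?_eq_getElem hi]
    rw [hc, List.getElem?_map, List.getElem?_range (by simp at hi; omega)] at h1
    simpa using h1.symm
  have hper : (σ ^ (l.length + 1)) x = x := by
    have h1 : (x :: (l ++ [x]))[l.length + 1]? = some x := by simp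
    rw [hc, List.getElem?_map, List.getElem?_range (by omega)] at h1
    simpa using h1
  have hper' : Function.IsPeriodicPt σ (l.length + 1) x := by
    rw [Function.IsPeriodicPt, ← Equiv.Perm.coe_pow]; exact hper
  have hpos := hper'.minimalPeriod_pos (Nat.succ_pos l.length)
  have hle := hper'.minimalPeriod_le (Nat.succ_pos l.length)
  have hmin : Function.minimalPeriod σ x = l.length + 1 := by
    by_contra hne
    have hlt : Function.minimalPeriod σ x < (x :: l).length := lt_of_le_of_ne hle hne
    have h1 := hget _ hlt
    rw [Equiv.Perm.coe_pow, Function.iterate_minimalPeriod] at h1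
    have := hn' (a₁ := ⟨_, hlt⟩) (a₂ := ⟨0, by simp⟩) h1
    exact hpos.ne' (congrArg Fin.val this)
  rw [loopFrom, hmin]
  refine List.ext_getElem (by simp) fun i h1 h2 => ?_
  rw [hget i h2]; simp

theorem minimalPeriod_pos [Finite α] (σ : Equiv.Perm α) (x : α) :
    0 < Function.minimalPeriod σ x :=
  Function.minimalPeriod_pos_of_mem_periodicPts
    (Function.Injective.mem_periodicPts σ.injective x)

theorem exists_loopFrom_eq [Finite α] (σ : Equiv.Perm α) (x : α) :
    ∃ l, loopFrom σ x = x :: l ∧ (x :: l).Nodup ∧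
      List.IsChain (fun u v => v = σ u) (x :: l ++ [x]) := by
  have hpos := minimalPeriod_pos σ x
  obtain ⟨p, hp⟩ : ∃ p, Function.minimalPeriod σ x = p + 1 :=
    ⟨Function.minimalPeriod σ x - 1, by omega⟩
  have e : (List.range (p + 1)).map (fun i => (σ ^ i) x) =
      x :: (List.range p).map fun i => (σ ^ (i + 1)) x := by
    rw [List.range_succ_eq_map]; simp [Function.comp_def]
  refine ⟨_, by rw [loopFrom, hp, e], ?_, ?_⟩
  · rw [← e]
    refine (List.nodup_map_iff_inj_on List.nodup_range).mpr fun i hi j hj hij => ?_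
    rw [List.mem_range] at hi hj
    simp only [Equiv.Perm.coe_pow] at hij
    exact (Function.iterate_eq_iterate_iff_of_lt_minimalPeriod (by omega) (by omega)).mp hij
  · rw [List.cons_append, isChain_cons_iff_pow, ← List.cons_append, ← e]
    simp only [List.length_append, List.length_map, List.length_range, List.length_singleton]
    have : (σ ^ (p + 1)) x = x := by
      rw [← hp, Equiv.Perm.coe_pow, Function.iterate_minimalPeriod]
    conv_rhs => rw [List.range_succ]
    simp [this]

theorem mem_loopFrom [Finite α] {σ : Equiv.Perm α} {x y : α} :
    y ∈ loopFrom σ x ↔ σ.SameCycle x y := by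
  rw [loopFrom, List.mem_map]
  constructor
  · rintro ⟨m, -, rfl⟩
    exact ⟨m, by simp⟩
  · intro h
    obtain ⟨m, hm⟩ := h.exists_nat_pow_eq
    refine ⟨m % Function.minimalPeriod σ x,
      List.mem_range.mpr (Nat.mod_lt _ (minimalPeriod_pos σ x)), ?_⟩
    rw [Equiv.Perm.coe_pow, Function.iterate_mod_minimalPeriod_eq, ← hm, Equiv.Perm.coe_pow]

end loops

/-! ### Symmetric permutations -/

section symmetric

variable {P : Type*} {X R : Type*} [CommRing R]

/-- A function on words that is `1` on the empty word and invariant under cyclic rotations and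
under conjugation. -/
structure IsDihedral (k : List X → R) (t : X → X) : Prop where
  nil : k [] = 1
  rotate : ∀ L M, k (L ++ M) = k (M ++ L)
  dag : ∀ L, k (dag t L) = k L

/-- A permutation `σ` with `δ σ δ = σ⁻¹` (for an involution `δ`) such that `σ δ` has no fixed
point. -/
def SymPerm (δ σ : Equiv.Perm P) : Prop := σ * δ * σ = δ ∧ ∀ z, σ z ≠ δ z

/-- The relation generated by `σ` and `δ`, whose classes are the conjugate pairs of cycles. -/
def pairRel (δ σ : Equiv.Perm P) (z w : P) : Prop := w = σ z ∨ w = δ z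

variable {δ σ : Equiv.Perm P} {k : List X → R} {t : X → X} {a : P → List X}

theorem SymPerm.apply_delta (h : SymPerm δ σ) {x y : P} (hxy : σ x = y) : σ (δ y) = δ x := by
  have := congrArg (fun f : Equiv.Perm P => f x) h.1
  simpa [hxy] using this

theorem SymPerm.pow_apply (h : SymPerm δ σ) (i : ℕ) (x : P) : (σ ^ i) (δ ((σ ^ i) x)) = δ x := by
  induction i generalizing x with
  | zero => rfl
  | succ i ih =>
    nth_rewrite 1 [pow_succ]
    rw [pow_succ', Equiv.Perm.mul_apply, Equiv.Perm.mul_apply, h.apply_delta rfl, ih]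

theorem quot_mk_eq_iff (hδ : ∀ x, δ (δ x) = x) (h : SymPerm δ σ) (z w : P) :
    Quot.mk (pairRel δ σ) z = Quot.mk (pairRel δ σ) w ↔ σ.SameCycle z w ∨ σ.SameCycle z (δ w) := by
  constructor
  · intro hq
    let f : Quot (pairRel δ σ) → Prop := Quot.lift (fun w => σ.SameCycle z w ∨ σ.SameCycle z (δ w))
      fun u v huv => by
        rcases huv with rfl | rfl
        · rw [Equiv.Perm.sameCycle_apply_right, ← h.apply_delta (rfl : σ u = σ u),
            Equiv.Perm.sameCycle_apply_right]
        · rw [hδ, or_comm]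
    have : f (Quot.mk _ z) := Or.inl (Equiv.Perm.SameCycle.refl _ _)
    rw [hq] at this
    exact this
  · have key : ∀ w, σ.SameCycle z w → Quot.mk (pairRel δ σ) z = Quot.mk (pairRel δ σ) w :=
      fun w hw => sameCycle_lift (f := Quot.mk (pairRel δ σ))
        (fun z => (Quot.sound (r := pairRel δ σ) (Or.inl rfl)).symm) hw
    rintro (hw | hw)
    · exact key _ hw
    · rw [key _ hw]
      exact (Quot.sound (r := pairRel δ σ) (Or.inr rfl)).symm

variable [Fintype P]

noncomputable instance (δ σ : Equiv.Perm P) : Fintype (Quot (pairRel δ σ)) := Fintype.ofFinite _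

/-- The value of `k` at the concatenation of the letters along the cycle through `x`. -/
noncomputable def loopValue (k : List X → R) (a : P → List X) (σ : Equiv.Perm P) (x : P) : R :=
  k ((loopFrom σ x).map a).flatten

/-- The product over the conjugate pairs of cycles of the values of `k`. -/
noncomputable def pairProd (k : List X → R) (δ : Equiv.Perm P) (a : P → List X)
    (σ : Equiv.Perm P) : R :=
  ∏ q : Quot (pairRel δ σ), loopValue k a σ q.out

/-- Suppose σ^m x = δ x. Going half of the way by `pow_apply` produces a fixed point of δ if m is
even, and a point y with σ y = δ y if m is odd; both are excluded. Hence a cycle never equals its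
conjugate. -/
theorem SymPerm.not_sameCycle (h : SymPerm δ σ) (hδ' : ∀ x, δ x ≠ x) (x : P) :
    ¬ σ.SameCycle x (δ x) := by
  intro hx
  obtain ⟨m, hm⟩ := hx.exists_nat_pow_eq
  obtain ⟨l, rfl | rfl⟩ := m.even_or_odd'
  · rw [two_mul, pow_add, Equiv.Perm.mul_apply, ← h.pow_apply l x] at hm
    exact hδ' _ ((σ ^ l).injective hm).symm
  · rw [show 2 * l + 1 = l + (l + 1) by ring, pow_add, Equiv.Perm.mul_apply,
      ← h.pow_apply l x, pow_succ', Equiv.Perm.mul_apply] at hm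
    exact h.2 _ ((σ ^ l).injective hm)

theorem loopValue_apply (hk : IsDihedral k t) (a : P → List X) (σ : Equiv.Perm P) (x : P) :
    loopValue k a σ (σ x) = loopValue k a σ x := by
  obtain ⟨l, h1, h2, h3⟩ := exists_loopFrom_eq σ x
  cases l with
  | nil =>
    have : x = σ x := by simpa using h3
    rw [← this]
  | cons y l =>
    have hy : y = σ x := by
      rw [List.cons_append, List.cons_append, List.isChain_cons_cons] at h3; exact h3.1
    have h4 : loopFrom σ y = y :: (l ++ [x]) := by
      refine loopFrom_eq_of_isChain ?_ ?_
      · have := (List.nodup_append_comm (l₁ := [x]) (l₂ := y :: l)).mp h2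
        simpa using this
      · rw [List.cons_append, List.cons_append, List.isChain_cons_cons] at h3
        have h5 := h3.2
        rw [← List.cons_append] at h5 ⊢
        refine List.IsChain.append h5 (by simp) fun u hu v hv => ?_
        rw [List.getLast?_append] at hu
        simp only [List.getLast?_singleton, Option.some_or, Option.mem_some_iff] at hu
        simp only [List.head?_cons, Option.mem_some_iff] at hv
        rw [← hu, ← hv, hy]
    rw [loopValue, loopValue, ← hy, h1, h4]
    simpa using hk.rotate ((y :: l).map a).flatten (a x)

theorem loopValue_delta (hk : IsDihedral k t) (h : SymPerm δ σ)
    (ha : ∀ z, a (δ z) = dag t (a z)) (x : P) :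
    loopValue k a σ (δ x) = loopValue k a σ x := by
  obtain ⟨l, h1, h2, h3⟩ := exists_loopFrom_eq σ x
  have h4 : loopFrom σ (δ x) = δ x :: dag δ l := by
    have e : δ x :: dag δ l ++ [δ x] = dag δ (x :: l ++ [x]) := by simp
    refine loopFrom_eq_of_isChain ?_ ?_
    · have : (dag δ (x :: l)).Nodup := List.nodup_reverse.mpr (h2.map δ.injective)
      rw [dag_cons] at this
      simpa using (List.nodup_append_comm).mp this
    · rw [e, dag, List.isChain_reverse, List.isChain_map]
      exact h3.imp fun u v huv => (h.apply_delta huv.symm).symm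
  have h5 : ∀ l : List P, ((dag δ l).map a).flatten = dag t (l.map a).flatten := by
    intro l
    induction l with
    | nil => rfl
    | cons y l ih => simp [ih, ha]
  rw [loopValue, loopValue, h1, h4, ← hk.dag ((x :: l).map a).flatten]
  simpa [h5, ha] using hk.rotate (dag t (a x)) (dag t (l.map a).flatten)

/-- By dihedral invariance the value depends only on the conjugate pair, so the arbitrary
representative in `pairProd` is harmless. -/
theorem loopValue_out (hk : IsDihedral k t) (h : SymPerm δ σ)
    (ha : ∀ z, a (δ z) = dag t (a z)) (x : P) :
    loopValue k a σ (Quot.mk (pairRel δ σ) x).out = loopValue k a σ x := by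
  let f : Quot (pairRel δ σ) → R := Quot.lift (loopValue k a σ) fun z w hzw => by
    rcases hzw with rfl | rfl
    · exact (loopValue_apply hk a σ z).symm
    · exact (loopValue_delta hk h ha z).symm
  change f (Quot.mk _ _) = f (Quot.mk _ x)
  rw [Quot.out_eq]

end symmetric

/-! ### Peeling one point off a symmetric permutation -/

section peel

open Equiv

variable {P : Type*} [DecidableEq P] {δ σ : Perm P} {x y : P}

/-- Multiply by the transpositions `(x y)` on the left and `(δ x, δ y)` on the right. -/
def peelPerm (δ : Perm P) (x y : P) (σ : Perm P) : Perm P :=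
  swap x y * σ * (δ * swap x y * δ)

theorem delta_mul_self (hδ : ∀ x, δ (δ x) = x) : δ * δ = 1 := Equiv.ext hδ

theorem delta_swap_delta (hδ : ∀ x, δ (δ x) = x) (x y : P) :
    δ * swap x y * δ = swap (δ x) (δ y) := by
  have h1 : δ⁻¹ = δ := inv_eq_of_mul_eq_one_left (delta_mul_self hδ)
  have := Equiv.swap_apply_apply δ x y
  rw [this, h1]

theorem peelPerm_peelPerm (hδ : ∀ x, δ (δ x) = x) (x y : P) (σ : Perm P) :
    peelPerm δ x y (peelPerm δ x y σ) = σ := by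
  have h : δ * swap x y * δ * (δ * swap x y * δ) = 1 := by
    rw [delta_swap_delta hδ, swap_mul_self]
  rw [peelPerm, peelPerm, mul_assoc, mul_assoc (swap x y * σ), h, mul_one, ← mul_assoc,
    swap_mul_self, one_mul]

theorem SymPerm.peelPerm (hδ : ∀ x, δ (δ x) = x) (h : SymPerm δ σ) (x y : P) :
    SymPerm δ (peelPerm δ x y σ) := by
  have h1 : ∀ z, σ (δ (σ z)) = δ z := fun z => h.apply_delta rfl
  refine ⟨Equiv.ext fun z => ?_, fun z hz => ?_⟩
  · simp [_root_.peelPerm, hδ, h1]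
  · refine h.2 (δ (swap x y (δ z))) ?_
    rw [hδ]
    apply (swap x y).injective
    simpa [_root_.peelPerm, hδ] using hz

/-- From σ x = y follows σ(δ y) = δ x. The left transposition removes x from its cycle, and the
right one removes δ x from the conjugate cycle, so the symmetry is kept. -/
theorem peelPerm_apply_self (hδ : ∀ x, δ (δ x) = x) (hδ' : ∀ x, δ x ≠ x) (h : SymPerm δ σ)
    (hxy : σ x = y) : peelPerm δ x y σ x = x := by
  have h1 : y ≠ δ x := hxy ▸ h.2 x
  rw [peelPerm, delta_swap_delta hδ, Perm.mul_apply, Perm.mul_apply,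
    swap_apply_of_ne_of_ne (hδ' x).symm fun h => h1 (by rw [h, hδ]), hxy, swap_apply_right]

theorem peelPerm_apply_delta (hδ : ∀ x, δ (δ x) = x) (hδ' : ∀ x, δ x ≠ x) (h : SymPerm δ σ)
    (hxy : σ x = y) : peelPerm δ x y σ (δ x) = δ x := by
  have h1 : y ≠ δ x := hxy ▸ h.2 x
  rw [peelPerm, delta_swap_delta hδ, Perm.mul_apply, Perm.mul_apply, swap_apply_left,
    h.apply_delta hxy, swap_apply_of_ne_of_ne (hδ' x) h1.symm]

theorem peelPerm_apply_of_ne (hδ : ∀ x, δ (δ x) = x) (hxy : σ x = y)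
    {z : P} (h1 : z ≠ x) (h2 : z ≠ δ x) (h3 : z ≠ δ y) :
    peelPerm δ x y σ z = if σ z = x then y else σ z := by
  rw [peelPerm, delta_swap_delta hδ, Perm.mul_apply, Perm.mul_apply,
    swap_apply_of_ne_of_ne h2 h3]
  split_ifs with h4
  · rw [h4, swap_apply_left]
  · exact swap_apply_of_ne_of_ne h4 fun h => h1 (σ.injective (h.trans hxy.symm))

theorem numCycles_peelPerm [Finite P] (hδ : ∀ x, δ (δ x) = x) (hδ' : ∀ x, δ x ≠ x)
    (h : SymPerm δ σ) (hxy : σ x = y) (hne : y ≠ x) :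
    numCycles (peelPerm δ x y σ) = numCycles σ + 2 := by
  have h1 : y ≠ δ x := hxy ▸ h.2 x
  rw [peelPerm, delta_swap_delta hδ, numCycles_mul_swap _ _ _ _ fun h => hne (δ.injective h).symm]
  · have := numCycles_swap_mul σ x (by rwa [hxy])
    rw [hxy] at this
    rw [this]
  · rw [Perm.mul_apply, h.apply_delta hxy, swap_apply_of_ne_of_ne (hδ' x) h1.symm]

variable {X R : Type*} [CommRing R] {k : List X → R} {t : X → X} {a : P → List X}

/-- Erase the letters at `x` and `δ x`. -/
def eraseLetter (δ : Perm P) (a : P → List X) (x z : P) : List X :=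
  if z = x ∨ z = δ x then [] else a z

/-- Move the letter at `x` in front of the letter at `y`, and conjugately at `δ x`, `δ y`. -/
def mergeLetter (δ : Perm P) (t : X → X) (a : P → List X) (x y z : P) : List X :=
  if z = x ∨ z = δ x then [] else if z = y then a x ++ a y else
    if z = δ y then dag t (a x ++ a y) else a z

theorem eraseLetter_delta (hδ : ∀ x, δ (δ x) = x) (ha : ∀ z, a (δ z) = dag t (a z)) (x z : P) :
    eraseLetter δ a x (δ z) = dag t (eraseLetter δ a x z) := by
  have h1 : δ z = x ↔ z = δ x := ⟨fun h => by rw [← h, hδ], fun h => by rw [h, hδ]⟩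
  have h2 : δ z = δ x ↔ z = x := δ.injective.eq_iff
  simp only [eraseLetter, h1, h2, or_comm (a := z = δ x)]
  split_ifs
  · rfl
  · exact ha z

theorem mergeLetter_delta (hδ : ∀ x, δ (δ x) = x) (hδ' : ∀ x, δ x ≠ x) (ht : ∀ x, t (t x) = x)
    (ha : ∀ z, a (δ z) = dag t (a z)) (x y z : P) :
    mergeLetter δ t a x y (δ z) = dag t (mergeLetter δ t a x y z) := by
  have h1 : ∀ w, δ z = w ↔ z = δ w := fun w =>
    ⟨fun h => by rw [← h, hδ], fun h => by rw [h, hδ]⟩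
  have h2 : ∀ w, δ z = δ w ↔ z = w := fun w => δ.injective.eq_iff
  simp only [mergeLetter, h1, hδ, or_comm (a := z = δ x)]
  by_cases h3 : z = x ∨ z = δ x
  · simp [h3]
  · simp only [h3, if_false]
    by_cases h4 : z = δ y
    · subst h4
      simp only [if_true, if_neg (hδ' y), dag_dag ht]
    · by_cases h5 : z = y
      · subst h5; simp [h4]
      · simp only [h4, h5, if_false, ha]

theorem isChain_peelPerm (hδ : ∀ x, δ (δ x) = x) (hxy : σ x = y) {u : P} {l : List P}
    (hx : ∀ z ∈ u :: l, z ≠ x ∧ z ≠ δ x ∧ z ≠ δ y)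
    (hc : List.IsChain (fun u v => v = σ u) (u :: l)) :
    List.IsChain (fun u v => v = peelPerm δ x y σ u) (u :: l) := by
  induction l generalizing u with
  | nil => simp
  | cons v l ih =>
    rw [List.isChain_cons_cons] at hc ⊢
    refine ⟨?_, ih (fun z hz => hx z (by simp [hz])) hc.2⟩
    obtain ⟨h1, h2, h3⟩ := hx u (by simp)
    rw [peelPerm_apply_of_ne hδ hxy h1 h2 h3, if_neg, hc.1]
    rw [← hc.1]
    exact (hx v (by simp)).1

variable [Fintype P]

theorem loopValue_eraseLetter (h : ∀ z ∈ loopFrom σ y, z ≠ x ∧ z ≠ δ x) :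
    loopValue k (eraseLetter δ a x) σ y = loopValue k a σ y := by
  rw [loopValue, loopValue]
  congr 2
  exact List.map_congr_left fun z hz => by simp [eraseLetter, h z hz]

theorem loopFrom_of_apply_eq (h : σ x = x) : loopFrom σ x = [x] :=
  loopFrom_eq_of_isChain (by simp) (by simp [h])

/-- Points are never deleted from the ground set. A removed point stays as a fixed point carrying
the empty word, and its factor is `k [] = 1`. -/
theorem pairProd_of_apply_eq (hk : IsDihedral k t) (hδ : ∀ x, δ (δ x) = x)
    (h : SymPerm δ σ) (ha : ∀ z, a (δ z) = dag t (a z)) (hx : σ x = x) :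
    pairProd k δ a σ = k (a x) * pairProd k δ (eraseLetter δ a x) σ := by
  classical
  have ha' := eraseLetter_delta hδ ha x
  rw [pairProd, pairProd, ← Finset.mul_prod_erase univ _ (mem_univ (Quot.mk _ x)),
    ← Finset.mul_prod_erase univ (fun q : Quot (pairRel δ σ) =>
      loopValue k (eraseLetter δ a x) σ q.out) (mem_univ (Quot.mk _ x)),
    loopValue_out hk h ha, loopValue_out hk h ha']
  have e1 : loopValue k a σ x = k (a x) := by simp [loopValue, loopFrom_of_apply_eq hx]
  have e2 : loopValue k (eraseLetter δ a x) σ x = 1 := by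
    simp [loopValue, loopFrom_of_apply_eq hx, eraseLetter, hk.nil]
  rw [e1, e2, one_mul]
  congr 1
  refine Finset.prod_congr rfl fun q hq => ?_
  induction q using Quot.inductionOn with
  | h z =>
    rw [loopValue_out hk h ha, loopValue_out hk h ha', loopValue_eraseLetter]
    intro w hw
    rw [mem_loopFrom] at hw
    have hne : Quot.mk (pairRel δ σ) z ≠ Quot.mk _ x := (Finset.mem_erase.mp hq).1
    rw [Ne, quot_mk_eq_iff hδ h, not_or] at hne
    exact ⟨fun e => hne.1 (e ▸ hw), fun e => hne.2 (e ▸ hw)⟩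

theorem loopValue_peelPerm_self (hδ : ∀ x, δ (δ x) = x) (hδ' : ∀ x, δ x ≠ x) (h : SymPerm δ σ)
    (hxy : σ x = y) (hne : y ≠ x) :
    loopValue k (mergeLetter δ t a x y) (peelPerm δ x y σ) y = loopValue k a σ x := by
  obtain ⟨l, h1, h2, h3⟩ := exists_loopFrom_eq σ x
  have hnot : ∀ z ∈ loopFrom σ x, z ≠ δ x ∧ z ≠ δ y := fun z hz => by
    rw [mem_loopFrom] at hz
    refine ⟨fun e => h.not_sameCycle hδ' x (e ▸ hz), fun e => h.not_sameCycle hδ' y ?_⟩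
    rw [← hxy, Perm.sameCycle_apply_left, hxy, ← e]; exact hz
  rw [h1] at hnot
  cases l with
  | nil => exact absurd (hxy.symm.trans (show x = σ x by simpa using h3).symm) hne
  | cons w l =>
    rw [List.cons_append, List.cons_append, List.isChain_cons_cons] at h3
    obtain ⟨rfl, h3⟩ := h3
    rw [hxy] at h1 h2 h3 hnot
    have hl : ∀ z ∈ y :: l, z ≠ x ∧ z ≠ δ x ∧ z ≠ δ y := fun z hz =>
      ⟨fun e => (List.nodup_cons.mp h2).1 (e ▸ hz), hnot z (by simp [List.mem_cons.mp hz])⟩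
    have h4 : loopFrom (peelPerm δ x y σ) y = y :: l := by
      refine loopFrom_eq_of_isChain (List.nodup_cons.mp h2).2 ?_
      rw [← List.cons_append, List.isChain_append] at h3
      refine List.IsChain.append (isChain_peelPerm hδ hxy hl h3.1) (by simp) fun u hu v hv => ?_
      have h5 := h3.2.2 u hu x (by simp)
      obtain ⟨g1, g2, g3⟩ := hl u (List.mem_of_getLast? hu)
      rw [peelPerm_apply_of_ne hδ hxy g1 g2 g3, if_pos h5.symm]
      simpa using hv.symm
    rw [loopValue, loopValue, h1, h4]
    congr 1
    obtain ⟨g1, g2, g3⟩ := hl y (by simp)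
    have e : mergeLetter δ t a x y y = a x ++ a y := by simp [mergeLetter, g1, g2]
    have e' : l.map (mergeLetter δ t a x y) = l.map a := List.map_congr_left fun z hz => by
      obtain ⟨g1, g2, g3⟩ := hl z (by simp [hz])
      have g4 : z ≠ y := fun e => (List.nodup_cons.mp (List.nodup_cons.mp h2).2).1 (e ▸ hz)
      simp [mergeLetter, g1, g2, g3, g4]
    simp [e, e']

theorem loopValue_peelPerm_of_ne (hδ : ∀ x, δ (δ x) = x) (hxy : σ x = y) {z : P}
    (hz : ∀ w ∈ loopFrom σ z, w ≠ x ∧ w ≠ δ x ∧ w ≠ y ∧ w ≠ δ y) :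
    loopValue k (mergeLetter δ t a x y) (peelPerm δ x y σ) z = loopValue k a σ z := by
  obtain ⟨l, h1, h2, h3⟩ := exists_loopFrom_eq σ z
  rw [h1] at hz
  have h4 : loopFrom (peelPerm δ x y σ) z = z :: l := by
    refine loopFrom_eq_of_isChain h2 ?_
    rw [List.cons_append] at h3 ⊢
    refine isChain_peelPerm hδ hxy (fun w hw => ?_) h3
    obtain ⟨g1, g2, g3, g4⟩ := hz w (by simpa [or_comm, or_assoc] using hw)
    exact ⟨g1, g2, g4⟩
  rw [loopValue, loopValue, h1, h4]
  congr 2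
  refine List.map_congr_left fun w hw => ?_
  obtain ⟨g1, g2, g3, g4⟩ := hz w hw
  simp [mergeLetter, g1, g2, g3, g4]

/-- Since y follows x in the cycle, putting the letter of x in front of that of y leaves the
concatenation along the cycle unchanged after x has been taken out. -/
theorem pairProd_peelPerm (hk : IsDihedral k t) (hδ : ∀ x, δ (δ x) = x) (hδ' : ∀ x, δ x ≠ x)
    (ht : ∀ x, t (t x) = x) (h : SymPerm δ σ) (ha : ∀ z, a (δ z) = dag t (a z)) (hxy : σ x = y)
    (hne : y ≠ x) :
    pairProd k δ a σ = pairProd k δ (mergeLetter δ t a x y) (peelPerm δ x y σ) := by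
  set ρ := peelPerm δ x y σ with hρ
  have hs : SymPerm δ ρ := h.peelPerm hδ x y
  have ha' := mergeLetter_delta (a := a) hδ hδ' ht ha x y
  have hyx : y ≠ δ x := hxy ▸ h.2 x
  have hyd : δ y ≠ x := fun e => hyx (by rw [← e, hδ])
  have hσ : ∀ z, Quot.mk (pairRel δ ρ) (ρ z) = Quot.mk _ z := fun z =>
    (Quot.sound (r := pairRel δ ρ) (Or.inl rfl)).symm
  have hD : ∀ z, Quot.mk (pairRel δ ρ) (δ z) = Quot.mk _ z := fun z =>
    (Quot.sound (r := pairRel δ ρ) (Or.inr rfl)).symm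
  -- Peeling isolates x and δ x, so the old class of x has to be followed through y. The only new
  -- class is that of x and δ x, which carries empty words.
  let f : P → P := fun z => if z = x then y else if z = δ x then δ y else z
  have fx : f x = y := by simp [f]
  have fdx : f (δ x) = δ y := by simp [f, hδ' x]
  have fo : ∀ z, z ≠ x → z ≠ δ x → f z = z := fun z h1 h2 => by simp [f, h1, h2]
  have hfσ : ∀ z, Quot.mk (pairRel δ ρ) (f (σ z)) = Quot.mk _ (f z) := fun z => by
    by_cases h1 : z = x
    · rw [h1, hxy, fx, fo y hne hyx]
    by_cases h2 : z = δ y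
    · rw [h2, h.apply_delta hxy, fdx, fo _ hyd fun e => hne (δ.injective e)]
    by_cases h3 : z = δ x
    · rw [h3, fdx, ← hσ (δ y), hρ, peelPerm, delta_swap_delta hδ, Perm.mul_apply, Perm.mul_apply,
        swap_apply_right]
      have g1 : σ (δ x) ≠ x := fun e => h.2 (δ x) (by rw [e, hδ])
      have g2 : σ (δ x) ≠ y := fun e => hδ' x (σ.injective (e.trans hxy.symm))
      have g3 : σ (δ x) ≠ δ x := fun e => h2 (h3.trans (σ.injective (e.trans
        (h.apply_delta hxy).symm)))
      rw [swap_apply_of_ne_of_ne g1 g2, fo _ g1 g3]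
    · rw [fo z h1 h3, ← hσ z, hρ, peelPerm_apply_of_ne hδ hxy h1 h3 h2]
      split_ifs with h4
      · rw [h4, fx]
      · rw [fo _ h4 fun e => h2 (σ.injective (e.trans (h.apply_delta hxy).symm))]
  have hfD : ∀ z, Quot.mk (pairRel δ ρ) (f (δ z)) = Quot.mk _ (f z) := fun z => by
    by_cases h1 : z = x
    · rw [h1, fdx, fx, hD]
    by_cases h2 : z = δ x
    · rw [h2, hδ, fdx, fx, hD]
    · rw [fo z h1 h2, fo (δ z) (fun e => h2 (by rw [← e, hδ])) fun e => h1 (δ.injective e), hD]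
  let F : Quot (pairRel δ σ) → Quot (pairRel δ ρ) := Quot.lift (fun z => Quot.mk _ (f z))
    fun u v huv => by
      rcases huv with rfl | rfl
      · exact (hfσ u).symm
      · exact (hfD u).symm
  have bσ : ∀ z, Quot.mk (pairRel δ σ) (σ z) = Quot.mk _ z := fun z =>
    (Quot.sound (r := pairRel δ σ) (Or.inl rfl)).symm
  have bD : ∀ z, Quot.mk (pairRel δ σ) (δ z) = Quot.mk _ z := fun z =>
    (Quot.sound (r := pairRel δ σ) (Or.inr rfl)).symm
  have bt : ∀ z, Quot.mk (pairRel δ σ) (swap x y z) = Quot.mk _ z := fun z => by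
    rw [swap_apply_def]
    split_ifs with h1 h2
    · rw [h1, ← hxy, bσ]
    · rw [h2, ← hxy, bσ]
    · rfl
  let G : Quot (pairRel δ ρ) → Quot (pairRel δ σ) := Quot.lift (fun z => Quot.mk _ z)
    fun u v huv => by
      rcases huv with rfl | rfl
      · simp only [hρ, peelPerm, Perm.mul_apply, bt, bσ, bD]
      · exact (bD u).symm
  have hGF : ∀ q, G (F q) = q := fun q => by
    induction q using Quot.inductionOn with
    | h z =>
      change Quot.mk _ (f z) = _
      by_cases h1 : z = x
      · rw [h1, fx, ← hxy, bσ]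
      by_cases h2 : z = δ x
      · rw [h2, fdx, bD, bD, ← hxy, bσ]
      · rw [fo z h1 h2]
  rw [pairProd, pairProd]
  refine Fintype.prod_of_injective F (Function.LeftInverse.injective hGF) _ _ ?_ ?_
  · intro q hq
    induction q using Quot.inductionOn with
    | h z =>
      have hz : z = x ∨ z = δ x := by
        by_contra hz
        rw [not_or] at hz
        exact hq ⟨Quot.mk _ z, by change Quot.mk _ (f z) = _; rw [fo z hz.1 hz.2]⟩
      have e : Quot.mk (pairRel δ ρ) z = Quot.mk _ x := by
        rcases hz with rfl | rfl
        · rfl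
        · exact hD x
      rw [e, loopValue_out hk hs ha', loopValue,
        loopFrom_of_apply_eq (peelPerm_apply_self hδ hδ' h hxy)]
      simp [mergeLetter, hk.nil]
  · intro q
    induction q using Quot.inductionOn with
    | h z =>
      by_cases hz : Quot.mk (pairRel δ σ) z = Quot.mk _ x
      · rw [hz]
        change _ = loopValue k _ ρ (Quot.mk _ (f x)).out
        rw [fx, loopValue_out hk h ha, loopValue_out hk hs ha',
          loopValue_peelPerm_self hδ hδ' h hxy hne]
      · have hz' : ∀ w ∈ loopFrom σ z, w ≠ x ∧ w ≠ δ x ∧ w ≠ y ∧ w ≠ δ y := by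
          intro w hw
          rw [mem_loopFrom] at hw
          have e := (quot_mk_eq_iff hδ h z w).mpr (Or.inl hw)
          rw [e] at hz
          refine ⟨fun e => hz (by rw [e]), fun e => hz (by rw [e, bD]),
            fun e => hz (by rw [e, ← hxy, bσ]), fun e => hz (by rw [e, bD, ← hxy, bσ])⟩
        have hself : z ∈ loopFrom σ z := mem_loopFrom.mpr (Perm.SameCycle.refl _ _)
        change _ = loopValue k _ ρ (Quot.mk _ (f z)).out
        rw [fo z (hz' z hself).1 (hz' z hself).2.1, loopValue_out hk h ha,
          loopValue_out hk hs ha', loopValue_peelPerm_of_ne hδ hxy hz']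

end peel

/-! ### Peeling the sum over symmetric permutations -/

section genusSum

open Equiv

variable {P : Type*} [DecidableEq P] {δ σ γ : Perm P} {x y : P}

/-- The permutation `γ δ γ⁻¹ δ`. -/
def annulusOf (δ γ : Perm P) : Perm P := γ * δ * γ⁻¹ * δ

/-- The two outer transpositions are absorbed into γ and γ⁻¹. Peeling therefore keeps the form
γδγ⁻¹δ, and it suffices to follow γ. -/
theorem peelPerm_annulusOf (hδ : ∀ x, δ (δ x) = x) (x y : P) (γ : Perm P) :
    peelPerm δ x y (annulusOf δ γ) = annulusOf δ (swap x y * γ) := by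
  have h := delta_mul_self hδ
  simp only [peelPerm, annulusOf, mul_inv_rev, swap_inv, mul_assoc]
  rw [← mul_assoc δ δ, h, one_mul]

variable {X R : Type*} [CommRing R] {k : List X → R} {t : X → X} {a : P → List X}
variable [Fintype P]

open Classical in
/-- The sum of `pairProd` over the symmetric permutations `σ` supported in `B` with
`#(σ) + #(σ⁻¹ Γ) = j`. -/
noncomputable def genusSum (k : List X → R) (δ : Perm P) (B : Set P) (Γ : Perm P)
    (a : P → List X) (j : ℕ) : R :=
  ∑ σ ∈ univ.filter (fun σ : Perm P => SymPerm δ σ ∧ (∀ z, z ∉ B → σ z = z) ∧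
    numCycles σ + numCycles (σ⁻¹ * Γ) = j), pairProd k δ a σ

/-- Peeling σ and Γ together only conjugates σ⁻¹Γ. -/
theorem numCycles_peelPerm_inv_mul (x y : P) (σ Γ : Perm P) :
    numCycles ((peelPerm δ x y σ)⁻¹ * peelPerm δ x y Γ) = numCycles (σ⁻¹ * Γ) := by
  have e : (peelPerm δ x y σ)⁻¹ * peelPerm δ x y Γ =
      (δ * swap x y * δ)⁻¹ * (σ⁻¹ * Γ) * ((δ * swap x y * δ)⁻¹)⁻¹ := by
    simp only [peelPerm]; group
  rw [e, numCycles_conj]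

open Classical in
-- The permutations are sorted by y = σ x. If y ≠ x, peeling is a bijection that adds two cycles to
-- σ and none to σ⁻¹Γ, whence `j + 2`.
theorem genusSum_peel (hk : IsDihedral k t) (hδ : ∀ x, δ (δ x) = x) (hδ' : ∀ x, δ x ≠ x)
    (ht : ∀ x, t (t x) = x) (ha : ∀ z, a (δ z) = dag t (a z)) {B : Set P} (Γ : Perm P) (j : ℕ)
    (hB : ∀ z, δ z ∈ B ↔ z ∈ B) (hx : x ∈ B) :
    genusSum k δ B Γ a j = k (a x) * genusSum k δ (B \ {x, δ x}) Γ (eraseLetter δ a x) j +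
      ∑ y ∈ univ.filter (fun y => y ∈ B \ {x, δ x}), genusSum k δ (B \ {x, δ x})
        (peelPerm δ x y Γ) (mergeLetter δ t a x y) (j + 2) := by
  have hfib : ∀ y, y ≠ x → ∑ σ ∈ (univ.filter (fun σ : Perm P => SymPerm δ σ ∧
      (∀ z, z ∉ B → σ z = z) ∧ numCycles σ + numCycles (σ⁻¹ * Γ) = j)).filter (fun σ => σ x = y),
        pairProd k δ a σ = if y ∈ B \ {x, δ x} then genusSum k δ (B \ {x, δ x})
        (peelPerm δ x y Γ) (mergeLetter δ t a x y) (j + 2) else 0 := by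
    intro y hne
    split_ifs with hy
    · have hyB : y ∈ B := hy.1
      have hyx : y ≠ δ x := fun e => hy.2 (by simp [e])
      have hdy : δ y ≠ x := fun e => hyx (by rw [← e, hδ])
      have hdxy : δ y ≠ δ x := fun e => hne (δ.injective e)
      have hBx : δ x ∈ B := (hB x).mpr hx
      have hBy : δ y ∈ B := (hB y).mpr hyB
      refine Finset.sum_nbij' (peelPerm δ x y) (peelPerm δ x y) ?_ ?_ ?_ ?_ ?_
      · intro σ hσ
        simp only [Finset.mem_filter, Finset.mem_univ, true_and] at hσ ⊢
        obtain ⟨⟨h1, h2, h3⟩, hxy⟩ := hσ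
        refine ⟨h1.peelPerm hδ x y, fun z hz => ?_, ?_⟩
        · by_cases e1 : z = x
          · rw [e1, peelPerm_apply_self hδ hδ' h1 hxy]
          by_cases e2 : z = δ x
          · rw [e2, peelPerm_apply_delta hδ hδ' h1 hxy]
          have hzB : z ∉ B := fun h => hz ⟨h, by simp [e1, e2]⟩
          rw [peelPerm_apply_of_ne hδ hxy e1 e2 fun e => hzB (e ▸ hBy), h2 z hzB, if_neg e1]
        · rw [numCycles_peelPerm_inv_mul, numCycles_peelPerm hδ hδ' h1 hxy hne]
          omega
      · intro σ hσ
        simp only [Finset.mem_filter, Finset.mem_univ, true_and] at hσ ⊢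
        obtain ⟨h1, h2, h3⟩ := hσ
        have hσx : peelPerm δ x y σ x = y := by
          rw [peelPerm, delta_swap_delta hδ, Perm.mul_apply, Perm.mul_apply,
            swap_apply_of_ne_of_ne (hδ' x).symm hdy.symm, h2 x (by simp), swap_apply_left]
        have hs := h1.peelPerm hδ x y
        refine ⟨⟨hs, fun z hz => ?_, ?_⟩, hσx⟩
        · rw [peelPerm, delta_swap_delta hδ, Perm.mul_apply, Perm.mul_apply,
            swap_apply_of_ne_of_ne (a := δ x) (b := δ y) (fun e => hz (by rwa [e]))
              (fun e => hz (by rwa [e])), h2 z fun h => hz h.1,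
            swap_apply_of_ne_of_ne (fun e => hz (by rwa [e])) (fun e => hz (by rwa [e]))]
        · have e1 := numCycles_peelPerm hδ hδ' hs hσx hne
          rw [peelPerm_peelPerm hδ] at e1
          have e2 := numCycles_peelPerm_inv_mul (δ := δ) x y (peelPerm δ x y σ) Γ
          rw [peelPerm_peelPerm hδ] at e2
          omega
      · exact fun σ _ => peelPerm_peelPerm hδ x y σ
      · exact fun σ _ => peelPerm_peelPerm hδ x y σ
      · intro σ hσ
        simp only [Finset.mem_filter, Finset.mem_univ, true_and] at hσ
        exact pairProd_peelPerm hk hδ hδ' ht hσ.1.1 ha hσ.2 hne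
    -- The value y = δ x is forbidden by symmetry, and a y outside B is already fixed by σ.
    · refine Finset.sum_eq_zero fun σ hσ => ?_
      simp only [Finset.mem_filter, Finset.mem_univ, true_and] at hσ
      obtain ⟨⟨h1, h2, -⟩, hxy⟩ := hσ
      refine absurd ⟨?_, ?_⟩ hy
      · by_contra hyB
        exact hne (σ.injective ((h2 y hyB).trans hxy.symm))
      · rintro (e | e)
        · exact hne e
        · exact h1.2 x (hxy.trans e)
  rw [genusSum, ← Finset.sum_fiberwise _ (fun σ : Perm P => σ x),
    ← Finset.add_sum_erase univ _ (mem_univ x)]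
  congr 1
  · rw [genusSum, Finset.mul_sum]
    refine Finset.sum_congr ?_ fun σ hσ => ?_
    · ext σ
      simp only [Finset.mem_filter, Finset.mem_univ, true_and]
      constructor
      · rintro ⟨⟨h1, h2, h3⟩, h4⟩
        refine ⟨h1, fun z hz => ?_, h3⟩
        by_cases e1 : z = x
        · rw [e1, h4]
        by_cases e2 : z = δ x
        · rw [e2, h1.apply_delta h4]
        exact h2 z fun h => hz ⟨h, by simp [e1, e2]⟩
      · rintro ⟨h1, h2, h3⟩
        exact ⟨⟨h1, fun z hz => h2 z fun h => hz h.1, h3⟩, h2 x (by simp)⟩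
    · simp only [Finset.mem_filter, Finset.mem_univ, true_and] at hσ
      exact pairProd_of_apply_eq hk hδ hσ.1 ha (hσ.2.1 x (by simp))
  · rw [Finset.sum_filter, Finset.sum_congr rfl fun y hy => hfib y (Finset.mem_erase.mp hy).1]
    rw [← Finset.add_sum_erase univ _ (mem_univ x)]
    simp

/-- Here every admissible σ fixes x and δ x, so cutting x out of γ multiplies σ⁻¹Γ by two
transpositions, each of which adds a cycle. -/
theorem genusSum_annulusOf_of_apply_ne (hδ : ∀ x, δ (δ x) = x) (hδ' : ∀ x, δ x ≠ x) {B : Set P}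
    (hx : x ∉ B) (hdx : δ x ∉ B) (h1 : γ x ≠ x) (h2 : γ (δ x) = δ x) (j : ℕ) :
    genusSum k δ B (annulusOf δ γ) a j =
      genusSum k δ B (annulusOf δ (swap x (γ x) * γ)) a (j + 2) := by
  classical
  rw [genusSum, genusSum]
  refine Finset.sum_congr (Finset.filter_congr fun σ _ => ?_) fun _ _ => rfl
  refine and_congr_right fun hs => and_congr_right fun hf => ?_
  have e : numCycles (σ⁻¹ * annulusOf δ (swap x (γ x) * γ)) =
      numCycles (σ⁻¹ * annulusOf δ γ) + 2 := by
    have sx : σ⁻¹ x = x := Perm.inv_eq_iff_eq.mpr (hf x hx).symm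
    have sdx : σ⁻¹ (δ x) = δ x := Perm.inv_eq_iff_eq.mpr (hf _ hdx).symm
    have gx : γ⁻¹ (δ x) = δ x := Perm.inv_eq_iff_eq.mpr h2.symm
    have Γx : annulusOf δ γ x = γ x := by
      simp only [annulusOf, Perm.mul_apply, gx, hδ]
    have Γu : annulusOf δ γ (δ (γ x)) = δ x := by simp [annulusOf, hδ, h2]
    have Kx : (σ⁻¹ * annulusOf δ γ) x = σ⁻¹ (γ x) := by rw [Perm.mul_apply, Γx]
    have hxu : δ x ≠ γ x := fun e => hδ' x (γ.injective (h2.trans e))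
    have e1 : σ⁻¹ * annulusOf δ (swap x (γ x) * γ) =
        swap x ((σ⁻¹ * annulusOf δ γ) x) * (σ⁻¹ * annulusOf δ γ) * swap (δ x) (δ (γ x)) := by
      rw [← peelPerm_annulusOf hδ, peelPerm, delta_swap_delta hδ, Kx]
      have := Equiv.mul_swap_eq_swap_mul σ⁻¹ x (γ x)
      rw [sx] at this
      simp only [← mul_assoc, this]
    rw [e1, numCycles_mul_swap, numCycles_swap_mul]
    · rw [Kx]
      intro e
      exact h1 (by rw [Perm.inv_eq_iff_eq, hf x hx] at e; exact e)
    · rw [Kx, Perm.mul_apply, Perm.mul_apply, Γu, sdx]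
      refine swap_apply_of_ne_of_ne (hδ' x) fun e => hxu ?_
      rw [eq_comm, Perm.inv_eq_iff_eq, hf _ hdx] at e
      exact e.symm
    · exact fun e => h1 (δ.injective e).symm
  rw [e]
  omega

end genusSum

/-! ### Words of signed points -/

section words

open Equiv

variable {P : Type*} [DecidableEq P] {δ : Perm P} {x y z : P}

/-- The product of the cyclic permutations given by the words. -/
def wordPerm (Ws : List (List P)) : Perm P := (Ws.map List.formPerm).prod

/-- The points of `l` and their images under `δ` are all distinct. -/
def SignedNodup (δ : Perm P) (l : List P) : Prop := l.Pairwise fun u v => v ≠ u ∧ v ≠ δ u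

/-- The points of `l` and their images under `δ`. -/
def signedSupport (δ : Perm P) (l : List P) : Set P := {z | z ∈ l ∨ δ z ∈ l}

theorem SignedNodup.nodup {l : List P} (h : SignedNodup δ l) : l.Nodup :=
  h.imp fun h => h.1.symm

theorem signedNodup_cons {l : List P} : SignedNodup δ (x :: l) ↔
    x ∉ l ∧ δ x ∉ l ∧ SignedNodup δ l := by
  rw [SignedNodup, List.pairwise_cons, ← and_assoc]
  refine and_congr_left' ⟨fun h => ⟨fun hx => (h x hx).1 rfl, fun hx => (h _ hx).2 rfl⟩,
    fun h v hv => ⟨fun e => h.1 (e ▸ hv), fun e => h.2 (e ▸ hv)⟩⟩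

theorem signedNodup_append {l m : List P} : SignedNodup δ (l ++ m) ↔
    SignedNodup δ l ∧ SignedNodup δ m ∧ ∀ z ∈ l, z ∉ m ∧ δ z ∉ m := by
  rw [SignedNodup, List.pairwise_append]
  refine and_congr_right' (and_congr_right' ⟨fun h z hz => ⟨fun hm => (h z hz z hm).1 rfl,
    fun hm => (h z hz _ hm).2 rfl⟩, fun h u hu v hv => ⟨fun e => (h u hu).1 (e ▸ hv),
    fun e => (h u hu).2 (e ▸ hv)⟩⟩)

theorem signedNodup_perm (hδ : ∀ x, δ (δ x) = x) {l m : List P} (h : l.Perm m) :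
    SignedNodup δ l ↔ SignedNodup δ m :=
  h.pairwise_iff fun h => ⟨h.1.symm, fun e => h.2 (by rw [e, hδ])⟩

theorem signedNodup_dag (hδ : ∀ x, δ (δ x) = x) {l : List P} :
    SignedNodup δ (dag δ l) ↔ SignedNodup δ l := by
  induction l with
  | nil => rfl
  | cons x l ih =>
    rw [dag_cons, signedNodup_perm hδ List.perm_append_comm, List.singleton_append,
      signedNodup_cons, signedNodup_cons, mem_dag hδ, mem_dag hδ, hδ, ih]

theorem formPerm_dag (hδ : ∀ x, δ (δ x) = x) (w : List P) :
    (dag δ w).formPerm = δ * w.formPerm⁻¹ * δ := by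
  have h1 : ∀ l : List P, (l.map δ).formPerm = δ * l.formPerm * δ := by
    intro l
    induction l with
    | nil => simp [delta_mul_self hδ]
    | cons x l ih =>
      cases l with
      | nil => simp [delta_mul_self hδ]
      | cons y l =>
        rw [List.map_cons] at ih
        rw [List.map_cons, List.map_cons, List.formPerm_cons_cons, ih, List.formPerm_cons_cons,
          ← delta_swap_delta hδ]
        simp only [mul_assoc]
        rw [← mul_assoc δ δ, delta_mul_self hδ, one_mul]
  rw [dag, List.formPerm_reverse, h1, mul_inv_rev, mul_inv_rev,
    inv_eq_of_mul_eq_one_left (delta_mul_self hδ), mul_assoc]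

/-- A word thus contributes two cycles to Γ, itself and its conjugate. -/
theorem annulusOf_formPerm_mul (hδ : ∀ x, δ (δ x) = x) (w : List P) (γ : Perm P) :
    annulusOf δ (w.formPerm * γ) = w.formPerm * annulusOf δ γ * (dag δ w).formPerm := by
  rw [formPerm_dag hδ, annulusOf, annulusOf, mul_inv_rev]
  simp only [mul_assoc]
  rw [← mul_assoc δ δ, delta_mul_self hδ, one_mul]

theorem wordPerm_apply_of_notMem {Ws : List (List P)} (h : z ∉ Ws.flatten) :
    wordPerm Ws z = z := by
  induction Ws with
  | nil => rfl
  | cons w Ws ih =>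
    rw [List.flatten_cons, List.mem_append, not_or] at h
    rw [wordPerm, List.map_cons, List.prod_cons, Perm.mul_apply, ← wordPerm, ih h.2,
      List.formPerm_apply_of_notMem h.1]

theorem annulusOf_wordPerm_apply (hδ : ∀ x, δ (δ x) = x) {Ws : List (List P)}
    (h : z ∉ Ws.flatten) (h' : δ z ∉ Ws.flatten) : annulusOf δ (wordPerm Ws) z = z := by
  have h1 : (wordPerm Ws)⁻¹ (δ z) = δ z :=
    Perm.inv_eq_iff_eq.mpr (wordPerm_apply_of_notMem h').symm
  simp only [annulusOf, Perm.mul_apply, h1, hδ, wordPerm_apply_of_notMem h]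

theorem commute_formPerm {f : Perm P} {w : List P} (h : ∀ z ∈ w, f z = z) :
    Commute f w.formPerm := by
  refine Perm.Disjoint.commute fun z => ?_
  by_cases hz : z ∈ w
  · exact Or.inl (h z hz)
  · exact Or.inr (List.formPerm_apply_of_notMem hz)

theorem commute_swap {f : Perm P} (hx : f x = x) (hy : f y = y) : Commute f (swap x y) := by
  rw [← List.formPerm_pair]
  exact commute_formPerm (by simp [hx, hy])

/-- A transposition of two points on one cycle cuts that cycle in two; read backwards, it joins two
cycles. The surgeries on words below all come from this. -/
theorem swap_mul_formPerm_append {U V : List P} (h : (x :: U ++ y :: V).Nodup) :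
    swap x y * (x :: U ++ y :: V).formPerm = (x :: U).formPerm * (y :: V).formPerm := by
  induction U generalizing x with
  | nil => simp
  | cons u U ih =>
    have h1 : (u :: U ++ y :: V).Nodup := (List.nodup_cons.mp h).2
    have hxu : x ≠ u := fun e => (List.nodup_cons.mp h).1 (by simp [e])
    have hxy : x ≠ y := fun e => (List.nodup_cons.mp h).1 (by simp [e])
    have huy : u ≠ y := fun e => (List.nodup_cons.mp h1).1 (by simp [e])
    have h2 := ih h1
    have h3 : (u :: U ++ y :: V).formPerm = swap u y * ((u :: U).formPerm * (y :: V).formPerm) := by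
      rw [← h2, ← mul_assoc, swap_mul_self, one_mul]
    rw [List.cons_append, List.cons_append, List.formPerm_cons_cons, ← List.cons_append, h3,
      List.formPerm_cons_cons x u U]
    simp only [← mul_assoc]
    congr 2
    have := Equiv.mul_swap_eq_swap_mul (swap x y) x u
    rw [swap_apply_left, swap_apply_of_ne_of_ne hxu.symm huy] at this
    rw [this, swap_comm u y, swap_mul_swap_mul_swap hxy hxu, swap_comm]

end words

/-! ### How transpositions act on the annular permutation of a list of words -/

section annulus

open Equiv

variable {P : Type*} [DecidableEq P] {δ : Perm P} {x y z : P}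

theorem wordPerm_cons (w : List P) (Ws : List (List P)) :
    wordPerm (w :: Ws) = w.formPerm * wordPerm Ws := by
  simp [wordPerm]

theorem wordPerm_append (Ws Ws' : List (List P)) :
    wordPerm (Ws ++ Ws') = wordPerm Ws * wordPerm Ws' := by
  simp [wordPerm]

theorem wordPerm_append_cons {A B : List (List P)} {w : List P}
    (h : (A ++ w :: B).flatten.Nodup) :
    wordPerm (A ++ w :: B) = w.formPerm * wordPerm (A ++ B) := by
  rw [wordPerm_append, wordPerm_cons, wordPerm_append, ← mul_assoc, ← mul_assoc]
  congr 1
  refine commute_formPerm fun z hz => wordPerm_apply_of_notMem fun hA => ?_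
  rw [List.flatten_append, List.nodup_append] at h
  exact h.2.2 z hA z (by simp [hz]) rfl

theorem formPerm_append_comm {U V : List P} (h : (U ++ V).Nodup) :
    (U ++ V).formPerm = (V ++ U).formPerm :=
  List.formPerm_eq_of_isRotated h ⟨U.length, by simp⟩

theorem swap_mul_wordPerm_split {U V : List P} {Ws : List (List P)}
    (h : (x :: (U ++ y :: V)).Nodup) :
    swap x y * wordPerm ((x :: (U ++ y :: V)) :: Ws) =
      wordPerm ((x :: U) :: (y :: V) :: Ws) := by
  rw [wordPerm_cons, wordPerm_cons, wordPerm_cons, ← mul_assoc, ← mul_assoc]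
  congr 1
  exact swap_mul_formPerm_append h

theorem swap_mul_wordPerm_join {w C D : List P} {A B : List (List P)}
    (h : ((x :: w) :: (A ++ (C ++ y :: D) :: B)).flatten.Nodup) :
    swap x y * wordPerm ((x :: w) :: (A ++ (C ++ y :: D) :: B)) =
      wordPerm ((x :: (w ++ y :: (D ++ C))) :: (A ++ B)) := by
  have h0 : ((A ++ (C ++ y :: D) :: B)).flatten.Nodup := by
    rw [List.flatten_cons, List.nodup_append] at h; exact h.2.1
  have h2 : (C ++ y :: D).Nodup := by
    rw [List.flatten_append, List.flatten_cons] at h0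
    exact (List.nodup_append.mp (List.nodup_append.mp h0).2.1).1
  have h1 : (x :: w ++ y :: (D ++ C)).Nodup := by
    refine (h.sublist (l₁ := x :: w ++ (C ++ y :: D)) ?_).perm ?_
    · rw [List.flatten_cons, List.flatten_append, List.flatten_cons]
      exact (List.sublist_append_of_sublist_right (List.sublist_append_left _ _)).append_left _
    · exact (List.perm_append_comm (l₁ := C) (l₂ := y :: D)).append_left _
  rw [wordPerm_cons, wordPerm_append_cons h0, wordPerm_cons, formPerm_append_comm h2,
    ← List.cons_append, ← mul_assoc ((x :: w).formPerm), List.cons_append,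
    ← swap_mul_formPerm_append h1, ← mul_assoc, ← mul_assoc, swap_mul_self, one_mul,
    List.cons_append]

theorem SignedNodup.delta_notMem (hδ : ∀ x, δ (δ x) = x) (hδ' : ∀ x, δ x ≠ x) {l : List P}
    (hl : SignedNodup δ l) {u : P} (hu : u ∈ l) : δ u ∉ l := by
  induction l with
  | nil => simp
  | cons v l ih =>
    rw [signedNodup_cons] at hl
    intro hu'
    rcases List.mem_cons.mp hu with rfl | hu1
    · rcases List.mem_cons.mp hu' with h1 | h1
      · exact hδ' _ h1
      · exact hl.2.1 h1
    · rcases List.mem_cons.mp hu' with h1 | h1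
      · exact hl.2.1 (by rw [← h1, hδ]; exact hu1)
      · exact ih hl.2.2 hu1 h1

theorem SignedNodup.crosscap (hδ : ∀ x, δ (δ x) = x) (hδ' : ∀ x, δ x ≠ x) {U V : List P}
    (h : SignedNodup δ (x :: (U ++ z :: V))) :
    SignedNodup δ (δ x :: (V ++ δ z :: dag δ U)) := by
  have h' : ∀ u ∈ x :: (U ++ z :: V), δ u ∉ x :: (U ++ z :: V) :=
    fun u => h.delta_notMem hδ hδ'
  have hV : ∀ w ∈ V, δ w ∉ V := fun w h1 h2 => h' w (by simp [h1]) (by simp [h2])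
  simp only [signedNodup_cons, signedNodup_append, List.mem_append, List.mem_cons, mem_dag hδ,
    hδ, signedNodup_dag hδ, not_or] at h ⊢
  grind

/-- In Γ the word xUzV is accompanied by its conjugate cycle, which contains δz. The transposition
(x, δz) joins these two cycles into one, and (δx, z) cuts the result at other places. The outcome is
again a word with its conjugate, in which U is reversed and transposed: a twist, which does not
change the number of words. -/
theorem annulusOf_crosscap (hδ : ∀ x, δ (δ x) = x) (hδ' : ∀ x, δ x ≠ x) {U V : List P}
    {Ws : List (List P)} (h : SignedNodup δ ((x :: (U ++ z :: V)) :: Ws).flatten) :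
    annulusOf δ (swap x (δ z) * wordPerm ((x :: (U ++ z :: V)) :: Ws)) =
      annulusOf δ (wordPerm ((δ x :: (V ++ δ z :: dag δ U)) :: Ws)) := by
  rw [List.flatten_cons, signedNodup_append] at h
  obtain ⟨hw, -, hd⟩ := h
  have hA : ∀ u, u ∈ x :: (U ++ z :: V) ∨ δ u ∈ x :: (U ++ z :: V) →
      annulusOf δ (wordPerm Ws) u = u := by
    rintro u (hu | hu)
    · exact annulusOf_wordPerm_apply hδ (hd u hu).1 (hd u hu).2
    · exact annulusOf_wordPerm_apply hδ (by simpa [hδ] using (hd _ hu).2) (hd _ hu).1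
  set A := annulusOf δ (wordPerm Ws) with hAdef
  -- the concatenation of the word with its conjugate
  have hlong : (x :: (U ++ z :: V) ++ δ z :: (dag δ U ++ δ x :: dag δ V)).Nodup := by
    have e : (δ z :: (dag δ U ++ δ x :: dag δ V)).Perm (dag δ (x :: (U ++ z :: V))) := by
      rw [dag_cons, dag_append, dag_cons]
      have := List.perm_append_comm (l₁ := δ z :: (dag δ U ++ [δ x])) (l₂ := dag δ V)
      simpa using this
    rw [(e.append_left _).nodup_iff, List.nodup_append]
    refine ⟨hw.nodup, ((signedNodup_dag hδ).mpr hw).nodup, ?_⟩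
    rintro u hu v hv rfl
    rw [mem_dag hδ] at hv
    exact hw.delta_notMem hδ hδ' hu hv
  have hdagw : (dag δ (x :: (U ++ z :: V))).formPerm =
      (δ z :: (dag δ U ++ δ x :: dag δ V)).formPerm := by
    have e1 : dag δ (x :: (U ++ z :: V)) = dag δ V ++ (δ z :: (dag δ U ++ [δ x])) := by simp
    have h1 : (dag δ V ++ (δ z :: (dag δ U ++ [δ x]))).Nodup :=
      e1 ▸ ((signedNodup_dag hδ).mpr hw).nodup
    rw [e1, formPerm_append_comm h1]
    simp
  have hrev : ∀ (p q : P) (M N : List P), (N ++ p :: (M ++ [q])).Nodup →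
      (N ++ p :: (M ++ [q])).formPerm * swap q p = (N ++ [p]).formPerm * (M ++ [q]).formPerm := by
    intro p q M N hn
    have h1 : (q :: M.reverse ++ p :: N.reverse).Nodup := by
      have := List.nodup_reverse.mpr hn; simpa using this
    have h2 := congrArg (fun f => f⁻¹) (swap_mul_formPerm_append h1)
    simp only [mul_inv_rev, ← List.formPerm_reverse, swap_inv] at h2
    simpa using h2
  -- The left transposition produces the one long cycle of `hlong`; after a rotation the right one
  -- cuts it into the two cycles of the twisted word.
  have hX : swap x (δ z) * (x :: (U ++ z :: V)).formPerm *
      (dag δ (x :: (U ++ z :: V))).formPerm * swap (δ x) z =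
      (dag δ (δ x :: (V ++ δ z :: dag δ U))).formPerm *
        (δ x :: (V ++ δ z :: dag δ U)).formPerm := by
    rw [hdagw, mul_assoc (swap x (δ z)), ← swap_mul_formPerm_append hlong, ← mul_assoc,
      swap_mul_self, one_mul]
    have e1 : x :: (U ++ z :: V) ++ δ z :: (dag δ U ++ δ x :: dag δ V) =
        (x :: U ++ z :: (V ++ δ z :: (dag δ U ++ [δ x]))) ++ dag δ V := by simp
    have e2 : dag δ V ++ (x :: U ++ z :: (V ++ δ z :: (dag δ U ++ [δ x]))) =
        (dag δ V ++ x :: U) ++ z :: ((V ++ δ z :: dag δ U) ++ [δ x]) := by simp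
    have hn2 : ((dag δ V ++ x :: U) ++ z :: ((V ++ δ z :: dag δ U) ++ [δ x])).Nodup := by
      rw [← e2, List.nodup_append_comm, ← e1]; exact hlong
    rw [e1, formPerm_append_comm (e1 ▸ hlong), e2, hrev _ _ _ _ hn2]
    have hn3 : ((V ++ δ z :: dag δ U) ++ [δ x]).Nodup :=
      (List.nodup_cons.mp (List.nodup_append.mp hn2).2.1).2
    have hn4 : (dag δ V ++ (x :: U ++ [z])).Nodup := by
      refine hn2.sublist ?_
      rw [List.append_assoc]
      refine List.Sublist.append_left (List.Sublist.append_left ?_ _) _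
      simp
    rw [formPerm_append_comm hn3]
    congr 1
    have e3 : dag δ (δ x :: (V ++ δ z :: dag δ U)) = (U ++ [z] ++ dag δ V) ++ [x] := by
      simp [dag_dag hδ, hδ]
    have e4 : [x] ++ (U ++ [z] ++ dag δ V) = (x :: U ++ [z]) ++ dag δ V := by simp
    have hn5 : ((U ++ [z] ++ dag δ V) ++ [x]).Nodup := by
      rw [List.nodup_append_comm, e4, List.nodup_append_comm]; exact hn4
    rw [e3, formPerm_append_comm hn5, e4, formPerm_append_comm (List.nodup_append_comm.mp hn4)]
    simp
  have hsub : ∀ u ∈ δ x :: (V ++ δ z :: dag δ U), A u = u := by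
    intro u hu
    refine hA u ?_
    simp only [List.mem_cons, List.mem_append, mem_dag hδ] at hu ⊢
    rcases hu with rfl | hu | rfl | hu
    · simp [hδ]
    · simp [hu]
    · simp [hδ]
    · simp [hu]
  rw [← peelPerm_annulusOf hδ, peelPerm, delta_swap_delta hδ, hδ, wordPerm_cons,
    annulusOf_formPerm_mul hδ, wordPerm_cons, annulusOf_formPerm_mul hδ, ← hAdef]
  have c1 : A * (x :: (U ++ z :: V)).formPerm = _ := commute_formPerm fun u hu => hA u (Or.inl hu)
  have c2 : A * swap x (δ z) = _ :=
    commute_swap (hA x (by simp)) (hA _ (by simp [hδ]))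
  have c3 : A * (δ x :: (V ++ δ z :: dag δ U)).formPerm = _ := commute_formPerm hsub
  have c5 : Commute ((dag δ (δ x :: (V ++ δ z :: dag δ U))).formPerm)
      ((δ x :: (V ++ δ z :: dag δ U)).formPerm) := by
    refine commute_formPerm fun u hu => List.formPerm_apply_of_notMem fun hu' => ?_
    exact (hw.crosscap hδ hδ').delta_notMem hδ hδ' hu ((mem_dag hδ).mp hu')
  calc _ = A * (swap x (δ z) * (x :: (U ++ z :: V)).formPerm *
        (dag δ (x :: (U ++ z :: V))).formPerm * swap (δ x) z) := by
        simp only [← mul_assoc]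
        rw [c2, mul_assoc (swap x (δ z)) A, c1]
        simp only [mul_assoc]
    _ = _ := by
        rw [hX, c5.eq, ← mul_assoc, c3]

end annulus

/-! ### Evaluation of the sums over symmetric permutations -/

section wordSum

open Equiv

variable {P : Type*} [DecidableEq P] [Fintype P] {δ : Perm P} {x y z : P}
variable {X R : Type*} [CommRing R] {k : List X → R} {t : X → X} {a : P → List X}

/-- Γ contains both a word and its conjugate as commuting cycles, so it does not distinguish between
the two. -/
theorem annulusOf_wordPerm_flip (hδ : ∀ x, δ (δ x) = x) (hδ' : ∀ x, δ x ≠ x)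
    {A B : List (List P)} {w : List P} (h : SignedNodup δ (A ++ w :: B).flatten)
    (h' : SignedNodup δ (A ++ dag δ w :: B).flatten) :
    annulusOf δ (wordPerm (A ++ w :: B)) = annulusOf δ (wordPerm (A ++ dag δ w :: B)) := by
  rw [wordPerm_append_cons h.nodup, wordPerm_append_cons h'.nodup, annulusOf_formPerm_mul hδ,
    annulusOf_formPerm_mul hδ, dag_dag hδ]
  have e : (A ++ w :: B).flatten.Perm (w ++ (A ++ B).flatten) := by
    rw [List.flatten_append, List.flatten_append, List.flatten_cons]
    simpa using (List.perm_append_comm (l₁ := A.flatten) (l₂ := w)).append_right B.flatten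
  rw [signedNodup_perm hδ e, signedNodup_append] at h
  have c1 : annulusOf δ (wordPerm (A ++ B)) * w.formPerm = _ := commute_formPerm fun u hu =>
    annulusOf_wordPerm_apply hδ (h.2.2 u hu).1 (h.2.2 u hu).2
  have c2 : annulusOf δ (wordPerm (A ++ B)) * (dag δ w).formPerm = _ :=
    commute_formPerm fun u hu => by
      rw [mem_dag hδ] at hu
      exact annulusOf_wordPerm_apply hδ (by simpa [hδ] using (h.2.2 _ hu).2) (h.2.2 _ hu).1
  have c3 : w.formPerm * (dag δ w).formPerm = _ := commute_formPerm fun u hu =>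
    List.formPerm_apply_of_notMem fun hu' => by
      rw [mem_dag hδ] at hu
      exact h.1.delta_notMem hδ hδ' hu' hu
  rw [mul_assoc, c2, ← mul_assoc, c3, mul_assoc, mul_assoc, c1]

/-- `genusSum` for the annular permutation and the support of a list of words. -/
noncomputable def wordSum (k : List X → R) (δ : Perm P) (Ws : List (List P)) (a : P → List X)
    (j : ℕ) : R :=
  genusSum k δ (signedSupport δ Ws.flatten) (annulusOf δ (wordPerm Ws)) a j

/-- If x is the only letter of its word, Γ already fixes it and the level stays; otherwise cutting x
out of Γ raises the level by 2. -/
theorem genusSum_delete (hδ : ∀ x, δ (δ x) = x) (hδ' : ∀ x, δ x ≠ x) {w : List P}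
    {Ws : List (List P)} (h : SignedNodup δ ((x :: w) :: Ws).flatten) (j : ℕ) :
    genusSum k δ (signedSupport δ ((x :: w) :: Ws).flatten \ {x, δ x})
      (annulusOf δ (wordPerm ((x :: w) :: Ws))) a j =
      wordSum k δ (w :: Ws) a (if w = [] then j else j + 2) := by
  rw [List.flatten_cons, List.cons_append] at h
  have h0 := signedNodup_cons.mp h
  have hB : signedSupport δ ((x :: w) :: Ws).flatten \ {x, δ x} =
      signedSupport δ (w :: Ws).flatten := by
    ext u
    simp only [signedSupport, List.flatten_cons, List.cons_append, List.mem_cons, Set.mem_sdiff,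
      Set.mem_ofPred_eq, Set.mem_insert_iff, Set.mem_singleton_iff, not_or]
    constructor
    · rintro ⟨(h1 | h1) | (h1 | h1), h2, h3⟩
      · exact absurd h1 h2
      · exact Or.inl h1
      · exact absurd (by rw [← h1, hδ]) h3
      · exact Or.inr h1
    · rintro (h1 | h1)
      · exact ⟨Or.inl (Or.inr h1), fun e => h0.1 (e ▸ h1), fun e => h0.2.1 (e ▸ h1)⟩
      · exact ⟨Or.inr (Or.inr h1), fun e => h0.2.1 (e ▸ h1),
          fun e => h0.1 (by rw [e, hδ] at h1; exact h1)⟩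
  rw [hB, wordSum]
  cases w with
  | nil => simp [wordPerm]
  | cons u w =>
    have hu : wordPerm ((x :: u :: w) :: Ws) x = u := by
      rw [wordPerm_cons, Perm.mul_apply, wordPerm_apply_of_notMem]
      · exact List.formPerm_apply_head _ _ _ (h.nodup.sublist (by simp))
      · intro hx; exact h0.1 (by simp [hx])
    have hne : u ≠ x := fun e => h0.1 (by simp [e])
    have hd : wordPerm ((x :: u :: w) :: Ws) (δ x) = δ x := by
      apply wordPerm_apply_of_notMem
      rw [List.flatten_cons, List.cons_append, List.mem_cons, not_or]
      exact ⟨hδ' x, h0.2.1⟩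
    rw [genusSum_annulusOf_of_apply_ne (x := x) hδ hδ' _ _ (by rwa [hu]) hd, hu, if_neg (by simp)]
    · congr 2
      rw [wordPerm_cons, wordPerm_cons, List.formPerm_cons_cons, ← mul_assoc, ← mul_assoc,
        swap_mul_self, one_mul]
    · simpa [signedSupport] using And.intro h0.1 h0.2.1
    · simp only [signedSupport, Set.mem_ofPred_eq, hδ]
      rw [or_comm]; simpa [signedSupport] using And.intro h0.1 h0.2.1

theorem genusSum_split (hδ : ∀ x, δ (δ x) = x) (hδ' : ∀ x, δ x ≠ x) {U V : List P}
    {Ws : List (List P)} (h : SignedNodup δ ((x :: (U ++ y :: V)) :: Ws).flatten) (j : ℕ) :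
    genusSum k δ (signedSupport δ ((x :: (U ++ y :: V)) :: Ws).flatten \ {x, δ x})
      (peelPerm δ x y (annulusOf δ (wordPerm ((x :: (U ++ y :: V)) :: Ws)))) a j =
      wordSum k δ (U :: (y :: V) :: Ws) a (if U = [] then j else j + 2) := by
  have e : ((x :: (U ++ y :: V)) :: Ws).flatten = ((x :: U) :: (y :: V) :: Ws).flatten := by simp
  have hn : (x :: (U ++ y :: V)).Nodup := h.nodup.sublist (by simp)
  rw [peelPerm_annulusOf hδ, swap_mul_wordPerm_split hn, e, genusSum_delete hδ hδ' (e ▸ h)]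

theorem genusSum_crosscap (hδ : ∀ x, δ (δ x) = x) (hδ' : ∀ x, δ x ≠ x) {U V : List P}
    {Ws : List (List P)} (h : SignedNodup δ ((x :: (U ++ z :: V)) :: Ws).flatten) (j : ℕ) :
    genusSum k δ (signedSupport δ ((x :: (U ++ z :: V)) :: Ws).flatten \ {x, δ x})
      (peelPerm δ x (δ z) (annulusOf δ (wordPerm ((x :: (U ++ z :: V)) :: Ws)))) a j =
      wordSum k δ ((δ z :: (dag δ U ++ V)) :: Ws) a (j + 2) := by
  have hc : SignedNodup δ ((δ x :: (V ++ δ z :: dag δ U)) :: Ws).flatten := by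
    rw [List.flatten_cons, signedNodup_append] at h ⊢
    refine ⟨h.1.crosscap hδ hδ', h.2.1, fun u hu => ?_⟩
    have hs : u ∈ x :: (U ++ z :: V) ∨ δ u ∈ x :: (U ++ z :: V) := by
      simp only [List.mem_cons, List.mem_append, mem_dag hδ] at hu ⊢
      rcases hu with rfl | hu | rfl | hu
      · simp [hδ]
      · simp [hu]
      · simp [hδ]
      · simp [hu]
    rcases hs with hs | hs
    · exact h.2.2 u hs
    · exact ⟨by simpa [hδ] using (h.2.2 _ hs).2, (h.2.2 _ hs).1⟩
  have hB : signedSupport δ ((x :: (U ++ z :: V)) :: Ws).flatten \ {x, δ x} =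
      signedSupport δ ((δ x :: (V ++ δ z :: dag δ U)) :: Ws).flatten \ {δ x, δ (δ x)} := by
    ext u
    have h1 : ∀ v, u = δ v ↔ δ u = v := fun v =>
      ⟨fun e => by rw [e, hδ], fun e => by rw [← e, hδ]⟩
    have h2 : ∀ v, δ u = δ v ↔ u = v := fun v => δ.injective.eq_iff
    simp only [signedSupport, List.flatten_cons, List.cons_append, List.append_assoc,
      List.mem_cons, List.mem_append, Set.mem_sdiff, Set.mem_ofPred_eq, Set.mem_insert_iff,
      Set.mem_singleton_iff, mem_dag hδ, h1, h2, hδ]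
    tauto
  rw [peelPerm_annulusOf hδ, annulusOf_crosscap hδ hδ' h, hB, genusSum_delete hδ hδ' hc,
    if_neg (by simp), wordSum, wordSum]
  have hn : (V ++ δ z :: dag δ U).Nodup := hc.nodup.sublist (by simp)
  congr 1
  · ext u
    simp only [signedSupport, List.flatten_cons, List.cons_append, List.append_assoc,
      List.mem_cons, List.mem_append, Set.mem_ofPred_eq]
    tauto
  · rw [wordPerm_cons, wordPerm_cons, formPerm_append_comm hn]
    simp

theorem genusSum_join (hδ : ∀ x, δ (δ x) = x) (hδ' : ∀ x, δ x ≠ x) {w C D : List P}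
    {A B : List (List P)} (h : SignedNodup δ ((x :: w) :: (A ++ (C ++ y :: D) :: B)).flatten)
    (j : ℕ) :
    genusSum k δ (signedSupport δ ((x :: w) :: (A ++ (C ++ y :: D) :: B)).flatten \ {x, δ x})
      (peelPerm δ x y (annulusOf δ (wordPerm ((x :: w) :: (A ++ (C ++ y :: D) :: B))))) a j =
      wordSum k δ ((w ++ y :: (D ++ C)) :: (A ++ B)) a (j + 2) := by
  have e : (((x :: w) :: (A ++ (C ++ y :: D) :: B)).flatten).Perm
      ((x :: (w ++ y :: (D ++ C))) :: (A ++ B)).flatten := by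
    simp only [List.flatten_cons, List.flatten_append, List.cons_append, List.append_assoc,
      List.perm_cons]
    refine List.perm_iff_count.mpr fun u => ?_
    simp only [List.count_append, List.count_cons]
    omega
  have hB : signedSupport δ ((x :: w) :: (A ++ (C ++ y :: D) :: B)).flatten =
      signedSupport δ ((x :: (w ++ y :: (D ++ C))) :: (A ++ B)).flatten := by
    ext u; simp only [signedSupport, Set.mem_ofPred_eq, e.mem_iff]
  rw [peelPerm_annulusOf hδ, swap_mul_wordPerm_join h.nodup, hB,
    genusSum_delete hδ hδ' ((signedNodup_perm hδ e).mp h), if_neg (by simp)]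

/-- This is applied to the terms of the peeling formula, where `f y` belongs to σ x = y. Points of
the other words `L` contribute nothing, and each remaining letter of the first word occurs with both
signs. -/
theorem sum_signedSupport {R : Type*} [AddCommMonoid R] (hδ : ∀ x, δ (δ x) = x)
    (hδ' : ∀ x, δ x ≠ x) {w L : List P} (h : SignedNodup δ (x :: (w ++ L)))
    [DecidablePred (fun y => y ∈ signedSupport δ (x :: (w ++ L)) \ {x, δ x})] (f : P → R)
    (hf : ∀ y ∈ signedSupport δ L, f y = 0) :
    ∑ y ∈ univ.filter (fun y => y ∈ signedSupport δ (x :: (w ++ L)) \ {x, δ x}), f y =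
      ∑ i : Fin w.length, (f w[i] + f (δ w[i])) := by
  have hw : w.Nodup := h.nodup.sublist (by simp)
  have hwx : SignedNodup δ (x :: w) := List.Pairwise.sublist (by simp) h
  have hwx' := signedNodup_cons.mp hwx
  have hdw : (w.map δ).Nodup := hw.map δ.injective
  have hdisj : Disjoint w.toFinset (w.map δ).toFinset := by
    rw [Finset.disjoint_left]
    intro u hu hu'
    rw [List.mem_toFinset] at hu hu'
    obtain ⟨v, hv, rfl⟩ := List.mem_map.mp hu'
    exact hwx'.2.2.delta_notMem hδ hδ' hv hu
  have hsub : w.toFinset ∪ (w.map δ).toFinset ⊆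
      univ.filter (fun y => y ∈ signedSupport δ (x :: (w ++ L)) \ {x, δ x}) := by
    intro u hu
    simp only [Finset.mem_union, List.mem_toFinset, List.mem_map] at hu
    simp only [Finset.mem_filter, Finset.mem_univ, true_and, signedSupport, Set.mem_sdiff,
      Set.mem_ofPred_eq, List.mem_cons, List.mem_append, Set.mem_insert_iff,
      Set.mem_singleton_iff, not_or]
    rcases hu with hu | ⟨v, hv, rfl⟩
    · exact ⟨by simp [hu], fun e => hwx'.1 (e ▸ hu), fun e => hwx'.2.1 (e ▸ hu)⟩
    · exact ⟨by simp [hδ, hv], fun e => hwx'.2.1 (by rw [← e, hδ]; exact hv),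
        fun e => hwx'.1 (by rw [← δ.injective e]; exact hv)⟩
  rw [← Finset.sum_subset hsub, Finset.sum_union hdisj, List.sum_toFinset _ hw,
    List.sum_toFinset _ hdw, Finset.sum_add_distrib, List.map_map]
  · congr 1
    · exact (Fin.sum_univ_fun_getElem w f).symm
    · exact (Fin.sum_univ_fun_getElem w (f ∘ δ)).symm
  · intro u hu hu'
    apply hf
    simp only [Finset.mem_union, List.mem_toFinset, List.mem_map, not_or, not_exists] at hu'
    simp only [Finset.mem_filter, Finset.mem_univ, true_and, signedSupport, Set.mem_sdiff,
      Set.mem_ofPred_eq, List.mem_cons, List.mem_append, Set.mem_insert_iff,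
      Set.mem_singleton_iff, not_or] at hu ⊢
    obtain ⟨(h1 | h1 | h1) | (h1 | h1 | h1), h2, h3⟩ := hu
    · exact absurd h1 h2
    · exact absurd h1 hu'.1
    · exact Or.inl h1
    · exact absurd (by rw [← h1, hδ]) h3
    · exact absurd ⟨h1, hδ u⟩ (hu'.2 (δ u))
    · exact Or.inr h1

end wordSum

/-! ### The recursions along a lettering and the evaluation for trivial words -/

section evaluation

open Equiv

variable {P : Type*} [DecidableEq P] [Fintype P] {δ : Perm P} {x y z : P}
variable {X R : Type*} [CommRing R] {k : List X → R} {t : X → X} {a : P → List X}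

theorem planarSum_cons_map (k : List X → R) (a : P → List X) (L : List X) (w : List P) :
    planarSum k (L :: w.map a) = k L * planarSum k (w.map a) + ∑ i : Fin w.length,
      planarSum k ((w.take i).map a) *
        planarSum k ((L ++ a w[i]) :: (w.drop (i + 1)).map a) := by
  rw [planarSum_cons]
  congr 1
  refine Fintype.sum_equiv (finCongr (List.length_map a)) _ _ fun i => ?_
  simp [List.map_take, List.map_drop]

theorem crosscapSum_cons_map (k : List X → R) (ha : ∀ z, a (δ z) = dag t (a z)) (L : List X)
    (w : List P) :
    crosscapSum k t (L :: w.map a) = k L * crosscapSum k t (w.map a) + ∑ i : Fin w.length,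
      (planarSum k ((w.take i).map a) *
          crosscapSum k t ((L ++ a w[i]) :: (w.drop (i + 1)).map a) +
        crosscapSum k t ((w.take i).map a) *
          planarSum k ((L ++ a w[i]) :: (w.drop (i + 1)).map a) +
        planarSum k ((L ++ a (δ w[i])) :: (dag δ (w.take i) ++ w.drop (i + 1)).map a)) := by
  have h : ∀ l : List P, dag (dag t) (l.map a) = (dag δ l).map a := by
    intro l
    induction l with
    | nil => rfl
    | cons u l ih => simp [ih, ha]
  rw [crosscapSum_cons]
  congr 1
  refine Fintype.sum_equiv (finCongr (List.length_map a)) _ _ fun i => ?_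
  simp [← List.map_take, ← List.map_drop, h, ha]

theorem map_eraseLetter {l : List P} (hx : x ∉ l) (hdx : δ x ∉ l) :
    l.map (eraseLetter δ a x) = l.map a :=
  List.map_congr_left fun z hz => by
    have h1 : z ≠ x := fun e => hx (e ▸ hz)
    have h2 : z ≠ δ x := fun e => hdx (e ▸ hz)
    simp [eraseLetter, h1, h2]

theorem map_mergeLetter {l : List P} (hx : x ∉ l) (hdx : δ x ∉ l) (hy : y ∉ l) (hdy : δ y ∉ l) :
    l.map (mergeLetter δ t a x y) = l.map a :=
  List.map_congr_left fun z hz => by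
    have h1 : z ≠ x := fun e => hx (e ▸ hz)
    have h2 : z ≠ δ x := fun e => hdx (e ▸ hz)
    have h3 : z ≠ y := fun e => hy (e ▸ hz)
    have h4 : z ≠ δ y := fun e => hdy (e ▸ hz)
    simp [mergeLetter, h1, h2, h3, h4]

theorem mergeLetter_apply (hx : y ≠ x) (hdx : y ≠ δ x) :
    mergeLetter δ t a x y y = a x ++ a y := by
  simp [mergeLetter, hx, hdx]

/-- An assignment of words to the signed points which is compatible with conjugation and empty
off the support of `l`. -/
structure IsLettering (δ : Perm P) (t : X → X) (a : P → List X) (l : List P) : Prop where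
  delta : ∀ z, a (δ z) = dag t (a z)
  eq_nil : ∀ z ∉ signedSupport δ l, a z = []

theorem IsLettering.eraseLetter {l m : List P} (h : IsLettering δ t a l)
    (hδ : ∀ x, δ (δ x) = x)
    (hm : ∀ z ∈ signedSupport δ l, z ≠ x → z ≠ δ x → z ∈ signedSupport δ m) :
    IsLettering δ t (eraseLetter δ a x) m where
  delta := eraseLetter_delta hδ h.delta x
  eq_nil z hz := by
    by_cases h1 : z = x ∨ z = δ x
    · simp [_root_.eraseLetter, h1]
    · simp only [_root_.eraseLetter, h1, if_false]
      rw [not_or] at h1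
      exact h.eq_nil z fun h2 => hz (hm z h2 h1.1 h1.2)

theorem IsLettering.mergeLetter {l m : List P} (h : IsLettering δ t a l)
    (hδ : ∀ x, δ (δ x) = x) (hδ' : ∀ x, δ x ≠ x) (ht : ∀ x, t (t x) = x)
    (hm : ∀ z ∈ signedSupport δ l, z ≠ x → z ≠ δ x → z ∈ signedSupport δ m)
    (hy : y ∈ signedSupport δ m) :
    IsLettering δ t (mergeLetter δ t a x y) m where
  delta := mergeLetter_delta hδ hδ' ht h.delta x y
  eq_nil z hz := by
    have hdy : δ y ∈ signedSupport δ m := by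
      change δ y ∈ m ∨ δ (δ y) ∈ m
      rw [hδ]; exact hy.symm
    have h3 : z ≠ y := fun e => hz (e ▸ hy)
    have h4 : z ≠ δ y := fun e => hz (e ▸ hdy)
    by_cases h1 : z = x ∨ z = δ x
    · simp [_root_.mergeLetter, h1]
    · simp only [_root_.mergeLetter, h1, h3, h4, if_false]
      rw [not_or] at h1
      exact h.eq_nil z fun h2 => hz (hm z h2 h1.1 h1.2)

/-- The number of non-empty words. -/
def neCount (Ws : List (List P)) : ℕ := Ws.countP fun w => !w.isEmpty

/-- The values of `wordSum` at the two highest levels, and its vanishing above them. -/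
structure WordSumEval (k : List X → R) (t : X → X) (δ : Perm P) (Ws : List (List P)) : Prop where
  zero : ∀ a, IsLettering δ t a Ws.flatten → ∀ j,
    2 * Fintype.card P + 2 * neCount Ws < j + 2 * Ws.flatten.length → wordSum k δ Ws a j = 0
  planar : ∀ a, IsLettering δ t a Ws.flatten → ∀ j,
    j + 2 * Ws.flatten.length = 2 * Fintype.card P + 2 * neCount Ws →
      wordSum k δ Ws a j = ((Ws.map (List.map a)).map (planarSum k)).prod
  crosscap : ∀ a, IsLettering δ t a Ws.flatten → ∀ j,
    j + 2 * Ws.flatten.length + 2 = 2 * Fintype.card P + 2 * neCount Ws →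
      wordSum k δ Ws a j = crosscapTotal k t (Ws.map (List.map a))

theorem wordSumEval_nil (hk : IsDihedral k t) (hδ : ∀ x, δ (δ x) = x) (hδ' : ∀ x, δ x ≠ x) :
    WordSumEval k t δ ([] : List (List P)) := by
  classical
  have h1 : annulusOf δ (wordPerm ([] : List (List P))) = 1 := by
    simp [annulusOf, wordPerm, delta_mul_self hδ]
  have hs : ∀ z, z ∉ signedSupport δ ([] : List (List P)).flatten := by simp [signedSupport]
  have hmem : ∀ (σ : Perm P) (j : ℕ), (SymPerm δ σ ∧ (∀ z,
      z ∉ signedSupport δ ([] : List (List P)).flatten → σ z = z) ∧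
      numCycles σ + numCycles (σ⁻¹ * annulusOf δ (wordPerm ([] : List (List P)))) = j) ↔
      σ = 1 ∧ j = 2 * Fintype.card P := by
    intro σ j
    rw [h1]
    constructor
    · rintro ⟨-, h2, h3⟩
      obtain rfl : σ = 1 := Equiv.ext fun z => h2 z (hs z)
      refine ⟨rfl, ?_⟩
      rw [← h3]; simp [numCycles_one]; ring
    · rintro ⟨rfl, rfl⟩
      refine ⟨⟨by simp, fun z => (hδ' z).symm⟩, fun z _ => rfl, ?_⟩
      simp [numCycles_one]; ring
  refine ⟨fun a ha j hj => ?_, fun a ha j hj => ?_, fun a ha j hj => ?_⟩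
  · rw [wordSum, genusSum]
    refine Finset.sum_eq_zero fun σ hσ => ?_
    rw [Finset.mem_filter, hmem] at hσ
    simp [neCount] at hj
    omega
  · rw [wordSum, genusSum]
    simp [neCount] at hj
    simp only [hmem, hj, and_true]
    rw [Finset.sum_filter, Finset.sum_ite_eq' univ (1 : Perm P)]
    have ha' : a = fun _ => [] := funext fun z => ha.eq_nil z (hs z)
    simp [pairProd, loopValue, ha', hk.nil]
  · rw [wordSum, genusSum]
    refine Finset.sum_eq_zero fun σ hσ => ?_
    rw [Finset.mem_filter, hmem] at hσ
    simp [neCount] at hj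
    omega

theorem WordSumEval.nil_cons {Ws : List (List P)} (h : WordSumEval k t δ Ws) :
    WordSumEval k t δ ([] :: Ws) := by
  have e1 : ([] :: Ws).flatten = Ws.flatten := by simp
  have e2 : ∀ a j, wordSum k δ ([] :: Ws) a j = wordSum k δ Ws a j := by
    intro a j; simp [wordSum, wordPerm]
  have e3 : neCount ([] :: Ws) = neCount Ws := by simp [neCount]
  refine ⟨fun a ha j hj => ?_, fun a ha j hj => ?_, fun a ha j hj => ?_⟩ <;>
    rw [e1] at ha hj <;> rw [e3] at hj <;> rw [e2]
  · exact h.zero a ha j hj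
  · rw [h.planar a ha j hj]; simp
  · rw [h.crosscap a ha j hj]; simp [crosscapTotal]

theorem neCount_cons_cons (w : List P) (Ws : List (List P)) :
    neCount ((x :: w) :: Ws) = neCount Ws + 1 := by
  simp [neCount]

theorem neCount_cons (w : List P) (Ws : List (List P)) :
    neCount (w :: Ws) = neCount Ws + if w = [] then 0 else 1 := by
  cases w <;> simp [neCount]

end evaluation

/-! ### The four kinds of terms in the peeling formula, and the induction -/

section evaluation

open Equiv

variable {P : Type*} [DecidableEq P] [Fintype P] {δ : Perm P} {x y z : P}
variable {X R : Type*} [CommRing R] {k : List X → R} {t : X → X} {a : P → List X}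
variable {w : List P} {Ws : List (List P)}

theorem map_map_eraseLetter (hx : x ∉ Ws.flatten) (hdx : δ x ∉ Ws.flatten) :
    Ws.map (List.map (eraseLetter δ a x)) = Ws.map (List.map a) :=
  List.map_congr_left fun _ hl => map_eraseLetter
    (fun h => hx (List.mem_flatten_of_mem hl h)) fun h => hdx (List.mem_flatten_of_mem hl h)

theorem map_map_mergeLetter (hx : x ∉ Ws.flatten) (hdx : δ x ∉ Ws.flatten)
    (hy : y ∉ Ws.flatten) (hdy : δ y ∉ Ws.flatten) :
    Ws.map (List.map (mergeLetter δ t a x y)) = Ws.map (List.map a) :=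
  List.map_congr_left fun _ hl => map_mergeLetter
    (fun h => hx (List.mem_flatten_of_mem hl h)) (fun h => hdx (List.mem_flatten_of_mem hl h))
    (fun h => hy (List.mem_flatten_of_mem hl h)) fun h => hdy (List.mem_flatten_of_mem hl h)

theorem WordSumEval.fixed_part (hδ : ∀ x, δ (δ x) = x) (hδ' : ∀ x, δ x ≠ x)
    (E : WordSumEval k t δ (w :: Ws)) (h : SignedNodup δ ((x :: w) :: Ws).flatten)
    (ha : IsLettering δ t a ((x :: w) :: Ws).flatten) (j : ℕ) :
    let T := genusSum k δ (signedSupport δ ((x :: w) :: Ws).flatten \ {x, δ x})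
      (annulusOf δ (wordPerm ((x :: w) :: Ws))) (eraseLetter δ a x) j
    (2 * Fintype.card P + 2 * neCount ((x :: w) :: Ws) <
      j + 2 * ((x :: w) :: Ws).flatten.length → T = 0) ∧
    (j + 2 * ((x :: w) :: Ws).flatten.length =
      2 * Fintype.card P + 2 * neCount ((x :: w) :: Ws) →
        T = (((w :: Ws).map (List.map a)).map (planarSum k)).prod) ∧
    (j + 2 * ((x :: w) :: Ws).flatten.length + 2 =
      2 * Fintype.card P + 2 * neCount ((x :: w) :: Ws) →
        T = crosscapTotal k t ((w :: Ws).map (List.map a))) := by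
  intro T
  have hT : T = wordSum k δ (w :: Ws) (eraseLetter δ a x) (if w = [] then j else j + 2) :=
    genusSum_delete hδ hδ' h j
  have e : ((x :: w) :: Ws).flatten = x :: (w :: Ws).flatten := by simp
  have h0 := signedNodup_cons.mp (e ▸ h)
  have ha' : IsLettering δ t (eraseLetter δ a x) (w :: Ws).flatten := by
    refine ha.eraseLetter hδ fun z hz h1 h2 => ?_
    have h3 : δ z ≠ x := fun e => h2 (by rw [← e, hδ])
    simp only [signedSupport, e, List.mem_cons, Set.mem_ofPred_eq, h1, h3, false_or] at hz ⊢
    exact hz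
  have hmap := map_map_eraseLetter (a := a) (Ws := w :: Ws) h0.1 h0.2.1
  have hl : ((x :: w) :: Ws).flatten.length = (w :: Ws).flatten.length + 1 := by rw [e]; rfl
  rw [hT, hl, neCount_cons_cons, ← hmap]
  have hne := neCount_cons w Ws
  refine ⟨fun hj => E.zero _ ha' _ ?_, fun hj => E.planar _ ha' _ ?_,
    fun hj => E.crosscap _ ha' _ ?_⟩ <;> rw [hne] <;> split_ifs <;> omega

/-- A letter is lost and, unless U is empty, a non-empty word is gained; the distance of the level
from its maximum is unchanged. A planar term stays planar, and a single crosscap falls into one of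
the words. -/
theorem WordSumEval.split_part (hδ : ∀ x, δ (δ x) = x) (hδ' : ∀ x, δ x ≠ x)
    (ht : ∀ x, t (t x) = x) {U V : List P} (hw : w = U ++ y :: V)
    (E : WordSumEval k t δ (U :: (y :: V) :: Ws)) (h : SignedNodup δ ((x :: w) :: Ws).flatten)
    (ha : IsLettering δ t a ((x :: w) :: Ws).flatten) (j : ℕ) :
    let T := genusSum k δ (signedSupport δ ((x :: w) :: Ws).flatten \ {x, δ x})
      (peelPerm δ x y (annulusOf δ (wordPerm ((x :: w) :: Ws)))) (mergeLetter δ t a x y) (j + 2)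
    let L := U.map a :: ((a x ++ a y) :: V.map a) :: Ws.map (List.map a)
    (2 * Fintype.card P + 2 * neCount ((x :: w) :: Ws) <
      j + 2 * ((x :: w) :: Ws).flatten.length → T = 0) ∧
    (j + 2 * ((x :: w) :: Ws).flatten.length =
      2 * Fintype.card P + 2 * neCount ((x :: w) :: Ws) → T = (L.map (planarSum k)).prod) ∧
    (j + 2 * ((x :: w) :: Ws).flatten.length + 2 =
      2 * Fintype.card P + 2 * neCount ((x :: w) :: Ws) → T = crosscapTotal k t L) := by
  intro T L
  subst hw
  have hT : T = wordSum k δ (U :: (y :: V) :: Ws) (mergeLetter δ t a x y)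
      (if U = [] then j + 2 else j + 2 + 2) := genusSum_split hδ hδ' h (j + 2)
  have e : ((x :: (U ++ y :: V)) :: Ws).flatten = x :: (U :: (y :: V) :: Ws).flatten := by simp
  have h0 := signedNodup_cons.mp (e ▸ h)
  have hy : y ∈ (U :: (y :: V) :: Ws).flatten := by simp
  have hyx : y ≠ x := fun e => h0.1 (e ▸ hy)
  have hydx : y ≠ δ x := fun e => h0.2.1 (e ▸ hy)
  have ha' : IsLettering δ t (mergeLetter δ t a x y) (U :: (y :: V) :: Ws).flatten := by
    refine ha.mergeLetter hδ hδ' ht (fun z hz h1 h2 => ?_) (Or.inl hy)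
    have h3 : δ z ≠ x := fun e => h2 (by rw [← e, hδ])
    simp only [signedSupport, e, List.mem_cons, Set.mem_ofPred_eq, h1, h3, false_or] at hz ⊢
    exact hz
  have hmap : (U :: (y :: V) :: Ws).map (List.map (mergeLetter δ t a x y)) = L := by
    have g := h0.2.2
    simp only [List.flatten_cons, List.cons_append, signedNodup_append, signedNodup_cons,
      List.mem_append, List.mem_cons, not_or] at g h0
    have gU : ∀ z ∈ U, z ≠ y ∧ δ z ≠ y := fun z hz => ⟨(g.2.2 z hz).1.1, (g.2.2 z hz).2.1⟩
    rw [List.map_cons, List.map_cons, List.map_cons, mergeLetter_apply hyx hydx,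
      map_mergeLetter (l := U) h0.1.1 h0.2.1.1 (fun hz => (gU y hz).1 rfl)
        (fun hz => (gU _ hz).2 (hδ y)),
      map_mergeLetter (l := V) h0.1.2.2.1 h0.2.1.2.2.1 g.2.1.1.1 g.2.1.2.1.1,
      map_map_mergeLetter h0.1.2.2.2 h0.2.1.2.2.2 g.2.1.1.2 g.2.1.2.1.2]
  have hl : ((x :: (U ++ y :: V)) :: Ws).flatten.length =
      (U :: (y :: V) :: Ws).flatten.length + 1 := by rw [e]; rfl
  rw [hT, hl, neCount_cons_cons, ← hmap]
  have hne := neCount_cons U ((y :: V) :: Ws)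
  rw [neCount_cons_cons] at hne
  refine ⟨fun hj => E.zero _ ha' _ ?_, fun hj => E.planar _ ha' _ ?_,
    fun hj => E.crosscap _ ha' _ ?_⟩ <;> rw [hne] <;> split_ifs <;> omega

/-- A letter is lost but no word is gained, so the distance to the maximal level drops by one step
of 2: the crosscap has been used up, and what remains is evaluated at its planar level. -/
theorem WordSumEval.crosscap_part (hδ : ∀ x, δ (δ x) = x) (hδ' : ∀ x, δ x ≠ x)
    (ht : ∀ x, t (t x) = x) {U V : List P} (hw : w = U ++ z :: V)
    (E : WordSumEval k t δ ((δ z :: (dag δ U ++ V)) :: Ws))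
    (h : SignedNodup δ ((x :: w) :: Ws).flatten)
    (ha : IsLettering δ t a ((x :: w) :: Ws).flatten) (j : ℕ) :
    let T := genusSum k δ (signedSupport δ ((x :: w) :: Ws).flatten \ {x, δ x})
      (peelPerm δ x (δ z) (annulusOf δ (wordPerm ((x :: w) :: Ws))))
      (mergeLetter δ t a x (δ z)) (j + 2)
    (2 * Fintype.card P + 2 * neCount ((x :: w) :: Ws) <
      j + 2 * ((x :: w) :: Ws).flatten.length + 2 → T = 0) ∧
    (j + 2 * ((x :: w) :: Ws).flatten.length + 2 =
      2 * Fintype.card P + 2 * neCount ((x :: w) :: Ws) →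
        T = planarSum k ((a x ++ a (δ z)) :: (dag δ U ++ V).map a) *
          ((Ws.map (List.map a)).map (planarSum k)).prod) := by
  intro T
  subst hw
  have hT : T = wordSum k δ ((δ z :: (dag δ U ++ V)) :: Ws) (mergeLetter δ t a x (δ z))
      (j + 2 + 2) := genusSum_crosscap hδ hδ' h (j + 2)
  have h0 := h
  simp only [List.flatten_cons, List.cons_append, List.append_assoc, signedNodup_append,
    signedNodup_cons, List.mem_append, List.mem_cons, not_or] at h0
  obtain ⟨⟨hxU, hxz, hxV, hxW⟩, ⟨hdU, hdz, hdV, hdW⟩, hU, ⟨⟨hzV, hzW⟩, ⟨hdzV, hdzW⟩, hV, hW, hVW⟩,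
    hU'⟩ := h0
  have hzU : z ∉ U := fun hz => (hU' z hz).1.1 rfl
  have hdzU : δ z ∉ U := fun hz => (hU' _ hz).2.1 (hδ z)
  have hyx : δ z ≠ x := fun e => hdz (by rw [← e, hδ])
  have hydx : δ z ≠ δ x := fun e => hxz (δ.injective e).symm
  have ha' : IsLettering δ t (mergeLetter δ t a x (δ z))
      ((δ z :: (dag δ U ++ V)) :: Ws).flatten := by
    refine ha.mergeLetter hδ hδ' ht (fun u hu h1 h2 => ?_) (Or.inl (by simp))
    have h3 : δ u ≠ x := fun e => h2 (by rw [← e, hδ])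
    have h4 : u = δ z ↔ δ u = z := ⟨fun e => by rw [e, hδ], fun e => by rw [← e, hδ]⟩
    have h5 : δ u = δ z ↔ u = z := δ.injective.eq_iff
    simp only [signedSupport, List.flatten_cons, List.cons_append, List.append_assoc,
      List.mem_append, List.mem_cons, mem_dag hδ, Set.mem_ofPred_eq, h1, h3, h4, h5, hδ,
      false_or] at hu ⊢
    tauto
  have hmap : ((δ z :: (dag δ U ++ V)) :: Ws).map (List.map (mergeLetter δ t a x (δ z))) =
      ((a x ++ a (δ z)) :: (dag δ U ++ V).map a) :: Ws.map (List.map a) := by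
    rw [List.map_cons, List.map_cons, mergeLetter_apply hyx hydx, map_mergeLetter,
      map_map_mergeLetter hxW hdW hdzW (by rwa [hδ])]
    all_goals simp only [List.mem_append, mem_dag hδ, not_or, hδ]
    · exact ⟨hdU, hxV⟩
    · exact ⟨hxU, hdV⟩
    · exact ⟨hzU, hdzV⟩
    · exact ⟨hdzU, hzV⟩
  have hl : ((x :: (U ++ z :: V)) :: Ws).flatten.length =
      ((δ z :: (dag δ U ++ V)) :: Ws).flatten.length + 1 := by simp; omega
  rw [hT, hl, neCount_cons_cons]
  have hne := neCount_cons_cons (x := δ z) (dag δ U ++ V) Ws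
  refine ⟨fun hj => E.zero _ ha' _ (by omega), fun hj => ?_⟩
  rw [E.planar _ ha' _ (by omega), hmap]
  simp

/-- A join loses a letter and also a non-empty word. At the two highest levels this lands strictly
above the maximum for the joined words, where the sum vanishes. -/
theorem genusSum_join_eq_zero (hδ : ∀ x, δ (δ x) = x) (hδ' : ∀ x, δ x ≠ x)
    (ht : ∀ x, t (t x) = x)
    (IH : ∀ Ws' : List (List P), SignedNodup δ Ws'.flatten →
      Ws'.flatten.length < ((x :: w) :: Ws).flatten.length → Ws'.length ≤ Ws.length →
        WordSumEval k t δ Ws')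
    (h : SignedNodup δ ((x :: w) :: Ws).flatten)
    (ha : IsLettering δ t a ((x :: w) :: Ws).flatten) (hy : y ∈ Ws.flatten) {j : ℕ}
    (hj : 2 * Fintype.card P + 2 * neCount ((x :: w) :: Ws) ≤
      j + 2 * ((x :: w) :: Ws).flatten.length + 2) :
    genusSum k δ (signedSupport δ ((x :: w) :: Ws).flatten \ {x, δ x})
      (peelPerm δ x y (annulusOf δ (wordPerm ((x :: w) :: Ws)))) (mergeLetter δ t a x y)
      (j + 2) = 0 := by
  obtain ⟨l, hl, hyl⟩ := List.mem_flatten.mp hy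
  obtain ⟨A, B, rfl⟩ := List.append_of_mem hl
  obtain ⟨C, D, rfl⟩ := List.append_of_mem hyl
  rw [genusSum_join hδ hδ' h]
  have hp : (((x :: w) :: (A ++ (C ++ y :: D) :: B)).flatten).Perm
      (x :: ((w ++ y :: (D ++ C)) :: (A ++ B)).flatten) := by
    simp only [List.flatten_cons, List.flatten_append, List.cons_append, List.append_assoc]
    refine List.perm_iff_count.mpr fun u => ?_
    simp only [List.count_append, List.count_cons]
    omega
  have h' := signedNodup_cons.mp ((signedNodup_perm hδ hp).mp h)
  have hlen : ((x :: w) :: (A ++ (C ++ y :: D) :: B)).flatten.length =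
      ((w ++ y :: (D ++ C)) :: (A ++ B)).flatten.length + 1 := hp.length_eq
  refine (IH _ h'.2.2 (by omega) (by simp)).zero _ ?_ _ ?_
  · refine ha.mergeLetter hδ hδ' ht (fun z hz h1 h2 => ?_) (Or.inl (by simp))
    have h3 : δ z ≠ x := fun e => h2 (by rw [← e, hδ])
    simp only [signedSupport, hp.mem_iff, List.mem_cons, Set.mem_ofPred_eq, h1, h3,
      false_or] at hz ⊢
    exact hz
  · have h1 : neCount ((x :: w) :: (A ++ (C ++ y :: D) :: B)) =
        neCount ((w ++ y :: (D ++ C)) :: (A ++ B)) + 1 := by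
      simp [neCount, List.countP_append]; omega
    omega

/-- Replacing the word that contains δ y by its conjugate, which does not affect Γ, reduces this to
the join with a letter. -/
theorem genusSum_join_delta_eq_zero (hδ : ∀ x, δ (δ x) = x) (hδ' : ∀ x, δ x ≠ x)
    (ht : ∀ x, t (t x) = x)
    (IH : ∀ Ws' : List (List P), SignedNodup δ Ws'.flatten →
      Ws'.flatten.length < ((x :: w) :: Ws).flatten.length → Ws'.length ≤ Ws.length →
        WordSumEval k t δ Ws')
    (h : SignedNodup δ ((x :: w) :: Ws).flatten)
    (ha : IsLettering δ t a ((x :: w) :: Ws).flatten) (hy : δ y ∈ Ws.flatten) {j : ℕ}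
    (hj : 2 * Fintype.card P + 2 * neCount ((x :: w) :: Ws) ≤
      j + 2 * ((x :: w) :: Ws).flatten.length + 2) :
    genusSum k δ (signedSupport δ ((x :: w) :: Ws).flatten \ {x, δ x})
      (peelPerm δ x y (annulusOf δ (wordPerm ((x :: w) :: Ws)))) (mergeLetter δ t a x y)
      (j + 2) = 0 := by
  obtain ⟨l, hl, hyl⟩ := List.mem_flatten.mp hy
  obtain ⟨A, B, rfl⟩ := List.append_of_mem hl
  have hmem : ∀ u, u ∈ signedSupport δ ((x :: w) :: (A ++ dag δ l :: B)).flatten ↔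
      u ∈ signedSupport δ ((x :: w) :: (A ++ l :: B)).flatten := by
    intro u
    simp only [signedSupport, List.flatten_cons, List.flatten_append, List.cons_append,
      List.mem_cons, List.mem_append, Set.mem_ofPred_eq, mem_dag hδ, hδ]
    tauto
  have hlen : ((x :: w) :: (A ++ dag δ l :: B)).flatten.length =
      ((x :: w) :: (A ++ l :: B)).flatten.length := by simp
  have hne : neCount ((x :: w) :: (A ++ dag δ l :: B)) =
      neCount ((x :: w) :: (A ++ l :: B)) := by
    simp [neCount, List.countP_append, List.countP_cons, dag]
  have h' : SignedNodup δ ((x :: w) :: (A ++ dag δ l :: B)).flatten := by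
    have p : ∀ m : List P, (((x :: w) :: (A ++ m :: B)).flatten).Perm
        (m ++ ((x :: w) :: (A ++ B)).flatten) := fun m => by
      simp only [List.flatten_cons, List.flatten_append, List.cons_append]
      refine List.perm_iff_count.mpr fun u => ?_
      simp only [List.count_append, List.count_cons]
      omega
    rw [signedNodup_perm hδ (p _), signedNodup_append] at h ⊢
    refine ⟨(signedNodup_dag hδ).mpr h.1, h.2.1, fun u hu => ?_⟩
    rw [mem_dag hδ] at hu
    exact ⟨by simpa [hδ] using (h.2.2 _ hu).2, (h.2.2 _ hu).1⟩
  have hS : signedSupport δ ((x :: w) :: (A ++ dag δ l :: B)).flatten =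
      signedSupport δ ((x :: w) :: (A ++ l :: B)).flatten := Set.ext hmem
  have := genusSum_join_eq_zero (k := k) (y := y) (j := j) hδ hδ' ht
    (Ws := A ++ dag δ l :: B) (w := w) (x := x)
    (fun Ws' h1 h2 h3 => IH Ws' h1 (by rwa [hlen] at h2) (by simpa using h3)) h'
    ⟨ha.delta, fun z hz => ha.eq_nil z (by rwa [← hmem])⟩
    (List.mem_flatten.mpr ⟨dag δ l, by simp, by rwa [mem_dag hδ]⟩) (by rw [hlen, hne]; exact hj)
  have hflip : annulusOf δ (wordPerm ((x :: w) :: (A ++ l :: B))) =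
      annulusOf δ (wordPerm ((x :: w) :: (A ++ dag δ l :: B))) :=
    annulusOf_wordPerm_flip (A := (x :: w) :: A) hδ hδ' h h'
  rw [hS, ← hflip] at this
  exact this

/-- The levels come from the disc: a non-empty word of r letters and its conjugate contribute at
most 2(r + 1) cycles to #(σ) + #(σ⁻¹Γ), and every point outside the support contributes 2. With l
letters and m non-empty words the maximum is 2|P| - 2l + 2m. Peeling the first letter reproduces the
recursions of `planarSum` at this level and of `crosscapTotal` one step of 2 below. -/
theorem wordSumEval (hk : IsDihedral k t) (hδ : ∀ x, δ (δ x) = x) (hδ' : ∀ x, δ x ≠ x)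
    (ht : ∀ x, t (t x) = x) (Ws : List (List P)) (h : SignedNodup δ Ws.flatten) :
    WordSumEval k t δ Ws := by
  classical
  -- A split loses one letter and gains one word, so a letter has to weigh more than a word.
  induction hn : 2 * Ws.flatten.length + Ws.length using Nat.strong_induction_on generalizing Ws with
  | _ n ih =>
    match Ws, h, hn with
    | [], _, _ => exact wordSumEval_nil hk hδ hδ'
    | [] :: Ws, h, hn =>
      have hlt : 2 * Ws.flatten.length + Ws.length < n := by rw [← hn]; simp
      exact (ih _ hlt Ws (by simpa using h) rfl).nil_cons
    | (x :: w) :: Ws, h, hn =>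
      have e : ((x :: w) :: Ws).flatten = x :: (w ++ Ws.flatten) := by simp
      have hlen : ((x :: w) :: Ws).flatten.length = w.length + Ws.flatten.length + 1 := by
        rw [e]; simp
      have IH : ∀ Ws' : List (List P), SignedNodup δ Ws'.flatten →
          Ws'.flatten.length < ((x :: w) :: Ws).flatten.length → Ws'.length ≤ Ws.length + 2 →
          WordSumEval k t δ Ws' := fun Ws' h1 h2 h3 =>
        ih _ (by rw [← hn, List.length_cons]; omega) Ws' h1 rfl
      have hsplit : ∀ i : Fin w.length, w = w.take i ++ w[i] :: w.drop (i + 1) := fun i => by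
        rw [Fin.getElem_fin, List.getElem_cons_drop, List.take_append_drop]
      have h1 := h
      rw [e] at h1
      have h2 := signedNodup_cons.mp h1
      have E0 : WordSumEval k t δ (w :: Ws) := IH _ h2.2.2 (by rw [hlen]; simp) (by simp)
      have E1 : ∀ i : Fin w.length, WordSumEval k t δ
          (w.take i :: (w[i] :: w.drop (i + 1)) :: Ws) := fun i => by
        have e1 : (w.take i :: (w[i] :: w.drop (i + 1)) :: Ws).flatten = w ++ Ws.flatten := by
          simp only [List.flatten_cons]
          rw [← List.append_assoc, ← hsplit i]
        refine IH _ (by rw [e1]; exact h2.2.2) ?_ (by simp)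
        rw [e1, hlen]; simp
      have E2 : ∀ i : Fin w.length, WordSumEval k t δ
          ((δ w[i] :: (dag δ (w.take i) ++ w.drop (i + 1))) :: Ws) := fun i => by
        refine IH _ ?_ ?_ (by simp)
        · have g := h2.2.2
          rw [hsplit i] at g
          have g' : ∀ u ∈ w.take i ++ w[i] :: w.drop (i + 1),
              δ u ∉ w.take i ++ w[i] :: w.drop (i + 1) := by
            rw [← hsplit i]
            exact fun u => (signedNodup_append.mp h2.2.2).1.delta_notMem hδ hδ'
          generalize w.take i = U at *
          generalize w.drop (i + 1) = V at *
          generalize w[i] = z at *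
          have hU : ∀ u ∈ U, δ u ∉ U := fun u h1 h2 => g' u (by simp [h1]) (by simp [h2])
          have hz : δ z ≠ z := hδ' z
          simp only [List.flatten_cons, List.cons_append, signedNodup_cons, signedNodup_append,
            List.mem_append, List.mem_cons, mem_dag hδ, signedNodup_dag hδ, hδ, not_or] at g ⊢
          grind
        · rw [hlen]
          have := i.2
          simp
          omega
      have E3 : ∀ Ws' : List (List P), SignedNodup δ Ws'.flatten →
          Ws'.flatten.length < ((x :: w) :: Ws).flatten.length → Ws'.length ≤ Ws.length →
          WordSumEval k t δ Ws' := fun Ws' h1 h2 h3 => IH Ws' h1 h2 (by omega)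
      have hB : ∀ l : List P, ∀ z, δ z ∈ signedSupport δ l ↔ z ∈ signedSupport δ l := by
        intro l z
        simp only [signedSupport, Set.mem_ofPred_eq, hδ]
        exact or_comm
      have hx : x ∈ signedSupport δ ((x :: w) :: Ws).flatten := Or.inl (by simp)
      -- The peeling formula at the levels of interest, where the joins with other words have
      -- already dropped out.
      have main : ∀ a, IsLettering δ t a ((x :: w) :: Ws).flatten → ∀ j,
          2 * Fintype.card P + 2 * neCount ((x :: w) :: Ws) ≤
            j + 2 * ((x :: w) :: Ws).flatten.length + 2 →
          wordSum k δ ((x :: w) :: Ws) a j = k (a x) *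
            genusSum k δ (signedSupport δ ((x :: w) :: Ws).flatten \ {x, δ x})
              (annulusOf δ (wordPerm ((x :: w) :: Ws))) (eraseLetter δ a x) j +
            ∑ i : Fin w.length, (genusSum k δ
              (signedSupport δ ((x :: w) :: Ws).flatten \ {x, δ x})
              (peelPerm δ x w[i] (annulusOf δ (wordPerm ((x :: w) :: Ws))))
              (mergeLetter δ t a x w[i]) (j + 2) +
            genusSum k δ (signedSupport δ ((x :: w) :: Ws).flatten \ {x, δ x})
              (peelPerm δ x (δ w[i]) (annulusOf δ (wordPerm ((x :: w) :: Ws))))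
              (mergeLetter δ t a x (δ w[i])) (j + 2)) := by
        intro a ha j hj
        rw [wordSum, genusSum_peel hk hδ hδ' ht ha.delta _ _ (hB _) hx]
        congr 1
        have hf : ∀ y ∈ signedSupport δ Ws.flatten,
            genusSum k δ (signedSupport δ ((x :: w) :: Ws).flatten \ {x, δ x})
              (peelPerm δ x y (annulusOf δ (wordPerm ((x :: w) :: Ws))))
              (mergeLetter δ t a x y) (j + 2) = 0 := by
          rintro y (hy | hy)
          · exact genusSum_join_eq_zero hδ hδ' ht E3 h ha hy hj
          · exact genusSum_join_delta_eq_zero hδ hδ' ht E3 h ha hy hj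
        rw [e] at hf ⊢
        exact sum_signedSupport hδ hδ' h1 _ hf
      refine ⟨fun a ha j hj => ?_, fun a ha j hj => ?_, fun a ha j hj => ?_⟩
      · rw [main a ha j (by omega), (E0.fixed_part hδ hδ' h ha j).1 hj, mul_zero, zero_add]
        refine Finset.sum_eq_zero fun i _ => ?_
        rw [((E1 i).split_part hδ hδ' ht (hsplit i) h ha j).1 hj,
          ((E2 i).crosscap_part hδ hδ' ht (hsplit i) h ha j).1 (by omega), zero_add]
      · rw [main a ha j (by omega), (E0.fixed_part hδ hδ' h ha j).2.1 hj]
        simp only [List.map_cons, List.prod_cons]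
        rw [planarSum_cons_map, add_mul, Finset.sum_mul, mul_assoc]
        congr 1
        refine Finset.sum_congr rfl fun i _ => ?_
        rw [((E1 i).split_part hδ hδ' ht (hsplit i) h ha j).2.1 hj,
          ((E2 i).crosscap_part hδ hδ' ht (hsplit i) h ha j).1 (by omega), add_zero]
        simp only [List.map_cons, List.prod_cons, mul_assoc]
      · rw [main a ha j (by omega), (E0.fixed_part hδ hδ' h ha j).2.2 hj]
        simp only [List.map_cons, crosscapTotal]
        rw [crosscapSum_cons_map k ha.delta, planarSum_cons_map, add_mul, add_mul,
          Finset.sum_mul, Finset.sum_mul, mul_add, add_add_add_comm, ← mul_assoc, ← mul_assoc,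
          ← Finset.sum_add_distrib]
        congr 1
        refine Finset.sum_congr rfl fun i _ => ?_
        rw [((E1 i).split_part hδ hδ' ht (hsplit i) h ha j).2.2 hj,
          ((E2 i).crosscap_part hδ hδ' ht (hsplit i) h ha j).2 (by omega)]
        simp only [List.map_cons, List.prod_cons, crosscapTotal]
        ring

end evaluation

/-! ### Sums over non-crossing partitions -/

section partitions

variable {α : Type*} [LinearOrder α]

/-- `Q` is the set of blocks of a non-crossing partition of `U`. -/
structure IsNCPartition (U : Finset α) (Q : Finset (Finset α)) : Prop where
  nonempty : ∀ V ∈ Q, V.Nonempty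
  subset : ∀ V ∈ Q, ∀ i ∈ V, i ∈ U
  cover : ∀ i ∈ U, ∃ V ∈ Q, i ∈ V
  eq_of_mem : ∀ V ∈ Q, ∀ W ∈ Q, ∀ i, i ∈ V → i ∈ W → V = W
  noncrossing : ∀ i j k l : α, i < j → j < k → k < l → ∀ V ∈ Q, ∀ W ∈ Q,
    i ∈ V → k ∈ V → j ∈ W → l ∈ W → V = W

/-- `x` and `y` are neighbours in a block of `Q`. -/
def IsNext (Q : Finset (Finset α)) (x y : α) : Prop :=
  ∃ B ∈ Q, x ∈ B ∧ y ∈ B ∧ x < y ∧ ∀ z ∈ B, x < z → y ≤ z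

/-- Add the point `x` to the block of `y`. -/
def attachPoint (x y : α) (V : Finset α) : Finset α := if y ∈ V then insert x V else V

variable {U : Finset α} {Q Q₁ Q₂ : Finset (Finset α)} {x y : α}

/-- A block with a point strictly between x and y and another point beyond y would cross the block
of x and y. So the blocks separate into those inside the gap and those outside, which is what the
recursion of `planarSum` needs. -/
theorem IsNCPartition.subset_or (h : IsNCPartition U Q) (hx : ∀ z ∈ U, x ≤ z)
    (hxy : IsNext Q x y) {V : Finset α} (hV : V ∈ Q) :
    (V ⊆ (U.erase x).filter (· < y)) ∨ ∀ v ∈ V, v = x ∨ y ≤ v := by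
  by_contra hcon
  rw [not_or] at hcon
  obtain ⟨h1, h2⟩ := hcon
  obtain ⟨B, hB, hxB, hyB, hlt, hmin⟩ := hxy
  push Not at h2
  obtain ⟨v, hv, hvx, hvy⟩ := h2
  have hxv : x < v := lt_of_le_of_ne (hx v (h.subset V hV v hv)) hvx.symm
  have hVB : V ≠ B := fun e => absurd (hmin v (e ▸ hv) hxv) (not_le.mpr hvy)
  obtain ⟨u, hu, hu'⟩ := Finset.not_subset.mp h1
  have huU := h.subset V hV u hu
  rw [Finset.mem_filter, Finset.mem_erase] at hu'
  by_cases hux : u = x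
  · exact hVB (h.eq_of_mem V hV B hB x (hux ▸ hu) hxB)
  · have hyu : y ≤ u := by
      by_contra hlt'
      exact hu' ⟨⟨hux, huU⟩, not_le.mp hlt'⟩
    rcases hyu.eq_or_lt with rfl | hyu
    · exact hVB (h.eq_of_mem V hV B hB _ hu hyB)
    · exact hVB (h.noncrossing x v y u hxv hvy hyu B hB V hV hxB hyB hv hu).symm

theorem IsNCPartition.inner (h : IsNCPartition U Q) (hx : ∀ z ∈ U, x ≤ z)
    (hxy : IsNext Q x y) :
    IsNCPartition ((U.erase x).filter (· < y)) (Q.filter (· ⊆ (U.erase x).filter (· < y))) where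
  nonempty V hV := h.nonempty V (Finset.mem_filter.mp hV).1
  subset V hV i hi := (Finset.mem_filter.mp hV).2 hi
  cover i hi := by
    have hi' := Finset.mem_filter.mp hi
    obtain ⟨V, hV, hiV⟩ := h.cover i (Finset.mem_of_mem_erase hi'.1)
    refine ⟨V, Finset.mem_filter.mpr ⟨hV, ?_⟩, hiV⟩
    refine (h.subset_or hx hxy hV).resolve_right fun h2 => ?_
    rcases h2 i hiV with rfl | h3
    · exact Finset.ne_of_mem_erase hi'.1 rfl
    · exact absurd hi'.2 (not_lt.mpr h3)
  eq_of_mem V hV W hW := h.eq_of_mem V (Finset.mem_filter.mp hV).1 W (Finset.mem_filter.mp hW).1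
  noncrossing i j k l h1 h2 h3 V hV W hW := h.noncrossing i j k l h1 h2 h3 V
    (Finset.mem_filter.mp hV).1 W (Finset.mem_filter.mp hW).1

theorem IsNCPartition.outer (h : IsNCPartition U Q) (hx : ∀ z ∈ U, x ≤ z)
    (hxy : IsNext Q x y) :
    IsNCPartition (U.filter (y ≤ ·))
      ((Q.filter (¬ · ⊆ (U.erase x).filter (· < y))).image (·.erase x)) where
  nonempty := by
    intro V' hV'
    obtain ⟨V, hVQ, rfl⟩ := Finset.mem_image.mp hV'
    have hV := (Finset.mem_filter.mp hVQ).1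
    have h2 := (h.subset_or hx hxy hV).resolve_left (Finset.mem_filter.mp hVQ).2
    obtain ⟨B, hB, hxB, hyB, hlt, hmin⟩ := hxy
    obtain ⟨v, hv⟩ := h.nonempty V hV
    rcases h2 v hv with rfl | h3
    · have e := h.eq_of_mem V hV B hB _ hv hxB
      exact ⟨y, Finset.mem_erase.mpr ⟨hlt.ne', e ▸ hyB⟩⟩
    · exact ⟨v, Finset.mem_erase.mpr ⟨(hlt.trans_le h3).ne', hv⟩⟩
  subset := by
    intro V' hV' i hi
    obtain ⟨V, hV, rfl⟩ := Finset.mem_image.mp hV'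
    obtain ⟨hV, hn⟩ := Finset.mem_filter.mp hV
    obtain ⟨h1, h2⟩ := Finset.mem_erase.mp hi
    exact Finset.mem_filter.mpr ⟨h.subset V hV i h2,
      (((h.subset_or hx hxy hV).resolve_left hn) i h2).resolve_left h1⟩
  cover := by
    intro i hi
    obtain ⟨hi, hyi⟩ := Finset.mem_filter.mp hi
    obtain ⟨V, hV, hiV⟩ := h.cover i hi
    refine ⟨_, Finset.mem_image_of_mem _ (Finset.mem_filter.mpr ⟨hV, fun hs => ?_⟩),
      Finset.mem_erase.mpr ⟨?_, hiV⟩⟩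
    · exact absurd (Finset.mem_filter.mp (hs hiV)).2 (not_lt.mpr hyi)
    · obtain ⟨B, hB, hxB, hyB, hlt, hmin⟩ := hxy
      exact (hlt.trans_le hyi).ne'
  eq_of_mem := by
    intro V' hV' W' hW' i hi hi'
    obtain ⟨V, hV, rfl⟩ := Finset.mem_image.mp hV'
    obtain ⟨W, hW, rfl⟩ := Finset.mem_image.mp hW'
    rw [h.eq_of_mem V (Finset.mem_filter.mp hV).1 W (Finset.mem_filter.mp hW).1 i
      (Finset.mem_of_mem_erase hi) (Finset.mem_of_mem_erase hi')]
  noncrossing := by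
    intro i j k l h1 h2 h3 V' hV' W' hW' hi hk hj hl
    obtain ⟨V, hV, rfl⟩ := Finset.mem_image.mp hV'
    obtain ⟨W, hW, rfl⟩ := Finset.mem_image.mp hW'
    rw [h.noncrossing i j k l h1 h2 h3 V (Finset.mem_filter.mp hV).1 W
      (Finset.mem_filter.mp hW).1 (Finset.mem_of_mem_erase hi) (Finset.mem_of_mem_erase hk)
      (Finset.mem_of_mem_erase hj) (Finset.mem_of_mem_erase hl)]

theorem mem_attachPoint {V : Finset α} {i : α} : i ∈ attachPoint x y V ↔ i ∈ V ∨ (i = x ∧ y ∈ V) := by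
  unfold attachPoint
  split_ifs with h
  · simp [h, or_comm]
  · simp [h]

/-- The inverse of the decomposition by `inner` and `outer`: x is attached to the block of y, the
least point of the outer part, so that no crossing can arise. -/
theorem IsNCPartition.glue (hxU : x ∈ U) (hx : ∀ z ∈ U, x ≤ z) (hyU : y ∈ U) (hxy : x < y)
    (h₁ : IsNCPartition ((U.erase x).filter (· < y)) Q₁)
    (h₂ : IsNCPartition (U.filter (y ≤ ·)) Q₂) :
    IsNCPartition U (Q₁ ∪ Q₂.image (attachPoint x y)) ∧ IsNext (Q₁ ∪ Q₂.image (attachPoint x y)) x y := by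
  have g1 : ∀ V ∈ Q₁, ∀ i ∈ V, i ∈ U ∧ x < i ∧ i < y := fun V hV i hi => by
    have := h₁.subset V hV i hi
    rw [Finset.mem_filter, Finset.mem_erase] at this
    exact ⟨this.1.2, lt_of_le_of_ne (hx i this.1.2) this.1.1.symm, this.2⟩
  have g2 : ∀ V ∈ Q₂, ∀ i ∈ V, i ∈ U ∧ y ≤ i := fun V hV i hi =>
    Finset.mem_filter.mp (h₂.subset V hV i hi)
  have g3 : ∀ V ∈ Q₂, ∀ i ∈ attachPoint x y V, i ∈ U ∧ (y ≤ i ∨ i = x) := fun V hV i hi => by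
    rcases mem_attachPoint.mp hi with hi | ⟨rfl, -⟩
    · exact ⟨(g2 V hV i hi).1, Or.inl (g2 V hV i hi).2⟩
    · exact ⟨hxU, Or.inr rfl⟩
  have g4 : ∀ V ∈ Q₂, ∀ i ∈ attachPoint x y V, y ≤ i → i ∈ V := fun V hV i hi hyi => by
    rcases mem_attachPoint.mp hi with hi | ⟨rfl, -⟩
    · exact hi
    · exact absurd hxy (not_lt.mpr hyi)
  have g5 : ∀ V ∈ Q₂, x ∈ attachPoint x y V → y ∈ V := fun V hV hi => by
    rcases mem_attachPoint.mp hi with hi | ⟨-, h⟩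
    · exact absurd hxy (not_lt.mpr (g2 V hV x hi).2)
    · exact h
  have key : ∀ W, W ∈ Q₁ ∪ Q₂.image (attachPoint x y) →
      W ∈ Q₁ ∨ ∃ V ∈ Q₂, attachPoint x y V = W := by simp
  refine ⟨⟨?_, ?_, ?_, ?_, ?_⟩, ?_⟩
  · intro V hV
    rcases key V hV with hV | ⟨W, hW, rfl⟩
    · exact h₁.nonempty V hV
    · obtain ⟨i, hi⟩ := h₂.nonempty W hW
      exact ⟨i, mem_attachPoint.mpr (Or.inl hi)⟩
  · intro V hV i hi
    rcases key V hV with hV | ⟨W, hW, rfl⟩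
    · exact (g1 V hV i hi).1
    · exact (g3 W hW i hi).1
  · intro i hi
    by_cases hyi : y ≤ i
    · obtain ⟨V, hV, hiV⟩ := h₂.cover i (Finset.mem_filter.mpr ⟨hi, hyi⟩)
      exact ⟨_, Finset.mem_union_right _ (Finset.mem_image_of_mem _ hV),
        mem_attachPoint.mpr (Or.inl hiV)⟩
    · by_cases hix : i = x
      · obtain ⟨V, hV, hyV⟩ := h₂.cover y (Finset.mem_filter.mpr ⟨hyU, le_rfl⟩)
        exact ⟨_, Finset.mem_union_right _ (Finset.mem_image_of_mem _ hV),
          mem_attachPoint.mpr (Or.inr ⟨hix, hyV⟩)⟩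
      · obtain ⟨V, hV, hiV⟩ := h₁.cover i (Finset.mem_filter.mpr
          ⟨Finset.mem_erase.mpr ⟨hix, hi⟩, not_le.mp hyi⟩)
        exact ⟨V, Finset.mem_union_left _ hV, hiV⟩
  · intro V hV W hW i hiV hiW
    rcases key V hV with hV₁ | ⟨V', hV', rfl⟩ <;> rcases key W hW with hW₁ | ⟨W', hW', rfl⟩
    · exact h₁.eq_of_mem V hV₁ W hW₁ i hiV hiW
    · have := g1 V hV₁ i hiV
      have := g3 W' hW' i hiW
      grind
    · have := g1 W hW₁ i hiW
      have := g3 V' hV' i hiV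
      grind
    · rcases (g3 V' hV' i hiV).2 with h | rfl
      · rw [h₂.eq_of_mem V' hV' W' hW' i (g4 V' hV' i hiV h) (g4 W' hW' i hiW h)]
      · rw [h₂.eq_of_mem V' hV' W' hW' y (g5 V' hV' hiV) (g5 W' hW' hiW)]
  · intro i j k l hij hjk hkl V hV W hW hi hk hj hl
    rcases key V hV with hV₁ | ⟨V', hV', rfl⟩ <;> rcases key W hW with hW₁ | ⟨W', hW', rfl⟩
    · exact h₁.noncrossing i j k l hij hjk hkl V hV₁ W hW₁ hi hk hj hl
    · have := g1 V hV₁ i hi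
      have := g1 V hV₁ k hk
      have := g3 W' hW' j hj
      grind
    · have := g1 W hW₁ j hj
      have := g1 W hW₁ l hl
      have := g3 V' hV' k hk
      grind
    · have e2 := (g3 W' hW' j hj)
      have e1 : i ∈ U := (g3 V' hV' i hi).1
      have hxi := hx i e1
      have hyj : y ≤ j := e2.2.resolve_right (hxi.trans_lt hij).ne'
      have hyk : y ≤ k := hyj.trans hjk.le
      have hyl : y ≤ l := hyk.trans hkl.le
      have k1 := g4 V' hV' k hk hyk
      have k2 := g4 W' hW' j hj hyj
      have k3 := g4 W' hW' l hl hyl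
      rcases (g3 V' hV' i hi).2 with hyi | rfl
      · rw [h₂.noncrossing i j k l hij hjk hkl V' hV' W' hW' (g4 V' hV' i hi hyi) k1 k2 k3]
      · have hyV := g5 V' hV' hi
        rcases hyj.eq_or_lt with rfl | hyj
        · rw [h₂.eq_of_mem V' hV' W' hW' _ hyV k2]
        · rw [h₂.noncrossing y j k l hyj hjk hkl V' hV' W' hW' hyV k1 k2 k3]
  · obtain ⟨V, hV, hyV⟩ := h₂.cover y (Finset.mem_filter.mpr ⟨hyU, le_rfl⟩)
    refine ⟨_, Finset.mem_union_right _ (Finset.mem_image_of_mem _ hV),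
      mem_attachPoint.mpr (Or.inr ⟨rfl, hyV⟩), mem_attachPoint.mpr (Or.inl hyV), hxy, fun z hz hxz => ?_⟩
    exact (g3 V hV z hz).2.resolve_right hxz.ne'

theorem attachPoint_erase (h : IsNCPartition U Q) (hxy : IsNext Q x y) {V : Finset α} (hV : V ∈ Q) :
    attachPoint x y (V.erase x) = V := by
  obtain ⟨B, hB, hxB, hyB, hlt, -⟩ := hxy
  unfold attachPoint
  split_ifs with hy
  · obtain rfl := h.eq_of_mem V hV B hB y (Finset.mem_of_mem_erase hy) hyB
    exact Finset.insert_erase hxB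
  · refine Finset.erase_eq_of_notMem fun hx => hy ?_
    obtain rfl := h.eq_of_mem V hV B hB x hx hxB
    exact Finset.mem_erase.mpr ⟨hlt.ne', hyB⟩

theorem erase_attachPoint {V : Finset α} (hx : x ∉ V) : (attachPoint x y V).erase x = V := by
  unfold attachPoint
  split_ifs
  · exact Finset.erase_insert hx
  · exact Finset.erase_eq_of_notMem hx

theorem IsNCPartition.eq_empty (h : IsNCPartition ∅ Q) : Q = ∅ := by
  refine Finset.eq_empty_of_forall_notMem fun V hV => ?_
  obtain ⟨i, hi⟩ := h.nonempty V hV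
  exact absurd (h.subset V hV i hi) (Finset.notMem_empty i)

theorem isNCPartition_empty : IsNCPartition (∅ : Finset α) ∅ := by
  constructor <;> simp

theorem IsNCPartition.erase_singleton (h : IsNCPartition U Q) (hQ : {x} ∈ Q) :
    IsNCPartition (U.erase x) (Q.erase {x}) where
  nonempty V hV := h.nonempty V (Finset.mem_of_mem_erase hV)
  subset V hV i hi := by
    refine Finset.mem_erase.mpr ⟨?_, h.subset V (Finset.mem_of_mem_erase hV) i hi⟩
    rintro rfl
    exact Finset.ne_of_mem_erase hV
      (h.eq_of_mem V (Finset.mem_of_mem_erase hV) _ hQ i hi (Finset.mem_singleton_self i))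
  cover i hi := by
    obtain ⟨V, hV, hiV⟩ := h.cover i (Finset.mem_of_mem_erase hi)
    refine ⟨V, Finset.mem_erase.mpr ⟨?_, hV⟩, hiV⟩
    rintro rfl
    exact Finset.ne_of_mem_erase hi (Finset.mem_singleton.mp hiV)
  eq_of_mem V hV W hW :=
    h.eq_of_mem V (Finset.mem_of_mem_erase hV) W (Finset.mem_of_mem_erase hW)
  noncrossing i j k l h1 h2 h3 V hV W hW := h.noncrossing i j k l h1 h2 h3 V
    (Finset.mem_of_mem_erase hV) W (Finset.mem_of_mem_erase hW)

theorem IsNCPartition.insert_singleton (hxU : x ∈ U) (h : IsNCPartition (U.erase x) Q) :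
    IsNCPartition U (insert {x} Q) ∧ {x} ∉ Q := by
  have g : ∀ V ∈ Q, x ∉ V := fun V hV hx => Finset.ne_of_mem_erase (h.subset V hV x hx) rfl
  refine ⟨⟨?_, ?_, ?_, ?_, ?_⟩, fun hx => g _ hx (Finset.mem_singleton_self x)⟩
  · intro V hV
    rcases Finset.mem_insert.mp hV with rfl | hV'
    · exact ⟨x, Finset.mem_singleton_self x⟩
    · exact h.nonempty V hV'
  · intro V hV i hi
    rcases Finset.mem_insert.mp hV with rfl | hV'
    · exact Finset.mem_singleton.mp hi ▸ hxU
    · exact Finset.mem_of_mem_erase (h.subset V hV' i hi)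
  · intro i hi
    by_cases hix : i = x
    · exact ⟨{x}, Finset.mem_insert_self _ _, Finset.mem_singleton.mpr hix⟩
    · obtain ⟨V, hV, hiV⟩ := h.cover i (Finset.mem_erase.mpr ⟨hix, hi⟩)
      exact ⟨V, Finset.mem_insert_of_mem hV, hiV⟩
  · intro V hV W hW i hiV hiW
    rcases Finset.mem_insert.mp hV with rfl | hV' <;> rcases Finset.mem_insert.mp hW with rfl | hW'
    · rfl
    · exact absurd hiW (Finset.mem_singleton.mp hiV ▸ g W hW')
    · exact absurd hiV (Finset.mem_singleton.mp hiW ▸ g V hV')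
    · exact h.eq_of_mem V hV' W hW' i hiV hiW
  · intro i j k l h1 h2 h3 V hV W hW hi hk hj hl
    rcases Finset.mem_insert.mp hV with rfl | hV'
    · rw [Finset.mem_singleton] at hi hk
      exact absurd (h1.trans h2) (by simp [hi, hk])
    · rcases Finset.mem_insert.mp hW with rfl | hW'
      · rw [Finset.mem_singleton] at hj hl
        exact absurd (h2.trans h3) (by simp [hj, hl])
      · exact h.noncrossing i j k l h1 h2 h3 V hV' W hW' hi hk hj hl

theorem IsNext.eq (h : IsNCPartition U Q) {z : α} (hy : IsNext Q x y) (hz : IsNext Q x z) :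
    y = z := by
  obtain ⟨B, hB, hxB, hyB, hlt, hmin⟩ := hy
  obtain ⟨C, hC, hxC, hzC, hlt', hmin'⟩ := hz
  obtain rfl := h.eq_of_mem B hB C hC x hxB hxC
  exact le_antisymm (hmin z hzC hlt') (hmin' y hyB hlt)

theorem IsNCPartition.exists_isNext (h : IsNCPartition U Q) (hxU : x ∈ U) (hx : ∀ z ∈ U, x ≤ z)
    (hQ : {x} ∉ Q) : ∃ y ∈ U.erase x, IsNext Q x y := by
  obtain ⟨B, hB, hxB⟩ := h.cover x hxU
  have hne : (B.erase x).Nonempty := by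
    by_contra hcon
    rw [Finset.not_nonempty_iff_eq_empty, Finset.erase_eq_empty_iff] at hcon
    rcases hcon with rfl | rfl
    · exact Finset.notMem_empty x hxB
    · exact hQ hB
  have hm := Finset.min'_mem _ hne
  set y := (B.erase x).min' hne
  obtain ⟨h1, h2⟩ := Finset.mem_erase.mp hm
  exact ⟨y, Finset.mem_erase.mpr ⟨h1, h.subset B hB y h2⟩, B, hB, hxB, h2,
    lt_of_le_of_ne (hx y (h.subset B hB y h2)) h1.symm,
    fun z hz hxz => Finset.min'_le _ _ (Finset.mem_erase.mpr ⟨hxz.ne', hz⟩)⟩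

variable {X R : Type*} [CommRing R]

/-- The value of `k` at the concatenation of the letters of a block. -/
def blockValue (k : List X → R) (a : α → List X) (V : Finset α) : R := k ((V.sort).map a).flatten

open Classical in
/-- The sum over the non-crossing partitions of `U` of the products of the block values. -/
noncomputable def ncSum [Fintype α] (k : List X → R) (a : α → List X) (U : Finset α) : R :=
  ∑ Q ∈ univ.filter (IsNCPartition U), ∏ V ∈ Q, blockValue k a V

/-- As x is the least point and y its successor in the block, y comes first once x is erased;
prefixing the letter of x to that of y restores the word. -/
theorem blockValue_erase (k : List X → R) (a : α → List X) (h : IsNCPartition U Q)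
    (hx : ∀ z ∈ U, x ≤ z) (hxy : IsNext Q x y) {V : Finset α} (hV : V ∈ Q) :
    blockValue k (Function.update a y (a x ++ a y)) (V.erase x) = blockValue k a V := by
  obtain ⟨B, hB, hxB, hyB, hlt, hmin⟩ := hxy
  have hcongr : ∀ s : Finset α, y ∉ s →
      (s.sort).map (Function.update a y (a x ++ a y)) = (s.sort).map a := fun s hs =>
    List.map_congr_left fun i hi => Function.update_of_ne
      (fun e : i = y => hs (e ▸ (Finset.mem_sort _).mp hi)) _ _
  unfold blockValue
  by_cases hyV : y ∈ V
  · obtain rfl := h.eq_of_mem V hV B hB y hyV hyB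
    have hyE : y ∈ V.erase x := Finset.mem_erase.mpr ⟨hlt.ne', hyV⟩
    have hE : (V.erase x).sort = y :: ((V.erase x).erase y).sort := by
      conv_lhs => rw [← Finset.insert_erase hyE]
      refine Finset.sort_insert _ (fun b hb => ?_) (Finset.notMem_erase _ _)
      have hb' := Finset.mem_erase.mp (Finset.mem_of_mem_erase hb)
      exact hmin b hb'.2 (lt_of_le_of_ne (hx b (h.subset V hV b hb'.2)) hb'.1.symm)
    have hF : V.sort = x :: (V.erase x).sort := by
      conv_lhs => rw [← Finset.insert_erase hxB]
      exact Finset.sort_insert _ (fun b hb => hx b (h.subset V hV b (Finset.mem_of_mem_erase hb)))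
        (Finset.notMem_erase _ _)
    rw [hF, hE, List.map_cons, List.map_cons, List.map_cons, hcongr _ (Finset.notMem_erase _ _)]
    simp
  · have hxV : x ∉ V := fun hxV => hyV (h.eq_of_mem V hV B hB x hxV hxB ▸ hyB)
    rw [Finset.erase_eq_of_notMem hxV, hcongr V hyV]

section sums

variable [Fintype α] (k : List X → R) (a : α → List X)

theorem ncSum_empty : ncSum k a ∅ = 1 := by
  classical
  unfold ncSum
  rw [Finset.sum_eq_single_of_mem ∅ (by simp [isNCPartition_empty])]
  · simp
  · intro Q hQ hne
    exact absurd (Finset.mem_filter.mp hQ).2.eq_empty hne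

open Classical in
theorem sum_singleton_mem (hxU : x ∈ U) :
    ∑ Q ∈ univ.filter (fun Q => IsNCPartition U Q ∧ {x} ∈ Q), ∏ V ∈ Q, blockValue k a V =
      k (a x) * ncSum k a (U.erase x) := by
  unfold ncSum
  rw [Finset.mul_sum]
  refine Finset.sum_nbij' (fun Q => Q.erase {x}) (fun Q => insert {x} Q) ?_ ?_ ?_ ?_ ?_
  · intro Q hQ
    have h := (Finset.mem_filter.mp hQ).2
    exact Finset.mem_filter.mpr ⟨Finset.mem_univ _, h.1.erase_singleton h.2⟩
  · intro Q hQ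
    have h := (Finset.mem_filter.mp hQ).2
    exact Finset.mem_filter.mpr ⟨Finset.mem_univ _, (h.insert_singleton hxU).1,
      Finset.mem_insert_self _ _⟩
  · intro Q hQ
    exact Finset.insert_erase (Finset.mem_filter.mp hQ).2.2
  · intro Q hQ
    exact Finset.erase_insert ((Finset.mem_filter.mp hQ).2.insert_singleton hxU).2
  · intro Q hQ
    rw [← Finset.mul_prod_erase Q _ (Finset.mem_filter.mp hQ).2.2]
    simp [blockValue]

open Classical in
theorem sum_isNext (hxU : x ∈ U) (hx : ∀ z ∈ U, x ≤ z) (hy : y ∈ U.erase x) :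
    ∑ Q ∈ univ.filter (fun Q => IsNCPartition U Q ∧ IsNext Q x y), ∏ V ∈ Q, blockValue k a V =
      ncSum k a ((U.erase x).filter (· < y)) *
        ncSum k (Function.update a y (a x ++ a y)) (U.filter (y ≤ ·)) := by
  unfold ncSum
  have hyU := Finset.mem_of_mem_erase hy
  have hxy : x < y := lt_of_le_of_ne (hx y hyU) (Finset.ne_of_mem_erase hy).symm
  set U₁ := (U.erase x).filter (· < y)
  have hinj : ∀ Q, IsNCPartition U Q → IsNext Q x y → ∀ P ⊆ Q, Set.InjOn (·.erase x)
      (P : Set (Finset α)) := by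
    intro Q hQ hn P hP V hV W hW e
    have := congrArg (attachPoint x y) e
    simpa only [attachPoint_erase hQ hn (hP hV), attachPoint_erase hQ hn (hP hW)] using this
  rw [Finset.sum_mul_sum, ← Finset.sum_product']
  refine Finset.sum_nbij'
    (fun Q => (Q.filter (· ⊆ U₁), (Q.filter (¬ · ⊆ U₁)).image (·.erase x)))
    (fun Q => Q.1 ∪ Q.2.image (attachPoint x y)) ?_ ?_ ?_ ?_ ?_
  · intro Q hQ
    obtain ⟨h1, h2⟩ := (Finset.mem_filter.mp hQ).2
    exact Finset.mem_product.mpr ⟨Finset.mem_filter.mpr ⟨Finset.mem_univ _, h1.inner hx h2⟩,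
      Finset.mem_filter.mpr ⟨Finset.mem_univ _, h1.outer hx h2⟩⟩
  · intro Q hQ
    obtain ⟨h1, h2⟩ := Finset.mem_product.mp hQ
    exact Finset.mem_filter.mpr ⟨Finset.mem_univ _, IsNCPartition.glue hxU hx hyU hxy
      (Finset.mem_filter.mp h1).2 (Finset.mem_filter.mp h2).2⟩
  · intro Q hQ
    obtain ⟨h1, h2⟩ := (Finset.mem_filter.mp hQ).2
    have : ((Q.filter (¬ · ⊆ U₁)).image (·.erase x)).image (attachPoint x y) =
        Q.filter (¬ · ⊆ U₁) := by
      rw [Finset.image_image]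
      conv_rhs => rw [← Finset.image_id (s := Q.filter (¬ · ⊆ U₁))]
      exact Finset.image_congr fun V hV => attachPoint_erase h1 h2 (Finset.mem_filter.mp hV).1
    simp only [this]
    exact Finset.filter_union_filter_not_eq _ _
  · rintro ⟨Q₁, Q₂⟩ hQ
    obtain ⟨h1, h2⟩ := Finset.mem_product.mp hQ
    replace h1 := (Finset.mem_filter.mp h1).2
    replace h2 := (Finset.mem_filter.mp h2).2
    have e1 : ∀ V ∈ Q₁, V ⊆ U₁ := fun V hV i hi => h1.subset V hV i hi
    have e2 : ∀ V ∈ Q₂.image (attachPoint x y), ¬ V ⊆ U₁ := by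
      intro V hV hs
      obtain ⟨W, hW, rfl⟩ := Finset.mem_image.mp hV
      obtain ⟨i, hi⟩ := h2.nonempty W hW
      have hyi := (Finset.mem_filter.mp (h2.subset W hW i hi)).2
      exact absurd (Finset.mem_filter.mp (hs (mem_attachPoint.mpr (Or.inl hi)))).2
        (not_lt.mpr hyi)
    have e3 : (Q₂.image (attachPoint x y)).image (·.erase x) = Q₂ := by
      rw [Finset.image_image]
      conv_rhs => rw [← Finset.image_id (s := Q₂)]
      refine Finset.image_congr fun V hV => erase_attachPoint fun hxV => ?_
      exact absurd (Finset.mem_filter.mp (h2.subset V hV x hxV)).2 (not_le.mpr hxy)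
    simp only [Finset.filter_union, Finset.filter_true_of_mem e1, Finset.filter_false_of_mem e2,
      Finset.filter_true_of_mem e2, Finset.union_empty,
      Finset.filter_false_of_mem (fun V hV => not_not.mpr (e1 V hV)), Finset.empty_union, e3]
  · intro Q hQ
    obtain ⟨h1, h2⟩ := (Finset.mem_filter.mp hQ).2
    rw [← Finset.prod_filter_mul_prod_filter_not Q (· ⊆ U₁)]
    congr 1
    rw [Finset.prod_image (hinj Q h1 h2 _ (Finset.filter_subset _ _))]
    exact Finset.prod_congr rfl fun V hV =>
      (blockValue_erase k a h1 hx h2 (Finset.mem_filter.mp hV).1).symm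

/-- The partitions are sorted by the second element y of the block of the least point x. This is the
recursion of `planarSum`, with points in place of positions. -/
theorem ncSum_eq (hxU : x ∈ U) (hx : ∀ z ∈ U, x ≤ z) :
    ncSum k a U = k (a x) * ncSum k a (U.erase x) + ∑ y ∈ U.erase x,
      ncSum k a ((U.erase x).filter (· < y)) *
        ncSum k (Function.update a y (a x ++ a y)) (U.filter (y ≤ ·)) := by
  classical
  rw [← sum_singleton_mem k a hxU, Finset.sum_congr rfl fun y hy => (sum_isNext k a hxU hx hy).symm]
  unfold ncSum
  rw [← Finset.sum_filter_add_sum_filter_not _ (fun Q => {x} ∈ Q), Finset.filter_filter,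
    Finset.filter_filter]
  congr 1
  simp only [Finset.sum_filter]
  rw [Finset.sum_comm]
  refine Finset.sum_congr rfl fun Q _ => ?_
  by_cases hQ : IsNCPartition U Q
  · by_cases hs : {x} ∈ Q
    · have : ∀ y, ¬ IsNext Q x y := by
        rintro y ⟨B, hB, hxB, hyB, hlt, -⟩
        obtain rfl := hQ.eq_of_mem B hB _ hs x hxB (Finset.mem_singleton_self x)
        exact hlt.ne' (Finset.mem_singleton.mp hyB)
      simp [hs, this]
    · obtain ⟨y, hy, hn⟩ := hQ.exists_isNext hxU hx hs
      rw [Finset.sum_eq_single_of_mem y hy]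
      · simp [hQ, hs, hn]
      · intro z _ hz
        exact if_neg fun h => hz (hn.eq hQ h.2).symm
  · simp [hQ]

theorem ncSum_toFinset (l : List α) (hl : l.Pairwise (· < ·)) :
    ncSum k a l.toFinset = planarSum k (l.map a) := by
  induction hn : l.length using Nat.strong_induction_on generalizing l a with
  | _ n ih =>
  subst hn
  cases l with
  | nil => simp [ncSum_empty]
  | cons x w =>
    obtain ⟨hxw, hw⟩ := List.pairwise_cons.mp hl
    have hxw' : x ∉ w := fun h => (hxw x h).false
    have hnd : w.Nodup := hw.imp fun h => h.ne
    have he : (x :: w).toFinset.erase x = w.toFinset := by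
      rw [List.toFinset_cons, Finset.erase_insert (by simpa using hxw')]
    rw [ncSum_eq k a (x := x) (by simp) (by simpa using fun z hz => (hxw z hz).le), he,
      List.map_cons, planarSum_cons, ih w.length (by simp) a w hw rfl,
      List.sum_toFinset _ hnd, ← Fin.sum_univ_fun_getElem]
    congr 1
    refine Fintype.sum_equiv (finCongr (by simp)) _ _ fun i => ?_
    obtain ⟨i, hi⟩ := i
    have hsplit : w = w.take i ++ w[i] :: w.drop (i + 1) := by simp
    obtain ⟨P, y, Q, hP, hy, hQ⟩ : ∃ P y Q, P = w.take i ∧ y = w[i] ∧ Q = w.drop (i + 1) :=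
      ⟨_, _, _, rfl, rfl, rfl⟩
    simp only [Fin.getElem_fin, finCongr_apply, Fin.val_cast, List.getElem_map, ← List.map_take,
      ← List.map_drop, ← hP, ← hy, ← hQ]
    rw [← hP, ← hy, ← hQ] at hsplit
    subst hsplit
    rw [List.pairwise_append, List.pairwise_cons] at hw
    obtain ⟨hPs, ⟨hyQ, hQs⟩, hPQ⟩ := hw
    have f1 : (P ++ y :: Q).toFinset.filter (· < y) = P.toFinset := by
      ext z
      simp only [Finset.mem_filter, List.mem_toFinset, List.mem_append, List.mem_cons]
      constructor
      · rintro ⟨h | rfl | h, hz⟩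
        · exact h
        · exact absurd hz (lt_irrefl _)
        · exact absurd (hyQ z h) hz.not_gt
      · exact fun h => ⟨Or.inl h, hPQ z h y (by simp)⟩
    have f2 : (x :: (P ++ y :: Q)).toFinset.filter (y ≤ ·) = (y :: Q).toFinset := by
      ext z
      simp only [Finset.mem_filter, List.mem_toFinset, List.mem_append, List.mem_cons]
      constructor
      · rintro ⟨rfl | h | h, hz⟩
        · exact absurd (hxw y (by simp)) hz.not_gt
        · exact absurd (hPQ z h y (by simp)) hz.not_gt
        · exact h
      · rintro (rfl | h)
        · exact ⟨by simp, le_rfl⟩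
        · exact ⟨by simp [h], (hyQ z h).le⟩
    have hyQ' : y ∉ Q := fun h => (hyQ y h).false
    rw [f1, f2, ih P.length (by simp) a P hPs rfl,
      ih (y :: Q).length (by simp) _ (y :: Q) (List.pairwise_cons.mpr ⟨hyQ, hQs⟩) rfl, List.map_cons,
      Function.update_self,
      List.map_congr_left fun z hz => Function.update_of_ne (fun e : z = y => hyQ' (e ▸ hz)) _ _]

end sums

end partitions

/-! ### The sums over `NC n` as planar sums -/

section frozen

variable {n : ℕ} {R A : Type*} [CommRing R]

theorem IsNoncrossing.isNCPartition {π : Finpartition (univ : Finset (Fin n))}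
    (h : IsNoncrossing π) : IsNCPartition univ π.parts where
  nonempty _ hV := π.nonempty_of_mem_parts hV
  subset _ _ i _ := Finset.mem_univ i
  cover _ hi := π.exists_mem hi
  eq_of_mem _ hV _ hW _ hiV hiW := π.eq_of_mem_parts hV hW hiV hiW
  noncrossing := h

/-- The partition with a given set of blocks. -/
def IsNCPartition.toFinpartition {Q : Finset (Finset (Fin n))} (h : IsNCPartition univ Q) :
    Finpartition (univ : Finset (Fin n)) where
  parts := Q
  supIndep := by
    rw [Finset.supIndep_iff_pairwiseDisjoint]
    intro V hV W hW hne
    exact Finset.disjoint_left.mpr fun i hi hi' => hne (h.eq_of_mem V hV W hW i hi hi')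
  sup_parts := by
    refine Finset.eq_univ_iff_forall.mpr fun i => ?_
    obtain ⟨V, hV, hi⟩ := h.cover i (Finset.mem_univ i)
    exact Finset.mem_sup.mpr ⟨V, hV, hi⟩
  bot_notMem hb := (h.nonempty _ hb).ne_empty rfl

open Classical in
theorem sum_NC (g : Finset (Fin n) → R) :
    ∑ π ∈ NC n, ∏ V ∈ π.parts, g V =
      ∑ Q ∈ univ.filter (IsNCPartition (univ : Finset (Fin n))), ∏ V ∈ Q, g V := by
  refine Finset.sum_bij (fun π _ => π.parts) ?_ ?_ ?_ ?_
  · intro π hπ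
    exact Finset.mem_filter.mpr ⟨Finset.mem_univ _, (Finset.mem_filter.mp hπ).2.isNCPartition⟩
  · intro π _ ρ _ h
    exact Finpartition.ext h
  · intro Q hQ
    have h := (Finset.mem_filter.mp hQ).2
    exact ⟨h.toFinpartition, Finset.mem_filter.mpr ⟨Finset.mem_univ _, h.noncrossing⟩, rfl⟩
  · intro π _
    rfl

theorem map_sort_eq_ofFn_restr (a : Fin n → A) (V : Finset (Fin n)) :
    (V.sort).map a = List.ofFn (restr a V) := by
  rw [← Finset.listMap_orderEmbOfFin_finRange V rfl, List.map_map, List.ofFn_eq_map]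
  rfl

theorem flatten_map_singleton {ι : Type*} (a : ι → A) (l : List ι) :
    (l.map fun i => [a i]).flatten = l.map a := by
  induction l with
  | nil => rfl
  | cons x l ih => simp [ih]

/-- The sum over non-crossing partitions in terms of `planarSum`. -/
theorem sum_NC_eq_planarSum (k : List A → R) (a : Fin n → A) :
    ∑ π ∈ NC n, ∏ V ∈ π.parts, k (List.ofFn (restr a V)) =
      planarSum k ((List.ofFn a).map fun x => [x]) := by
  classical
  rw [sum_NC]
  have h := ncSum_toFinset k (fun i => [a i]) (List.finRange n) (List.pairwise_lt_finRange n)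
  rw [List.toFinset_finRange] at h
  rw [List.ofFn_eq_map, List.map_map]
  refine Eq.trans ?_ h
  unfold ncSum blockValue
  refine Finset.sum_congr rfl fun Q _ => Finset.prod_congr rfl fun V _ => ?_
  rw [flatten_map_singleton, map_sort_eq_ofFn_restr]

end frozen

/-! ### Symmetric non-crossing annular permutations -/

section sumCongr

open Equiv

variable {α β : Type*}

theorem sumCongr_zpow (s : Perm α) (r : Perm β) (i : ℤ) :
    (sumCongr s r : Perm (α ⊕ β)) ^ i = sumCongr (s ^ i) (r ^ i) := by
  have := map_zpow (Perm.sumCongrHom α β) (s, r) i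
  simpa using this.symm

theorem numCycles_sumCongr [Finite α] [Finite β] (s : Perm α) (r : Perm β) :
    numCycles (sumCongr s r : Perm (α ⊕ β)) = numCycles s + numCycles r := by
  unfold numCycles
  rw [← Nat.card_sum]
  have hl : ∀ a b, Perm.SameCycle (sumCongr s r) (Sum.inl a) (Sum.inl b) ↔
      s.SameCycle a b := fun a b => by simp [Perm.SameCycle, sumCongr_zpow]
  have hr : ∀ a b, Perm.SameCycle (sumCongr s r) (Sum.inr a) (Sum.inr b) ↔
      r.SameCycle a b := fun a b => by simp [Perm.SameCycle, sumCongr_zpow]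
  have hlr : ∀ a b, ¬ Perm.SameCycle (sumCongr s r) (Sum.inl a) (Sum.inr b) :=
    fun a b => by simp [Perm.SameCycle, sumCongr_zpow]
  refine Nat.card_congr ⟨Quotient.lift
      (Sum.elim (fun a => Sum.inl ⟦a⟧) (fun b => Sum.inr ⟦b⟧)) ?_,
    Sum.elim (Quotient.lift (fun a => ⟦Sum.inl a⟧) ?_) (Quotient.lift (fun b => ⟦Sum.inr b⟧) ?_),
    ?_, ?_⟩
  · rintro (a | a) (b | b) h
    · exact congrArg Sum.inl (Quotient.sound ((hl a b).mp h))
    · exact absurd h (hlr a b)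
    · exact absurd (Perm.SameCycle.symm h) (hlr b a)
    · exact congrArg Sum.inr (Quotient.sound ((hr a b).mp h))
  · exact fun a b h => Quotient.sound ((hl a b).mpr h)
  · exact fun a b h => Quotient.sound ((hr a b).mpr h)
  · intro q
    induction q using Quotient.inductionOn with
    | h x => rcases x with a | b <;> rfl
  · rintro (q | q) <;> induction q using Quotient.inductionOn <;> rfl

end sumCongr

/-! ### Symmetric permutations of the signed points -/

section delta

open Equiv

variable {n : ℕ} {σ : Perm (PM n)}

@[simp] theorem deltaPerm_inl (i : Fin n) : deltaPerm n (Sum.inl i) = Sum.inr i := rfl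

@[simp] theorem deltaPerm_inr (i : Fin n) : deltaPerm n (Sum.inr i) = Sum.inl i := rfl

theorem deltaPerm_deltaPerm (z : PM n) : deltaPerm n (deltaPerm n z) = z := by
  rcases z with i | i <;> rfl

theorem deltaPerm_ne (z : PM n) : deltaPerm n z ≠ z := by
  rcases z with i | i <;> simp

theorem isPairing_iff_symPerm : IsPairing (σ * deltaPerm n) ↔ SymPerm (deltaPerm n) σ := by
  constructor
  · intro h
    refine ⟨Equiv.ext fun x => ?_, fun z hz => (h (deltaPerm n z)).1 ?_⟩
    · have := (h (deltaPerm n x)).2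
      simpa [deltaPerm_deltaPerm] using this
    · simpa [deltaPerm_deltaPerm] using hz
  · intro h x
    refine ⟨fun hx => h.2 (deltaPerm n x) (by simpa [deltaPerm_deltaPerm] using hx), ?_⟩
    have := congrArg (fun f : Perm (PM n) => f (deltaPerm n x)) h.1
    simpa [deltaPerm_deltaPerm] using this

theorem SymPerm.delta_conj (h : SymPerm (deltaPerm n) σ) (z : PM n) :
    deltaPerm n (σ (deltaPerm n z)) = σ⁻¹ z := by
  rw [Equiv.Perm.eq_inv_iff_eq]
  have := congrArg (fun f : Perm (PM n) => f (deltaPerm n z)) h.1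
  simpa [deltaPerm_deltaPerm] using this

theorem annulusPerm_eq :
    annulusPerm n = sumCongr (finRotate n) (finRotate n)⁻¹ := by
  ext z
  rcases z with i | i
  · simp [annulusPerm, gammaPerm, Perm.sumCongr_inv]
  · simp [annulusPerm, gammaPerm, Perm.sumCongr_inv]

/-- A symmetric permutation with `#(σ) + #(σ⁻¹ Γ) = 2n` connects the two cycles of `Γ`. -/
theorem exists_sameCycle_of_numCycles (hn : n ≠ 0) (h : SymPerm (deltaPerm n) σ)
    (hσ : numCycles σ + numCycles (σ⁻¹ * annulusPerm n) = 2 * n) :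
    ∃ k l : Fin n, σ.SameCycle (Sum.inl k) (Sum.inr l) := by
  by_contra hcon
  push Not at hcon
  have hmem : σ ∈ (Perm.sumCongrHom (Fin n) (Fin n)).range := by
    refine Perm.mem_sumCongrHom_range_of_perm_mapsTo_inl ?_
    rintro _ ⟨i, rfl⟩
    rcases hi : σ (Sum.inl i) with j | j
    · exact ⟨j, rfl⟩
    · exact absurd ⟨1, by simpa using hi⟩ (hcon i j)
  obtain ⟨⟨s, r⟩, rfl⟩ := hmem
  have hr : r = s⁻¹ := by
    ext i
    have := h.delta_conj (Sum.inl i)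
    simp only [Perm.sumCongrHom_apply, Perm.sumCongr_inv, deltaPerm_inl, sumCongr_apply, Sum.map_inr,
      deltaPerm_inr, Sum.map_inl, Sum.inl.injEq] at this
    rw [this]
  subst hr
  set c := finRotate n
  have e : (Perm.sumCongrHom (Fin n) (Fin n) (s, s⁻¹))⁻¹ * annulusPerm n =
      sumCongr (s⁻¹ * c) (s * c⁻¹) := by
    rw [annulusPerm_eq, Perm.sumCongrHom_apply, Perm.sumCongr_inv, Perm.sumCongr_mul, inv_inv]
  have e2 : numCycles (s * c⁻¹) = numCycles (s⁻¹ * c) := by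
    rw [← numCycles_conj (s⁻¹ * c) s, ← numCycles_inv]
    congr 1
    group
  rw [e, Perm.sumCongrHom_apply, numCycles_sumCongr, numCycles_sumCongr, numCycles_inv, e2] at hσ
  dsimp only at hσ
  -- A σ that does not connect the two cycles is s on the positive and s⁻¹ on the negative points,
  -- so #(s) + #(s⁻¹c) = n. The sign of the n-cycle c forces this sum to have the parity of n + 1.
  have s1 := sign_eq_neg_one_pow s
  have s2 := sign_eq_neg_one_pow (s⁻¹ * c)
  obtain ⟨m, rfl⟩ := Nat.exists_eq_succ_of_ne_zero hn
  have s3 : (Perm.sign c : ℤ) = (-1) ^ m := by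
    rw [sign_finRotate]; simp
  rw [Perm.sign_mul, Perm.sign_inv, Units.val_mul] at s2
  have s4 : (-1 : ℤ) ^ m = (-1) ^ (m + 1) * (-1) ^ (2 * (m + 1)) := by
    calc (-1 : ℤ) ^ m = (Perm.sign s * Perm.sign s : ℤˣ) * (Perm.sign c : ℤ) := by
          rw [s3, Int.units_mul_self]; simp
      _ = (Perm.sign s : ℤ) * ((Perm.sign s : ℤ) * (Perm.sign c : ℤ)) := by
          push_cast; ring
      _ = _ := by
          rw [s2, s1, ← pow_add, ← pow_add, Fintype.card_fin]
          congr 1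
          omega
  rw [pow_mul, neg_one_sq, one_pow, mul_one, pow_succ] at s4
  have : (-1 : ℤ) ^ m ≠ 0 := pow_ne_zero _ (by norm_num)
  omega

/-- The positive points in their order. -/
def posWord (n : ℕ) : List (PM n) := (List.finRange n).map Sum.inl

theorem formPerm_posWord : (posWord n).formPerm = gammaPerm n := by
  have hnd : (posWord n).Nodup := (List.nodup_finRange n).map Sum.inl_injective
  ext z : 1
  rcases z with i | i
  · have h := List.formPerm_apply_getElem (posWord n) hnd i (by simp [posWord])
    simp only [posWord, List.getElem_map, List.getElem_finRange, List.length_map,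
      List.length_finRange, Fin.cast_mk, Fin.eta] at h
    rw [posWord, h]
    obtain ⟨m, rfl⟩ := Nat.exists_eq_succ_of_ne_zero i.pos.ne'
    simp only [gammaPerm, Equiv.sumCongr_apply, Sum.map_inl, finRotate_apply, Sum.inl.injEq]
    ext
    simp [Fin.val_add]
  · rw [List.formPerm_apply_of_notMem (by simp [posWord])]
    rfl

theorem signedNodup_posWord : SignedNodup (deltaPerm n) (posWord n) := by
  have h := List.nodup_finRange n
  unfold SignedNodup posWord
  rw [List.pairwise_map]
  exact h.imp fun h => ⟨by simpa using h.symm, by simp⟩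

theorem signedSupport_posWord : signedSupport (deltaPerm n) (posWord n) = Set.univ := by
  ext z
  rcases z with i | i <;> simp [signedSupport, posWord]

end delta

/-! ### The annular part of the moment-cumulant formula as a crosscap sum -/

section link

open Equiv

variable {n : ℕ} {A R : Type*} [CommRing R] {k : List A → R} {t : A → A}

/-- The one-letter words of the signed points. -/
def signedLetter (t : A → A) (a : Fin n → A) (z : PM n) : List A :=
  [Sum.elim a (fun i => t (a i)) z]

theorem isLettering_signedLetter (ht : ∀ x, t (t x) = x) (a : Fin n → A) {l : List (PM n)}
    (hl : signedSupport (deltaPerm n) l = Set.univ) :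
    IsLettering (deltaPerm n) t (signedLetter t a) l where
  delta z := by rcases z with i | i <;> simp [signedLetter, ht]
  eq_nil z hz := absurd (hl ▸ Set.mem_univ z) hz

theorem posWord_map_signedLetter (a : Fin n → A) :
    (posWord n).map (signedLetter t a) = (List.ofFn a).map fun x => [x] := by
  rw [posWord, List.map_map, List.ofFn_eq_map, List.map_map]
  rfl

/-- This is `wordSumEval` for the single word 1, …, n. The connectivity condition in `SNCdelta`
follows from the other two, so it does not restrict the sum. -/
theorem sum_SNCdelta_pairProd (hk : IsDihedral k t) (ht : ∀ x, t (t x) = x) (a : Fin n → A) :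
    ∑ σ ∈ SNCdelta n, pairProd k (deltaPerm n) (signedLetter t a) σ =
      crosscapSum k t ((List.ofFn a).map fun x => [x]) := by
  classical
  by_cases hn : n = 0
  · subst hn
    have : SNCdelta 0 = ∅ := Finset.filter_false_of_mem fun σ _ h => h.1.choose.elim0
    simp [this]
  -- With 2n signed points, n letters and one word the planar level is 2n + 2, so the level 2n is
  -- that of one crosscap. For n = 0 there would be no non-empty word.
  have h := (wordSumEval hk deltaPerm_deltaPerm deltaPerm_ne ht [posWord n]
    (by simpa using signedNodup_posWord)).crosscap (signedLetter t a)
    (isLettering_signedLetter ht a (by simpa using signedSupport_posWord)) (2 * n) (by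
      have : (posWord n).isEmpty = false := by simp [posWord, hn]
      simp [neCount, this]
      simp [posWord]
      omega)
  rw [List.map_cons, List.map_nil, posWord_map_signedLetter] at h
  simp only [crosscapTotal, List.map_nil, List.prod_nil, mul_one, mul_zero, add_zero] at h
  rw [← h]
  unfold wordSum genusSum
  refine Finset.sum_congr ?_ fun _ _ => rfl
  have hΓ : annulusOf (deltaPerm n) (wordPerm [posWord n]) = annulusPerm n := by
    simp [annulusOf, wordPerm, formPerm_posWord, annulusPerm]
  ext σ
  simp only [SNCdelta, Finset.mem_filter, Finset.mem_univ, true_and, hΓ, List.flatten_cons,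
    List.flatten_nil, List.append_nil, signedSupport_posWord, Set.mem_univ, not_true_eq_false,
    false_imp_iff, implies_true, isPairing_iff_symPerm]
  exact ⟨fun h => ⟨h.2.2, h.2.1⟩, fun h => ⟨exists_sameCycle_of_numCycles hn h.1 h.2, h.2, h.1⟩⟩

/-- The free cumulant of a list, with value `1` at the empty list. -/
noncomputable def listCumulant [Ring A] [Algebra ℂ A] (τ : A →ₗ[ℂ] ℂ) (L : List A) : ℂ :=
  if L = [] then 1 else freeCumulant τ L.length L.get

theorem freeCumulant_congr [Ring A] [Algebra ℂ A] (τ : A →ₗ[ℂ] ℂ) {m n : ℕ} (h : m = n)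
    {a : Fin m → A} {b : Fin n → A} (hab : ∀ i, a i = b (Fin.cast h i)) :
    freeCumulant τ m a = freeCumulant τ n b := by
  subst h
  exact congrArg _ (funext hab)

theorem listCumulant_ofFn [Ring A] [Algebra ℂ A] (τ : A →ₗ[ℂ] ℂ) (hn : n ≠ 0) (a : Fin n → A) :
    listCumulant τ (List.ofFn a) = freeCumulant τ n a := by
  rw [listCumulant, if_neg (by simpa using hn)]
  exact freeCumulant_congr τ (List.length_ofFn) fun i => by simp; rfl

variable [Ring A] [Algebra ℂ A] (P : RealInfProbSpace A)

theorem cycleCumulant_eq_loopValue (σ : Perm (PM n)) (a : Fin n → A) (x : PM n) :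
    P.cycleCumulant σ a x = loopValue (listCumulant P.τ) (signedLetter P.t a) σ x := by
  rw [RealInfProbSpace.cycleCumulant, loopValue, ← listCumulant_ofFn _ (minimalPeriod_pos σ x).ne']
  congr 1
  unfold signedLetter
  rw [flatten_map_singleton, loopFrom, List.map_map, List.ofFn_eq_map, ← List.map_coe_finRange_eq_range,
    List.map_map]
  rfl

/-- Every conjugate pair contains a positive point, because δ exchanges the signs; the least one
indexes the pair. -/
theorem kappaHalf_eq_pairProd (hk : IsDihedral (listCumulant P.τ) P.t) {σ : Perm (PM n)}
    (hσ : SymPerm (deltaPerm n) σ) (a : Fin n → A) :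
    P.kappaHalf σ a =
      pairProd (listCumulant P.τ) (deltaPerm n) (signedLetter P.t a) σ := by
  classical
  have hq := fun i j : Fin n => quot_mk_eq_iff deltaPerm_deltaPerm hσ (Sum.inl i) (Sum.inl j)
  simp only [deltaPerm_inl] at hq
  unfold RealInfProbSpace.kappaHalf pairProd
  simp only [← hq]
  refine Finset.prod_bij (fun i _ => Quot.mk (pairRel (deltaPerm n) σ) (Sum.inl i)) ?_ ?_ ?_ ?_
  · simp
  · intro i hi j hj h
    exact le_antisymm ((Finset.mem_filter.mp hi).2 j h) ((Finset.mem_filter.mp hj).2 i h.symm)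
  · intro q _
    have hne : (univ.filter fun i : Fin n =>
        Quot.mk (pairRel (deltaPerm n) σ) (Sum.inl i) = q).Nonempty := by
      induction q using Quot.inductionOn with
      | h z =>
        rcases z with i | i
        · exact ⟨i, by simp⟩
        · exact ⟨i, Finset.mem_filter.mpr ⟨Finset.mem_univ _, Quot.sound (Or.inr rfl)⟩⟩
    have hm := (Finset.mem_filter.mp (Finset.min'_mem _ hne)).2
    refine ⟨Finset.min' _ hne, Finset.mem_filter.mpr ⟨Finset.mem_univ _, fun j hj => ?_⟩, hm⟩
    exact Finset.min'_le _ j (Finset.mem_filter.mpr ⟨Finset.mem_univ _, hj.symm.trans hm⟩)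
  · intro i _
    rw [loopValue_out hk hσ (isLettering_signedLetter P.t_t a signedSupport_posWord).delta]
    exact cycleCumulant_eq_loopValue P σ a _

/-- The annular part of the moment-cumulant formula in terms of `crosscapSum`. -/
theorem sum_kappaHalf (hk : IsDihedral (listCumulant P.τ) P.t) (a : Fin n → A) :
    ∑ σ ∈ SNCdelta n, P.kappaHalf σ a =
      crosscapSum (listCumulant P.τ) P.t ((List.ofFn a).map fun x => [x]) := by
  classical
  rw [← sum_SNCdelta_pairProd hk P.t_t a]
  refine Finset.sum_congr rfl fun σ hσ => kappaHalf_eq_pairProd P hk ?_ a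
  exact isPairing_iff_symPerm.mp (Finset.mem_filter.mp hσ).2.2.2

end link

/-! ### Invariance of planar and crosscap sums -/

section invariance

open Equiv

variable {X Y R : Type*} [CommRing R] {k k' : List X → R} {t : X → X}

/-- The word of one-letter lists. -/
def singles (L : List X) : List (List X) := L.map fun x => [x]

@[simp] theorem singles_nil : singles ([] : List X) = [] := rfl

@[simp] theorem singles_cons (x : X) (L : List X) : singles (x :: L) = [x] :: singles L := rfl

@[simp] theorem singles_append (L M : List X) : singles (L ++ M) = singles L ++ singles M := by
  simp [singles]

@[simp] theorem length_singles (L : List X) : (singles L).length = L.length := by simp [singles]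

@[simp] theorem flatten_singles (L : List X) : (singles L).flatten = L := by
  induction L with
  | nil => rfl
  | cons x L ih => simp [ih]

theorem ne_nil_of_mem_singles {L : List X} {x : List X} (h : x ∈ singles L) : x ≠ [] := by
  obtain ⟨y, -, rfl⟩ := List.mem_map.mp h
  simp

theorem dag_singles (L : List X) : dag (dag t) (singles L) = singles (dag t L) := by
  induction L with
  | nil => rfl
  | cons x L ih => simp [ih]

/-- The recursions defining the planar and crosscap sums single out a first letter, which hides
their symmetry. `wordSum` sees a word only through Γ and the support, and these do not change under
rotation or conjugation. -/
theorem wordSum_append_comm {n : ℕ} {u v : List (PM n)} (h : SignedNodup (deltaPerm n) (u ++ v))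
    (a : PM n → List X) (j : ℕ) :
    wordSum k (deltaPerm n) [u ++ v] a j = wordSum k (deltaPerm n) [v ++ u] a j := by
  have e1 : wordPerm [u ++ v] = wordPerm [v ++ u] := by
    simpa [wordPerm] using formPerm_append_comm h.nodup
  have e2 : signedSupport (deltaPerm n) [u ++ v].flatten =
      signedSupport (deltaPerm n) [v ++ u].flatten := by
    ext z; simp [signedSupport, or_comm]
  rw [wordSum, wordSum, e1, e2]

theorem wordSum_dag {n : ℕ} {u : List (PM n)} (h : SignedNodup (deltaPerm n) u)
    (a : PM n → List X) (j : ℕ) :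
    wordSum k (deltaPerm n) [u] a j = wordSum k (deltaPerm n) [dag (deltaPerm n) u] a j := by
  have e1 := annulusOf_wordPerm_flip deltaPerm_deltaPerm deltaPerm_ne (A := []) (B := []) (w := u)
    (by simpa using h) (by simpa using (signedNodup_dag deltaPerm_deltaPerm).mpr h)
  have e2 : signedSupport (deltaPerm n) [u].flatten =
      signedSupport (deltaPerm n) [dag (deltaPerm n) u].flatten := by
    ext z
    simp only [signedSupport, List.flatten_cons, List.flatten_nil, List.append_nil,
      Set.mem_ofPred_eq, mem_dag deltaPerm_deltaPerm, deltaPerm_deltaPerm]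
    exact or_comm
  rw [List.nil_append, List.nil_append] at e1
  rw [wordSum, wordSum, e1, e2]

theorem signedSupport_of_perm {n : ℕ} {u : List (PM n)} (h : u.Perm (posWord n)) :
    signedSupport (deltaPerm n) u = Set.univ := by
  rw [← signedSupport_posWord]
  ext z
  simp [signedSupport, h.mem_iff]

theorem wordSum_eq_planarSum (hk : IsDihedral k t) (ht : ∀ x, t (t x) = x) {n : ℕ} (hn : n ≠ 0)
    {u : List (PM n)} (h : SignedNodup (deltaPerm n) u) (hu : u.length = n)
    (hs : signedSupport (deltaPerm n) u = Set.univ) (a : Fin n → X) :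
    wordSum k (deltaPerm n) [u] (signedLetter t a) (2 * n + 2) =
      planarSum k (u.map (signedLetter t a)) := by
  have := (wordSumEval hk deltaPerm_deltaPerm deltaPerm_ne ht [u] (by simpa using h)).planar
    (signedLetter t a) (isLettering_signedLetter ht a (by simpa using hs)) (2 * n + 2) (by
      have : u.isEmpty = false := by
        rw [List.isEmpty_eq_false_iff, ← List.length_pos_iff, hu]; omega
      simp [neCount, this, hu]
      omega)
  simpa using this

theorem wordSum_eq_crosscapSum (hk : IsDihedral k t) (ht : ∀ x, t (t x) = x) {n : ℕ} (hn : n ≠ 0)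
    {u : List (PM n)} (h : SignedNodup (deltaPerm n) u) (hu : u.length = n)
    (hs : signedSupport (deltaPerm n) u = Set.univ) (a : Fin n → X) :
    wordSum k (deltaPerm n) [u] (signedLetter t a) (2 * n) =
      crosscapSum k t (u.map (signedLetter t a)) := by
  have := (wordSumEval hk deltaPerm_deltaPerm deltaPerm_ne ht [u] (by simpa using h)).crosscap
    (signedLetter t a) (isLettering_signedLetter ht a (by simpa using hs)) (2 * n) (by
      have : u.isEmpty = false := by
        rw [List.isEmpty_eq_false_iff, ← List.length_pos_iff, hu]; omega
      simp [neCount, this, hu]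
      omega)
  simpa [crosscapTotal] using this

theorem exists_posWord_eq_append (L M : List X) : ∃ u v : List (PM (L ++ M).length),
    posWord _ = u ++ v ∧ u.map (signedLetter t (L ++ M).get) = singles L ∧
      v.map (signedLetter t (L ++ M).get) = singles M := by
  have h := posWord_map_signedLetter (t := t) (L ++ M).get
  rw [List.ofFn_get] at h
  change _ = singles (L ++ M) at h
  rw [singles_append, List.map_eq_append_iff] at h
  obtain ⟨u, v, h1, h2, h3⟩ := h
  exact ⟨u, v, h1, h2, h3⟩

theorem length_posWord (n : ℕ) : (posWord n).length = n := by simp [posWord]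

theorem planarSum_dag (hk : IsDihedral k t) (ht : ∀ x, t (t x) = x) (L : List X) :
    planarSum k (singles (dag t L)) = planarSum k (singles L) := by
  rcases eq_or_ne L [] with rfl | hL
  · rfl
  have hn : L.length ≠ 0 := by simpa using hL
  have e := posWord_map_signedLetter (t := t) L.get
  rw [List.ofFn_get] at e
  change _ = singles L at e
  have hu := signedNodup_posWord (n := L.length)
  have hletter := isLettering_signedLetter ht L.get (signedSupport_posWord (n := L.length))
  have hs : signedSupport (deltaPerm L.length) (dag (deltaPerm L.length) (posWord _)) =
      Set.univ := by
    rw [← signedSupport_posWord]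
    ext z
    simp only [signedSupport, Set.mem_ofPred_eq, mem_dag deltaPerm_deltaPerm, deltaPerm_deltaPerm]
    exact or_comm
  have e2 : (dag (deltaPerm L.length) (posWord L.length)).map (signedLetter t L.get) =
      dag (dag t) (singles L) := by
    rw [← e]
    simp only [dag, List.map_reverse, List.map_map]
    congr 1
    exact List.map_congr_left fun z _ => hletter.delta z
  rw [← dag_singles, ← e2, ← e, ← wordSum_eq_planarSum hk ht hn
    ((signedNodup_dag deltaPerm_deltaPerm).mpr hu) (by simp [length_posWord]) hs,
    ← wordSum_eq_planarSum hk ht hn hu (length_posWord _) signedSupport_posWord, ← wordSum_dag hu]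

theorem planarSum_rotate_of_isDihedral (hk : IsDihedral k t) (ht : ∀ x, t (t x) = x)
    (L M : List X) : planarSum k (singles (L ++ M)) = planarSum k (singles (M ++ L)) := by
  rcases eq_or_ne (L ++ M) [] with hL | hL
  · simp_all
  obtain ⟨u, v, h1, h2, h3⟩ := exists_posWord_eq_append (t := t) L M
  have hn : (L ++ M).length ≠ 0 := by rwa [Ne, List.length_eq_zero_iff]
  have hu := signedNodup_posWord (n := (L ++ M).length)
  rw [h1] at hu
  have hp : (v ++ u).Perm (posWord _) := h1 ▸ List.perm_append_comm
  have hv := (signedNodup_perm deltaPerm_deltaPerm (hp.trans (List.Perm.of_eq h1))).mpr hu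
  rw [singles_append, singles_append, ← h2, ← h3, ← List.map_append, ← List.map_append,
    ← wordSum_eq_planarSum hk ht hn hu (h1 ▸ length_posWord _)
      (h1 ▸ signedSupport_posWord),
    ← wordSum_eq_planarSum hk ht hn hv (hp.length_eq.trans (length_posWord _))
      (signedSupport_of_perm hp), wordSum_append_comm hu]

theorem crosscapSum_rotate (hk : IsDihedral k t) (ht : ∀ x, t (t x) = x)
    (L M : List X) : crosscapSum k t (singles (L ++ M)) = crosscapSum k t (singles (M ++ L)) := by
  rcases eq_or_ne (L ++ M) [] with hL | hL
  · simp_all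
  obtain ⟨u, v, h1, h2, h3⟩ := exists_posWord_eq_append (t := t) L M
  have hn : (L ++ M).length ≠ 0 := by rwa [Ne, List.length_eq_zero_iff]
  have hu := signedNodup_posWord (n := (L ++ M).length)
  rw [h1] at hu
  have hp : (v ++ u).Perm (posWord _) := h1 ▸ List.perm_append_comm
  have hv := (signedNodup_perm deltaPerm_deltaPerm (hp.trans (List.Perm.of_eq h1))).mpr hu
  rw [singles_append, singles_append, ← h2, ← h3, ← List.map_append, ← List.map_append,
    ← wordSum_eq_crosscapSum hk ht hn hu (h1 ▸ length_posWord _)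
      (h1 ▸ signedSupport_posWord),
    ← wordSum_eq_crosscapSum hk ht hn hv (hp.length_eq.trans (length_posWord _))
      (signedSupport_of_perm hp), wordSum_append_comm hu]

theorem planarSum_map (k : List Y → R) (f : X → Y) (W : List (List X)) :
    planarSum k (W.map (List.map f)) = planarSum (fun L => k (L.map f)) W := by
  induction hn : W.length using Nat.strong_induction_on generalizing W with
  | _ n ih =>
  subst hn
  cases W with
  | nil => simp
  | cons L W =>
    rw [List.map_cons, planarSum_cons, planarSum_cons, ih W.length (by simp) W rfl]
    congr 1
    refine Fintype.sum_equiv (finCongr (by simp)) _ _ fun i => ?_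
    have hi : (i : ℕ) < W.length := by simpa using i.2
    simp only [Fin.getElem_fin, finCongr_apply, Fin.val_cast, List.getElem_map, ← List.map_take,
      ← List.map_drop]
    rw [ih _ (by simp) _ rfl, ← List.map_append, ← List.map_cons, ih _ (by simp; omega) _ rfl]

/-- The extension of a cyclic function on words over `X` to a dihedral function on words over two
copies of `X`. -/
def doubled (k : List X → R) (L : List (X ⊕ X)) : R :=
  if ∀ x ∈ L, x.isLeft then k (L.filterMap Sum.getLeft?)
  else if ∀ x ∈ L, x.isRight then k (L.filterMap Sum.getRight?).reverse else 0

/-- Evaluation through `wordSum` requires invariance under conjugation, but dual cumulants are only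
known to be cyclic, as τ' need not be invariant under t. A second copy of the alphabet supplies
formal transposes, and on the original letters nothing changes. -/
theorem isDihedral_doubled (hk : k [] = 1) (hr : ∀ L M, k (L ++ M) = k (M ++ L)) :
    IsDihedral (doubled k) Sum.swap where
  nil := by simpa [doubled] using hk
  rotate L M := by
    have e : ∀ p : X ⊕ X → Prop, (∀ x ∈ L ++ M, p x) ↔ ∀ x ∈ M ++ L, p x := fun p => by
      simp only [List.mem_append, or_comm]
    simp only [doubled, e, List.filterMap_append, List.reverse_append, hr]
  dag L := by
    have e1 : (∀ x ∈ dag Sum.swap L, x.isLeft) ↔ ∀ x ∈ L, x.isRight := by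
      simp [dag]
    have e2 : (∀ x ∈ dag Sum.swap L, x.isRight) ↔ ∀ x ∈ L, x.isLeft := by
      simp [dag]
    have e3 : (dag Sum.swap L).filterMap Sum.getLeft? = (L.filterMap Sum.getRight?).reverse := by
      rw [dag, List.filterMap_reverse, List.filterMap_map]
      congr 2
      ext x; rcases x <;> rfl
    have e4 : (dag Sum.swap L).filterMap Sum.getRight? = (L.filterMap Sum.getLeft?).reverse := by
      rw [dag, List.filterMap_reverse, List.filterMap_map]
      congr 2
      ext x; rcases x <;> rfl
    simp only [doubled, e1, e2, e3, e4, List.reverse_reverse]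
    by_cases h1 : ∀ x ∈ L, x.isLeft <;> by_cases h2 : ∀ x ∈ L, x.isRight
    · have : L = [] := by
        refine List.eq_nil_iff_forall_not_mem.mpr fun x hx => ?_
        have := h1 x hx
        have := h2 x hx
        rcases x <;> simp_all
      simp [this]
    · rw [if_neg h2, if_pos h1, if_pos h1]
    · rw [if_pos h2, if_neg h1, if_pos h2]
    · rw [if_neg h2, if_neg h1, if_neg h1, if_neg h2]

theorem doubled_map_inl (k : List X → R) (L : List X) : doubled k (L.map Sum.inl) = k L := by
  simp [doubled, List.filterMap_map, Function.comp_def]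

/-- Planar sums of a cyclic function are cyclic. -/
theorem planarSum_rotate (hk : k [] = 1) (hr : ∀ L M, k (L ++ M) = k (M ++ L)) (L M : List X) :
    planarSum k (singles (L ++ M)) = planarSum k (singles (M ++ L)) := by
  have key : ∀ N : List X, planarSum k (singles N) =
      planarSum (doubled k) (singles (N.map Sum.inl)) := fun N => by
    have e : singles (N.map (Sum.inl : X → X ⊕ X)) = (singles N).map (List.map Sum.inl) := by
      simp [singles]
    rw [e, planarSum_map]
    simp only [doubled_map_inl]
  rw [key, key, List.map_append, List.map_append]
  exact planarSum_rotate_of_isDihedral (isDihedral_doubled hk hr) Sum.swap_swap _ _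

/-- If `k` and `k'` agree on short words, their planar sums differ by their top values. -/
theorem planarSum_sub_planarSum {N : ℕ} (h : ∀ L, L.length < N → k L = k' L) (h0 : k [] = k' [])
    (W : List (List X)) (hW : ∀ L ∈ W, L ≠ []) (hN : W.flatten.length ≤ N) :
    planarSum k W - planarSum k' W = k W.flatten - k' W.flatten := by
  induction hn : W.length using Nat.strong_induction_on generalizing W with
  | _ n ih =>
  subst hn
  have eq_of_lt : ∀ V : List (List X), V.length < W.length → (∀ L ∈ V, L ≠ []) →
      V.flatten.length < N → planarSum k V = planarSum k' V := fun V hV hV' hVN => by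
    have := ih _ hV V hV' hVN.le rfl
    rwa [h _ hVN, sub_self, sub_eq_zero] at this
  cases W with
  | nil => simp [h0]
  | cons L W =>
    have hL := hW L (by simp)
    have hLp := List.length_pos_iff.mpr hL
    have hW' : ∀ M ∈ W, M ≠ [] := fun M hM => hW M (by simp [hM])
    rw [List.flatten_cons, List.length_append] at hN
    cases W with
    | nil =>
      rw [planarSum_cons, planarSum_cons]
      simp
    | cons M W =>
      have hM := hW' M (by simp)
      have hMp := List.length_pos_iff.mpr hM
      have e0 := ih ((L ++ M) :: W).length (by simp) ((L ++ M) :: W) (by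
        intro K hK
        rcases List.mem_cons.mp hK with rfl | hK
        · simp [hL]
        · exact hW' K (by simp [hK])) (by
          rw [List.flatten_cons, List.length_append] at hN
          rw [List.flatten_cons, List.length_append, List.length_append]
          omega) rfl
      rw [List.flatten_cons, List.length_append] at hN
      rw [planarSum_cons, planarSum_cons k' L, h L (by omega), eq_of_lt (M :: W) (by simp) hW' (by
        rw [List.flatten_cons, List.length_append]; omega)]
      -- If the gap is non-empty, both factors involve words of total length less than N, where the
      -- two functions agree. Only the term with empty gap can differ, and it is handled by the
      -- induction hypothesis.
      have hs : ∀ i : Fin W.length,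
          planarSum k ((M :: W).take (i + 1)) * planarSum k ((L ++ W[i]) :: W.drop (i + 1)) =
          planarSum k' ((M :: W).take (i + 1)) *
            planarSum k' ((L ++ W[i]) :: W.drop (i + 1)) := by
        intro i
        have hi := i.2
        have hsum : ((M :: W).take (i + 1)).flatten.length +
            ((L ++ W[i]) :: W.drop (i + 1)).flatten.length =
              L.length + (M.length + W.flatten.length) := by
          have : W = W.take i ++ W[i] :: W.drop (i + 1) := by simp
          conv_rhs => rw [this]
          simp only [List.take_succ_cons, List.flatten_cons, List.flatten_append, List.length_append]
          omega
        have h1 : 0 < ((M :: W).take (i + 1)).flatten.length := by simp; omega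
        have h2 : 0 < ((L ++ W[i]) :: W.drop (i + 1)).flatten.length := by simp; omega
        congr 1
        · exact eq_of_lt _ (by simp) (fun K hK => hW' K (List.mem_of_mem_take hK)) (by omega)
        · refine eq_of_lt _ (by simp) (fun K hK => ?_) (by omega)
          rcases List.mem_cons.mp hK with rfl | hK
          · simp [hL]
          · exact hW' K (List.mem_cons_of_mem _ (List.mem_of_mem_drop hK))
      have hsum : ∀ κ : List X → R, (∑ i : Fin (M :: W).length, planarSum κ ((M :: W).take i) *
          planarSum κ ((L ++ (M :: W)[i]) :: (M :: W).drop (i + 1))) =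
          planarSum κ ((L ++ M) :: W) + ∑ i : Fin W.length, planarSum κ ((M :: W).take (i + 1)) *
            planarSum κ ((L ++ W[i]) :: W.drop (i + 1)) := fun κ => by
        refine (Fin.sum_univ_succ (n := W.length) (fun i => planarSum κ ((M :: W).take i) *
          planarSum κ ((L ++ (M :: W)[i]) :: (M :: W).drop (i + 1)))).trans ?_
        congr 1
        exact (congrArg (· * _) (planarSum_nil κ)).trans (one_mul _)
      rw [hsum, hsum, Finset.sum_congr rfl fun i _ => hs i]
      simp only [List.flatten_cons, List.append_assoc] at e0 ⊢
      linear_combination e0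

end invariance

/-! ### Moment-cumulant formulas for lists -/

section cumulants

open TrivSqZeroExt

variable {A : Type*}

theorem sum_NC_eq_add {n : ℕ} (hn : n ≠ 0) {M : Type*} [AddCommMonoid M]
    (F : Finset (Finset (Fin n)) → M) :
    ∑ π ∈ NC n, F π.parts = F {univ} + ∑ π ∈ properNC n, F π.parts := by
  classical
  have hne : (univ : Finset (Fin n)) ≠ ∅ := by
    have : NeZero n := ⟨hn⟩
    exact Finset.univ_nonempty.ne_empty
  have hmem : Finpartition.indiscrete hne ∉ properNC n := fun h =>
    (Finset.mem_filter.mp h).2 (Finset.mem_singleton_self _)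
  have hNC : NC n = insert (Finpartition.indiscrete hne) (properNC n) := by
    ext π
    rw [Finset.mem_insert, properNC, Finset.mem_filter]
    constructor
    · intro h
      by_cases hu : univ ∈ π.parts
      · left
        ext V : 2
        rw [Finpartition.indiscrete_parts, Finset.mem_singleton]
        refine ⟨fun hV => ?_, fun hV => hV ▸ hu⟩
        obtain ⟨i, hi⟩ := π.nonempty_of_mem_parts hV
        exact π.eq_of_mem_parts hV hu hi (Finset.mem_univ i)
      · exact Or.inr ⟨h, hu⟩
    · rintro (rfl | h)
      · refine Finset.mem_filter.mpr ⟨Finset.mem_univ _, fun i j k l _ _ _ V hV W hW _ _ _ _ => ?_⟩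
        rw [Finpartition.indiscrete_parts, Finset.mem_singleton] at hV hW
        rw [hV, hW]
      · exact h.1
  rw [hNC, Finset.sum_insert hmem, Finpartition.indiscrete_parts]

theorem ofFn_restr_univ {n : ℕ} (a : Fin n → A) : List.ofFn (restr a univ) = List.ofFn a := by
  rw [← map_sort_eq_ofFn_restr, Fin.sort_univ, List.ofFn_eq_map]

variable [Ring A] [Algebra ℂ A]

theorem listCumulant_restr (τ : A →ₗ[ℂ] ℂ) {n : ℕ} (a : Fin n → A)
    (π : Finpartition (univ : Finset (Fin n))) {V : Finset (Fin n)} (hV : V ∈ π.parts) :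
    listCumulant τ (List.ofFn (restr a V)) = freeCumulant τ V.card (restr a V) :=
  listCumulant_ofFn τ (Finset.card_pos.mpr (π.nonempty_of_mem_parts hV)).ne' _

/-- The moment-cumulant formula. -/
theorem planarSum_listCumulant {τ : A →ₗ[ℂ] ℂ} (hτ : τ 1 = 1) (L : List A) :
    planarSum (listCumulant τ) (singles L) = τ L.prod := by
  rcases eq_or_ne L [] with rfl | hL
  · simp [hτ]
  have hn : L.length ≠ 0 := by simpa using hL
  obtain ⟨n, a, rfl⟩ : ∃ (n : ℕ) (a : Fin n → A), L = List.ofFn a := ⟨_, L.get, L.ofFn_get.symm⟩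
  rw [List.length_ofFn] at hn
  have h := sum_NC_eq_planarSum (listCumulant τ) a
  rw [sum_NC_eq_add hn (fun Q => ∏ V ∈ Q, listCumulant τ (List.ofFn (restr a V))),
    Finset.prod_singleton, ofFn_restr_univ, listCumulant_ofFn τ hn, freeCumulant] at h
  rw [singles, ← h, sub_add_eq_add_sub, sub_eq_iff_eq_add, add_right_inj,
    ← Finset.sum_coe_sort (properNC n)]
  refine Finset.sum_congr rfl fun π _ => ?_
  rw [← Finset.prod_coe_sort π.1.parts]
  exact Finset.prod_congr rfl fun V _ => listCumulant_restr τ a π.1 V.2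

variable (P : RealInfProbSpace A)

/-- The real infinitesimal cumulant of a list. -/
noncomputable def listInf (L : List A) : ℂ := P.infCumulant L.length L.get

/-- The free cumulant and the infinitesimal cumulant of a list as a dual number. -/
noncomputable def dualCumulant (L : List A) : DualNumber ℂ := (listCumulant P.τ L, listInf P L)

@[simp] theorem fst_dualCumulant (L : List A) : (dualCumulant P L).fst = listCumulant P.τ L := rfl

@[simp] theorem snd_dualCumulant (L : List A) : (dualCumulant P L).snd = listInf P L := rfl

theorem listInf_ofFn {n : ℕ} (a : Fin n → A) : listInf P (List.ofFn a) = P.infCumulant n a := by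
  have key : ∀ {m : ℕ} (h : m = n) {b : Fin m → A}, (∀ i, b i = a (Fin.cast h i)) →
      P.infCumulant m b = P.infCumulant n a := by
    rintro _ rfl b hb
    exact congrArg _ (funext hb)
  exact key List.length_ofFn fun i => by simp; rfl

theorem SNCdelta_zero : SNCdelta 0 = ∅ := by
  classical
  exact Finset.filter_false_of_mem fun σ _ h => h.1.choose.elim0

theorem listInf_nil : listInf P [] = 0 := by
  have h : ∀ (π : {π // π ∈ properNC 0}), IsEmpty {V // V ∈ π.1.parts} := fun π =>
    ⟨fun V => (π.1.nonempty_of_mem_parts V.2).choose.elim0⟩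
  have h0 := listInf_ofFn P (Fin.elim0 : Fin 0 → A)
  rw [List.ofFn_zero] at h0
  rw [h0, RealInfProbSpace.infCumulant, SNCdelta_zero]
  simp [P.τ'_one]

theorem dualCumulant_nil : dualCumulant P [] = 1 := by
  ext
  · simp [listCumulant]
  · simp [listInf_nil]

theorem fst_prod_eq {ι : Type*} (s : Finset ι) (f : ι → DualNumber ℂ) :
    (∏ i ∈ s, f i).fst = ∏ i ∈ s, (f i).fst :=
  map_prod (fstHom ℂ ℂ ℂ) f s

open Classical in
-- The Leibniz rule: for the blocks of π and the values κ + εκ', the ε-part of the product is ∂κ_π.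
theorem snd_prod_eq {ι : Type*} (s : Finset ι) (f : ι → DualNumber ℂ) :
    (∏ i ∈ s, f i).snd = ∑ i ∈ s, (f i).snd * ∏ j ∈ s.erase i, (f j).fst := by
  induction s using Finset.induction_on with
  | empty => simp
  | insert x s hx ih =>
    rw [Finset.prod_insert hx, snd_mul, ih, Finset.sum_insert hx, Finset.erase_insert hx,
      fst_prod_eq, Finset.smul_sum,
      add_comm (Finset.sum s _)]
    congr 1
    refine Finset.sum_congr rfl fun i hi => ?_
    rw [Finset.erase_insert_of_ne (fun e : x = i => hx (e ▸ hi)), Finset.prod_insert (by simp [hx])]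
    simp only [smul_eq_mul]
    ring

theorem fst_planarSum {X : Type*} (K : List X → DualNumber ℂ) (W : List (List X)) :
    (planarSum K W).fst = planarSum (fun L => (K L).fst) W := by
  induction hn : W.length using Nat.strong_induction_on generalizing W with
  | _ n ih =>
  subst hn
  cases W with
  | nil => simp
  | cons L W =>
    rw [planarSum_cons, planarSum_cons, fst_add, fst_mul, fst_sum, ih W.length (by simp) W rfl]
    congr 1
    refine Finset.sum_congr rfl fun i _ => ?_
    rw [fst_mul, ih _ (by simp) _ rfl,
      ih _ (by simpa using i.pos) _ rfl]

/-- The moment-cumulant formula for `τ'`. -/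
theorem moment_infCumulant (hk : IsDihedral (listCumulant P.τ) P.t) (L : List A) :
    P.τ' L.prod = (planarSum (dualCumulant P) (singles L)).snd +
      crosscapSum (listCumulant P.τ) P.t (singles L) := by
  rcases eq_or_ne L [] with rfl | hL
  · simp [P.τ'_one]
  have hn : L.length ≠ 0 := by simpa using hL
  obtain ⟨n, a, rfl⟩ : ∃ (n : ℕ) (a : Fin n → A), L = List.ofFn a := ⟨_, L.get, L.ofFn_get.symm⟩
  rw [List.length_ofFn] at hn
  have h := sum_NC_eq_planarSum (dualCumulant P) a
  rw [sum_NC_eq_add hn (fun Q => ∏ V ∈ Q, dualCumulant P (List.ofFn (restr a V))),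
    Finset.prod_singleton, ofFn_restr_univ] at h
  have h2 := congrArg snd h
  rw [snd_add, snd_dualCumulant, listInf_ofFn, snd_sum, RealInfProbSpace.infCumulant,
    sum_kappaHalf P hk] at h2
  rw [singles, ← h2, eq_comm, sub_add_eq_add_sub, sub_add_cancel, sub_add_eq_add_sub,
    sub_eq_iff_eq_add, add_right_inj, ← Finset.sum_coe_sort (properNC n)]
  refine Finset.sum_congr rfl fun π _ => ?_
  rw [snd_prod_eq, ← Finset.sum_coe_sort π.1.parts]
  refine Finset.sum_congr rfl fun V _ => ?_
  rw [snd_dualCumulant, listInf_ofFn]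
  congr 1
  refine Finset.prod_congr (by congr!) fun W hW => ?_
  exact listCumulant_restr P.τ a π.1 (Finset.mem_of_mem_erase hW)

variable {P}

theorem t_one : P.t 1 = 1 := by
  have := P.t_mul (P.t 1) 1
  rw [mul_one, P.t_t, mul_one] at this
  exact this.symm

theorem t_prod (L : List A) : P.t L.prod = (dag P.t L).prod := by
  induction L with
  | nil => exact t_one
  | cons x L ih => simp [P.t_mul, ih]

/-- At length N the cumulant is the moment minus the planar sum of the cumulants truncated below N.
The moment is invariant since τ is a trace with τ(aᵗ) = τ(a); the truncated cumulants are dihedral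
by induction, hence so is their planar sum. -/
theorem isDihedral_listCumulant (hP : P.IsTracial) : IsDihedral (listCumulant P.τ) P.t := by
  have key : ∀ N, (∀ L M : List A, (L ++ M).length = N →
      listCumulant P.τ (L ++ M) = listCumulant P.τ (M ++ L)) ∧
      ∀ L : List A, L.length = N → listCumulant P.τ (dag P.t L) = listCumulant P.τ L := by
    intro N
    induction N using Nat.strong_induction_on with
    | _ N ih =>
    rcases Nat.eq_zero_or_pos N with rfl | hN
    · refine ⟨fun L M h => ?_, fun L h => ?_⟩
      · rw [List.length_append] at h
        rw [List.length_eq_zero_iff.mp (show L.length = 0 by omega),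
          List.length_eq_zero_iff.mp (show M.length = 0 by omega)]
      · rw [List.length_eq_zero_iff.mp h]; rfl
    let k : List A → ℂ := fun L => if L.length < N then listCumulant P.τ L else 0
    have hk : IsDihedral k P.t := by
      refine ⟨by simp [k, hN, listCumulant], fun L M => ?_, fun L => ?_⟩
      · simp only [k, List.length_append, add_comm M.length]
        split_ifs with h
        · exact (ih _ h).1 L M (by simp)
        · rfl
      · simp only [k, length_dag]
        split_ifs with h
        · exact (ih _ h).2 L rfl
        · rfl
    have hsub : ∀ L : List A, L.length = N →
        listCumulant P.τ L = P.τ L.prod - planarSum k (singles L) := fun L hL => by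
      have := planarSum_sub_planarSum (k := listCumulant P.τ) (k' := k) (N := N)
        (fun L h => (if_pos h).symm) (by simp [k, hN]) (singles L)
        (fun _ => ne_nil_of_mem_singles) (by simp [hL])
      rw [planarSum_listCumulant P.τ_one, flatten_singles,
        show k L = 0 from if_neg (by omega), sub_zero] at this
      exact this.symm
    refine ⟨fun L M h => ?_, fun L h => ?_⟩
    · rw [hsub _ h, hsub _ (by rw [← h, List.length_append, List.length_append, add_comm]),
        planarSum_rotate hk.nil hk.rotate, List.prod_append, List.prod_append, hP.1]
    · rw [hsub _ h, hsub _ (by rw [length_dag, h]), planarSum_dag hk P.t_t, ← t_prod, P.τ_t]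
  exact ⟨by simp [listCumulant], fun L M => (key _).1 L M rfl, fun L => (key _).2 L rfl⟩

/-- The same truncation argument in dual numbers, with the crosscap sum subtracted as well.
Conjugation is left out, for τ' is only a trace. -/
theorem listInf_rotate (hP : P.IsTracial) (L M : List A) :
    listInf P (L ++ M) = listInf P (M ++ L) := by
  have hkd := isDihedral_listCumulant hP
  induction hN : (L ++ M).length using Nat.strong_induction_on generalizing L M with
  | _ N ih =>
  rcases Nat.eq_zero_or_pos N with rfl | hN0
  · rw [List.length_append] at hN
    rw [List.length_eq_zero_iff.mp (show L.length = 0 by omega),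
      List.length_eq_zero_iff.mp (show M.length = 0 by omega)]
  let K : List A → DualNumber ℂ := fun L => if L.length < N then dualCumulant P L else 0
  have hK0 : K [] = 1 := by simp [K, hN0, dualCumulant_nil]
  have hK : ∀ L M, K (L ++ M) = K (M ++ L) := fun L M => by
    simp only [K, List.length_append, add_comm M.length]
    split_ifs with h
    · ext
      · exact hkd.rotate L M
      · exact ih _ h L M (by simp)
    · rfl
  have hsub : ∀ L : List A, L.length = N → listInf P L = P.τ' L.prod -
      crosscapSum (listCumulant P.τ) P.t (singles L) - (planarSum K (singles L)).snd :=
    fun L hL => by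
      have := planarSum_sub_planarSum (k := dualCumulant P) (k' := K) (N := N)
        (fun L h => (if_pos h).symm) (by simp [K, hN0]) (singles L)
        (fun _ => ne_nil_of_mem_singles) (by simp [hL])
      rw [flatten_singles, show K L = 0 from if_neg (by omega), sub_zero] at this
      rw [moment_infCumulant P hkd, add_sub_cancel_right, ← snd_sub, this, snd_dualCumulant]
  rw [hsub _ hN, hsub _ (by rw [← hN, List.length_append, List.length_append, add_comm]),
    planarSum_rotate hK0 hK, crosscapSum_rotate hkd P.t_t, List.prod_append, List.prod_append, hP.2]

end cumulants

/-! ### Moments by following the block of the first letter -/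

section openSums

open TrivSqZeroExt

variable {X : Type*} (k k' : List X → ℂ) (t : X → X)

/-- The planar sum of a word of letters. -/
def mom (W : List X) : ℂ := planarSum k (singles W)

@[simp] theorem mom_nil : mom k [] = 1 := planarSum_nil k

/-- The sum over non-crossing partitions in which the first block begins with `C`, has then a gap
which begins with `g`, and continues with letters of `W`. -/
def openSum : List X → List X → List X → ℂ
  | C, g, [] => k C * mom k g
  | C, g, w :: W => openSum C (g ++ [w]) W + mom k g * openSum (C ++ [w]) [] W

theorem getElem_singles (W : List X) (i : ℕ) (h : i < (singles W).length) :
    (singles W)[i] = [W[i]'(by simpa using h)] := by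
  simp [singles]

theorem take_singles (W : List X) (i : ℕ) : (singles W).take i = singles (W.take i) := by
  simp [singles, List.map_take]

theorem drop_singles (W : List X) (i : ℕ) : (singles W).drop i = singles (W.drop i) := by
  simp [singles, List.map_drop]

theorem planarSum_cons_singles {R : Type*} [CommRing R] (K : List X → R) (C W : List X) :
    planarSum K (C :: singles W) = K C * planarSum K (singles W) + ∑ i : Fin W.length,
      planarSum K (singles (W.take i)) *
        planarSum K ((C ++ [W[i]]) :: singles (W.drop (i + 1))) := by
  rw [planarSum_cons]
  congr 1
  refine Fintype.sum_equiv (finCongr (by simp)) _ _ fun i => ?_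
  simp [take_singles, drop_singles, getElem_singles]

theorem crosscapSum_cons_singles (C W : List X) :
    crosscapSum k t (C :: singles W) = k C * crosscapSum k t (singles W) + ∑ i : Fin W.length,
      (mom k (W.take i) * crosscapSum k t ((C ++ [W[i]]) :: singles (W.drop (i + 1))) +
        crosscapSum k t (singles (W.take i)) *
          planarSum k ((C ++ [W[i]]) :: singles (W.drop (i + 1))) +
        planarSum k ((C ++ [t W[i]]) :: singles (dag t (W.take i) ++ W.drop (i + 1)))) := by
  rw [crosscapSum_cons]
  congr 1
  refine Fintype.sum_equiv (finCongr (by simp)) _ _ fun i => ?_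
  simp [take_singles, drop_singles, getElem_singles, dag_singles, mom]

/-- Each letter either enlarges the gap or closes it and joins the block. Unrolling this choice up
to the first letter that joins gives the recursion of `planarSum`; the letterwise form makes
structural induction on the word possible. -/
theorem openSum_eq (C g W : List X) :
    openSum k C g W = k C * mom k (g ++ W) + ∑ i : Fin W.length,
      mom k (g ++ W.take i) * planarSum k ((C ++ [W[i]]) :: singles (W.drop (i + 1))) := by
  induction W generalizing C g with
  | nil => simp [openSum]
  | cons w W ih =>
    have h := ih (C ++ [w]) []
    simp only [List.nil_append, mom] at h
    rw [← planarSum_cons_singles] at h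
    rw [openSum, h, ih]
    refine Eq.trans ?_ (congrArg _ (Fin.sum_univ_succ (n := W.length) fun i =>
      mom k (g ++ (w :: W).take i) *
        planarSum k ((C ++ [(w :: W)[i]]) :: singles ((w :: W).drop (i + 1)))).symm)
    simp
    ring

theorem openSum_nil (C W : List X) : openSum k C [] W = planarSum k (C :: singles W) := by
  rw [openSum_eq, planarSum_cons_singles]
  rfl

theorem mom_cons (x : X) (W : List X) : mom k (x :: W) = openSum k [x] [] W :=
  (openSum_nil k [x] W).symm

/-- The dual number with components `k L` and `k' L`. -/
def dualPair (L : List X) : DualNumber ℂ := (k L, k' L)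

@[simp] theorem fst_dualPair (L : List X) : (dualPair k k' L).fst = k L := rfl

@[simp] theorem snd_dualPair (L : List X) : (dualPair k k' L).snd = k' L := rfl

theorem fst_planarSum_dualPair (W : List (List X)) :
    (planarSum (dualPair k k') W).fst = planarSum k W := fst_planarSum _ _

/-- The sum of the derivative of the planar sum and of the crosscap sum. -/
def infSum (W : List (List X)) : ℂ := (planarSum (dualPair k k') W).snd + crosscapSum k t W

/-- The infinitesimal moment of a word of letters. -/
def momInf (W : List X) : ℂ := infSum k k' t (singles W)

@[simp] theorem momInf_nil : momInf k k' t [] = 0 := by simp [momInf, infSum]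

/-- The infinitesimal analogue of `openSum`. -/
def openInf : List X → List X → List X → ℂ
  | C, g, [] => k' C * mom k g + k C * momInf k k' t g
  | C, g, w :: W => openInf C (g ++ [w]) W + mom k g * openInf (C ++ [w]) [] W +
      momInf k k' t g * openSum k (C ++ [w]) [] W + openSum k (C ++ [t w]) [] (dag t g ++ W)

theorem infSum_cons_singles (C W : List X) :
    infSum k k' t (C :: singles W) = k' C * mom k W + k C * momInf k k' t W +
      ∑ i : Fin W.length,
        (mom k (W.take i) * infSum k k' t ((C ++ [W[i]]) :: singles (W.drop (i + 1))) +
          momInf k k' t (W.take i) * planarSum k ((C ++ [W[i]]) :: singles (W.drop (i + 1))) +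
          planarSum k ((C ++ [t W[i]]) :: singles (dag t (W.take i) ++ W.drop (i + 1)))) := by
  rw [infSum, planarSum_cons_singles, crosscapSum_cons_singles, snd_add, snd_mul, snd_sum]
  have h : ∀ i : Fin W.length, snd (planarSum (dualPair k k') (singles (W.take i)) *
      planarSum (dualPair k k') ((C ++ [W[i]]) :: singles (W.drop (i + 1)))) =
      mom k (W.take i) *
        (planarSum (dualPair k k') ((C ++ [W[i]]) :: singles (W.drop (i + 1)))).snd +
      (planarSum (dualPair k k') (singles (W.take i))).snd *
        planarSum k ((C ++ [W[i]]) :: singles (W.drop (i + 1))) := fun i => by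
    rw [snd_mul, fst_planarSum_dualPair, fst_planarSum_dualPair]
    simp [mom]
  rw [Finset.sum_congr rfl fun i _ => h i, fst_planarSum_dualPair]
  simp only [momInf, infSum, fst_dualPair, snd_dualPair, smul_eq_mul, MulOpposite.smul_eq_mul_unop,
    MulOpposite.unop_op, mom, Finset.sum_add_distrib, mul_add, add_mul]
  ring

/-- A letter that joins now leaves the infinitesimal part outside, or puts it into the gap, or is
reached through the crosscap. In the last case nothing infinitesimal remains, and the gap reappears
conjugated in front of the rest. -/
theorem openInf_eq (C g W : List X) :
    openInf k k' t C g W = k' C * mom k (g ++ W) + k C * momInf k k' t (g ++ W) +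
      ∑ i : Fin W.length,
        (mom k (g ++ W.take i) * infSum k k' t ((C ++ [W[i]]) :: singles (W.drop (i + 1))) +
          momInf k k' t (g ++ W.take i) *
            planarSum k ((C ++ [W[i]]) :: singles (W.drop (i + 1))) +
          planarSum k ((C ++ [t W[i]]) ::
            singles (dag t (g ++ W.take i) ++ W.drop (i + 1)))) := by
  induction W generalizing C g with
  | nil => simp [openInf]
  | cons w W ih =>
    have h := ih (C ++ [w]) []
    simp only [List.nil_append] at h
    rw [← infSum_cons_singles] at h
    rw [openInf, h, ih, openSum_nil, openSum_nil]
    refine Eq.trans ?_ (congrArg _ (Fin.sum_univ_succ (n := W.length) fun i =>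
      mom k (g ++ (w :: W).take i) *
          infSum k k' t ((C ++ [(w :: W)[i]]) :: singles ((w :: W).drop (i + 1))) +
        momInf k k' t (g ++ (w :: W).take i) *
          planarSum k ((C ++ [(w :: W)[i]]) :: singles ((w :: W).drop (i + 1))) +
        planarSum k ((C ++ [t (w :: W)[i]]) ::
          singles (dag t (g ++ (w :: W).take i) ++ (w :: W).drop (i + 1)))).symm)
    simp
    ring

theorem openInf_nil (C W : List X) : openInf k k' t C [] W = infSum k k' t (C :: singles W) := by
  rw [openInf_eq, infSum_cons_singles]
  rfl

theorem momInf_cons (x : X) (W : List X) : momInf k k' t (x :: W) = openInf k k' t [x] [] W :=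
  (openInf_nil k k' t [x] W).symm

end openSums

/-! ### Moments of centred alternating words -/

section alternating

variable {X ι : Type*} {k k' : List X → ℂ} {t : X → X} {col : X → ι}

/-- `k` vanishes on words whose letters do not all have the same colour. -/
def IsColored (col : X → ι) (k : List X → ℂ) : Prop :=
  ∀ C : List X, ∀ x ∈ C, ∀ y ∈ C, col x ≠ col y → k C = 0

/-- Neighbouring letters have different colours. -/
def Alternating (col : X → ι) (W : List X) : Prop := W.IsChain fun x y => col x ≠ col y

/-- The values of `k` at the letters vanish. -/
def Centred (k : List X → ℂ) (W : List X) : Prop := ∀ x ∈ W, k [x] = 0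

theorem centred_append {V W : List X} : Centred k (V ++ W) ↔ Centred k V ∧ Centred k W := by
  simp [Centred, or_imp, forall_and]

theorem centred_cons {x : X} {W : List X} : Centred k (x :: W) ↔ k [x] = 0 ∧ Centred k W := by
  simp [Centred]

theorem Alternating.left {V W : List X} (h : Alternating col (V ++ W)) : Alternating col V :=
  List.IsChain.left_of_append h

theorem Alternating.right {V W : List X} (h : Alternating col (V ++ W)) : Alternating col W :=
  List.IsChain.right_of_append h

theorem Alternating.tail {x : X} {W : List X} (h : Alternating col (x :: W)) : Alternating col W :=
  Alternating.right (V := [x]) h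

theorem Alternating.ne {x y : X} {V W : List X} (h : Alternating col (V ++ x :: y :: W)) :
    col x ≠ col y :=
  (List.isChain_cons_cons.mp (Alternating.right h)).1

theorem alternating_reverse {W : List X} : Alternating col W.reverse ↔ Alternating col W := by
  unfold Alternating
  rw [List.isChain_reverse]
  constructor <;> exact fun h => h.imp fun _ _ h => h.symm

theorem alternating_map (hcol : ∀ x, col (t x) = col x) {W : List X} :
    Alternating col (W.map t) ↔ Alternating col W := by
  simp only [Alternating, List.isChain_map, hcol]

theorem openSum_eq_zero (hc : IsColored col k) {C : List X} {x y : X} (hx : x ∈ C) (hy : y ∈ C)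
    (hxy : col x ≠ col y) (g W : List X) : openSum k C g W = 0 := by
  induction W generalizing C g with
  | nil => rw [openSum, hc C x hx y hy hxy, zero_mul]
  | cons w W ih =>
    rw [openSum, ih hx hy, ih (by simp [hx]) (by simp [hy]), mul_zero, add_zero]

theorem openInf_eq_zero (hc : IsColored col k) (hc' : IsColored col k') {C : List X} {x y : X}
    (hx : x ∈ C) (hy : y ∈ C) (hxy : col x ≠ col y) (g W : List X) :
    openInf k k' t C g W = 0 := by
  induction W generalizing C g with
  | nil => rw [openInf, hc C x hx y hy hxy, hc' C x hx y hy hxy, zero_mul, zero_mul, add_zero]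
  | cons w W ih =>
    rw [openInf, ih hx hy, ih (by simp [hx]) (by simp [hy]),
      openSum_eq_zero hc (x := x) (y := y) (by simp [hx]) (by simp [hy]) hxy,
      openSum_eq_zero hc (x := x) (y := y) (by simp [hx]) (by simp [hy]) hxy]
    ring

/-- A non-empty gap is alternating and centred, hence has moment zero. So no letter may be skipped,
and only the block that takes all of them survives. The bound `N` lets this serve inside the
induction that proves `hM`. -/
theorem openSum_alternating_aux {N : ℕ}
    (hM : ∀ g : List X, g ≠ [] → g.length ≤ N → Alternating col g → Centred k g → mom k g = 0)
    (C g W : List X) (c : X) (hN : (g ++ W).length ≤ N) (ha : Alternating col (c :: (g ++ W)))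
    (hz : Centred k (g ++ W)) :
    openSum k (C ++ [c]) g W = if g = [] then k (C ++ c :: W) else 0 := by
  induction W generalizing C g c with
  | nil =>
    rw [List.append_nil] at hN ha hz
    rw [openSum]
    split_ifs with hg
    · simp [hg]
    · rw [hM g hg hN ha.tail hz, mul_zero]
  | cons w W ih =>
    rw [openSum, ih C (g ++ [w]) c (by simpa using hN) (by simpa using ha) (by simpa using hz),
      if_neg (by simp), zero_add]
    split_ifs with hg
    · subst hg
      rw [mom_nil, one_mul, ih (C ++ [c]) [] w (by simp at hN ⊢; omega) ha.tail
        (centred_cons.mp hz).2, if_pos rfl]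
      simp
    · rw [hM g hg (by simp at hN; omega) (ha.tail.left) (centred_append.mp hz).1, zero_mul]

/-- Only the partition with a single block is left, and its value is that of a mixed word or of one
centred letter. -/
theorem mom_alternating (hc : IsColored col k) {W : List X} (hW : W ≠ []) (ha : Alternating col W)
    (hz : Centred k W) : mom k W = 0 := by
  induction hn : W.length using Nat.strong_induction_on generalizing W with
  | _ n ih =>
  subst hn
  obtain ⟨x, V, rfl⟩ := List.exists_cons_of_ne_nil hW
  have h := openSum_alternating_aux (k := k) (N := V.length)
    (fun g hg hgl ha hz => ih g.length (by simp; omega) hg ha hz rfl) [] [] V x (by simp) ha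
    (centred_cons.mp hz).2
  rw [if_pos rfl] at h
  rw [mom_cons]
  refine h.trans ?_
  cases V with
  | nil => exact hz x (by simp)
  | cons v V => exact hc _ x (by simp) v (by simp) (Alternating.ne (V := []) ha)

theorem openSum_alternating (hc : IsColored col k) (C g W : List X) (c : X)
    (ha : Alternating col (c :: (g ++ W))) (hz : Centred k (g ++ W)) :
    openSum k (C ++ [c]) g W = if g = [] then k (C ++ c :: W) else 0 :=
  openSum_alternating_aux (N := (g ++ W).length) (fun _ hg _ h1 h2 => mom_alternating hc hg h1 h2)
    C g W c le_rfl ha hz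

/-- An alternating tail can only contribute its last letter to the open block. -/
theorem openSum_concat (hc : IsColored col k) (C g V : List X) (v : X)
    (ha : Alternating col (V ++ [v])) (hz : Centred k (V ++ [v])) :
    openSum k C g (V ++ [v]) = k C * mom k (g ++ (V ++ [v])) + mom k (g ++ V) * k (C ++ [v]) := by
  induction V generalizing C g with
  | nil => simp [openSum]
  | cons u V ih =>
    rw [List.cons_append, openSum, ih _ _ ha.tail (centred_cons.mp hz).2,
      openSum_alternating hc C [] (V ++ [v]) u ha (centred_cons.mp hz).2, if_pos rfl]
    have : k (C ++ u :: (V ++ [v])) = 0 := by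
      cases V with
      | nil => exact hc _ u (by simp) v (by simp) (Alternating.ne (V := []) ha)
      | cons w V => exact hc _ u (by simp) w (by simp) (Alternating.ne (V := []) ha)
    simp [this]

/-- Closing a gap before the end of an alternating centred stretch costs a vanishing moment, so the
whole stretch `A` falls into the gap. -/
theorem openSum_gap (hc : IsColored col k) (C g A Z : List X) (hg : g ≠ [])
    (ha : Alternating col (g ++ A)) (hz : Centred k (g ++ A)) :
    openSum k C g (A ++ Z) = openSum k C (g ++ A) Z := by
  induction A generalizing g with
  | nil => simp
  | cons a A ih =>
    rw [List.cons_append, openSum, mom_alternating hc hg ha.left (centred_append.mp hz).1, zero_mul,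
      add_zero, ih _ (by simp) (by simpa using ha) (by simpa using hz)]
    simp

/-- The first letter of `A` differs in colour from a letter of the block and cannot join it. Thus a
gap opens, and it swallows `A`. -/
theorem openSum_append (hc : IsColored col k) {C : List X} {c : X} (hC : c ∈ C) (A Z : List X)
    (ha : Alternating col (c :: A)) (hz : Centred k A) :
    openSum k C [] (A ++ Z) = openSum k C A Z := by
  cases A with
  | nil => rfl
  | cons a A =>
    rw [List.cons_append, openSum,
      openSum_eq_zero hc (C := C ++ [a]) (x := c) (y := a) (by simp [hC]) (by simp)
      (Alternating.ne (V := []) ha), mul_zero, add_zero]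
    exact openSum_gap hc C [a] A Z (by simp) ha.tail hz

/-- The product of the values of `k` at the pairs of corresponding letters of two words, and `0`
if the words have different lengths. -/
def pairing (k : List X → ℂ) : List X → List X → ℂ
  | [], [] => 1
  | a :: B, v :: V => k [a, v] * pairing k B V
  | [], _ :: _ => 0
  | _ :: _, [] => 0

theorem pairing_eq_zero {B V : List X} (h : B.length ≠ V.length) : pairing k B V = 0 := by
  induction B generalizing V with
  | nil =>
    cases V with
    | nil => simp at h
    | cons v V => rfl
  | cons a B ih =>
    cases V with
    | nil => rfl
    | cons v V => rw [pairing, ih (by simpa using h), mul_zero]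

theorem mom_rotate (hk : IsDihedral k t) (V W : List X) : mom k (V ++ W) = mom k (W ++ V) :=
  planarSum_rotate hk.nil hk.rotate V W

/-- Moments of a product of two alternating centred words. -/
theorem mom_reverse_append (hk : IsDihedral k t) (hc : IsColored col k) {B V : List X}
    (haB : Alternating col B) (hzB : Centred k B) (haV : Alternating col V) (hzV : Centred k V) :
    mom k (B.reverse ++ V) = pairing k B V := by
  induction B generalizing V with
  | nil =>
    cases V with
    | nil => simp [pairing]
    | cons v V => exact mom_alternating hc (by simp) haV hzV
  | cons a B ih =>
    cases V with
    | nil =>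
      rw [List.append_nil]
      refine mom_alternating hc (by simp) (alternating_reverse.mpr haB) fun x hx => hzB x ?_
      exact List.mem_reverse.mp hx
    | cons v V =>
      rw [pairing]
      by_cases hav : col a = col v
      · have hB : ∀ b B', B = b :: B' → col a ≠ col b := by
          rintro b B' rfl
          exact Alternating.ne (V := []) haB
        have hzr : Centred k B.reverse := fun x hx => hzB x (by simp at hx; simp [hx])
        have har : Alternating col B.reverse := alternating_reverse.mpr haB.tail
        have ha0 := (centred_cons.mp hzB).1
        -- If the block of `a` skips `v`, the gap swallows `V`; in the reversed tail only the last
        -- letter `b` could still join, and as a neighbour of `a` it has another colour.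
        have e1 : openSum k [a] [v] (V ++ B.reverse) = 0 := by
          rw [openSum_gap hc [a] [v] V B.reverse (by simp) haV hzV]
          cases B with
          | nil => simp [openSum, ha0]
          | cons b B =>
            rw [List.reverse_cons] at hzr har ⊢
            rw [openSum_concat hc _ _ _ _ har hzr, ha0, hc ([a] ++ [b]) a (by simp) b (by simp)
              (hB b B rfl)]
            ring
        -- Once `v` has joined, the next letter of `V` has the wrong colour, and so does the final
        -- `b`; the block is exactly the pair.
        have e2 : openSum k [a, v] [] (V ++ B.reverse) = k [a, v] * mom k (V ++ B.reverse) := by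
          rw [openSum_append hc (c := v) (by simp) V _ haV (centred_cons.mp hzV).2]
          cases B with
          | nil => simp [openSum]
          | cons b B =>
            rw [List.reverse_cons] at hzr har ⊢
            rw [openSum_concat hc _ _ _ _ har hzr, hc ([a, v] ++ [b]) a (by simp) b (by simp)
              (hB b B rfl)]
            ring
        rw [List.reverse_cons, List.append_assoc, mom_rotate hk, List.singleton_append,
          List.cons_append, mom_cons, List.cons_append, openSum, List.nil_append, e1, mom_nil,
          one_mul, zero_add, List.singleton_append, e2, mom_rotate hk,
          ih haB.tail (centred_cons.mp hzB).2 haV.tail (centred_cons.mp hzV).2]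
      -- With different colours at the junction the whole word alternates, so both sides are zero.
      · rw [hc [a, v] a (by simp) v (by simp) hav, zero_mul]
        refine mom_alternating hc (by simp) ?_ ?_
        · refine List.isChain_append.mpr ⟨alternating_reverse.mpr haB, haV, ?_⟩
          simpa using hav
        · refine centred_append.mpr ⟨fun x hx => hzB x (List.mem_reverse.mp hx), hzV⟩

theorem Centred.map (hk : IsDihedral k t) {W : List X} (h : Centred k W) :
    Centred k (W.map t) := by
  intro x hx
  obtain ⟨y, hy, rfl⟩ := List.mem_map.mp hx
  exact (hk.dag [y]).trans (h y hy)

theorem alternating_dag (hcol : ∀ x, col (t x) = col x) {W : List X} :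
    Alternating col (dag t W) ↔ Alternating col W :=
  alternating_reverse.trans (alternating_map hcol)

theorem mom_dag_append (hk : IsDihedral k t) (hc : IsColored col k)
    (hcol : ∀ x, col (t x) = col x) {U V : List X} (haU : Alternating col U) (hzU : Centred k U)
    (haV : Alternating col V) (hzV : Centred k V) :
    mom k (dag t U ++ V) = pairing k (U.map t) V :=
  mom_reverse_append hk hc ((alternating_map hcol).mpr haU) (hzU.map hk) haV hzV

/-- The contribution to an infinitesimal moment of the crosscap terms in which the block of the
first letter `x` continues with a conjugated letter of `W`, after a gap which begins with `g`. -/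
def crossSum (k : List X → ℂ) (t : X → X) (x : X) : List X → List X → ℂ
  | _, [] => 0
  | g, w :: W => crossSum k t x (g ++ [w]) W + openSum k [x, t w] [] (dag t g ++ W)

/-- Apart from crosscap terms, leaving `x` alone gives zero by centring. If a letter other than `z`
joins after an infinitesimal gap, all later letters must join too, which makes the block mixed; a
gap without infinitesimal part is empty, which forces mixed colours, or has moment zero. What
remains is the pair of `x` and `z`. -/
theorem openInf_alternating (hc : IsColored col k) (hc' : IsColored col k') {x z : X}
    (g W : List X) (ha : Alternating col (x :: (g ++ (W ++ [z]))))
    (hz : Centred k (x :: (g ++ (W ++ [z])))) :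
    openInf k k' t [x] g (W ++ [z]) =
      k [x, z] * momInf k k' t (g ++ W) + crossSum k t x g (W ++ [z]) := by
  have hx := (centred_cons.mp hz).1
  have e : ∀ g w V, Alternating col (x :: (g ++ w :: V)) → Centred k g →
      mom k g * openInf k k' t [x, w] [] V = 0 := by
    intro g w V h hg
    cases g with
    | nil => rw [openInf_eq_zero hc hc' (x := x) (y := w) (by simp) (by simp)
        (Alternating.ne (V := []) h), mul_zero]
    | cons u g => rw [mom_alternating hc (by simp) h.tail.left hg, zero_mul]
  induction W generalizing g with
  | nil =>
    rw [List.nil_append] at ha hz ⊢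
    rw [openInf, List.singleton_append, e g z [] ha (centred_append.mp (centred_cons.mp hz).2).1, openInf, hx,
      mom_alternating hc (by simp) ha.tail (centred_cons.mp hz).2, crossSum, crossSum, openSum]
    simp [mul_comm]
  | cons w W ih =>
    have hmix : k ([x] ++ w :: (W ++ [z])) = 0 := by
      have ha' := ha.tail.right
      cases W with
      | nil => exact hc _ w (by simp) z (by simp) (Alternating.ne (V := []) ha')
      | cons u W => exact hc _ w (by simp) u (by simp) (Alternating.ne (V := []) ha')
    have hs : openSum k ([x] ++ [w]) [] (W ++ [z]) = 0 := by
      rw [openSum_alternating hc [x] [] (W ++ [z]) w ha.tail.right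
        (centred_cons.mp (centred_append.mp (centred_cons.mp hz).2).2).2, if_pos rfl, hmix]
    have hz' : Centred k (x :: (g ++ [w] ++ (W ++ [z]))) := by simpa using hz
    have ha' : Alternating col (x :: (g ++ [w] ++ (W ++ [z]))) := by simpa using ha
    rw [List.cons_append, openInf, hs, List.singleton_append,
      e g w (W ++ [z]) ha (centred_append.mp (centred_cons.mp hz).2).1, crossSum,
      ih (g ++ [w]) ha' hz']
    simp only [List.append_assoc, List.singleton_append]
    ring

/-! ### Crosscap terms of alternating words -/

section cross

variable {x w v : X} {g V : List X}

theorem openSum_cross (hc : IsColored col k) (hcol : ∀ x, col (t x) = col x)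
    (hk : IsDihedral k t) (Z : List X) (ha : Alternating col (g ++ [w])) (hz : Centred k g) :
    openSum k [x, t w] [] (dag t g ++ Z) = openSum k [x, t w] (dag t g) Z := by
  refine openSum_append hc (c := t w) (by simp) _ _ ?_ fun y hy => hz.map hk y (by simpa [dag] using hy)
  have := (alternating_dag hcol).mpr ha
  simpa using this

theorem openSum_cross_nil (hk : IsDihedral k t) (hc : IsColored col k)
    (hcol : ∀ x, col (t x) = col x) (ha : Alternating col (g ++ [w])) (hz : Centred k g) :
    openSum k [x, t w] [] (dag t g ++ []) = k [x, t w] * pairing k (g.map t) [] := by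
  rw [openSum_cross hc hcol hk [] ha hz, openSum, ← mom_dag_append hk hc hcol ha.left hz
    List.isChain_nil (by simp [Centred]), List.append_nil]

/-- After the twist the conjugated gap cannot join the block, and of the rest only its last letter
can. If that letter stays out, the gap is paired with the whole rest; if it joins, the gap is paired
with the rest without it. These are the even and odd formulas of freeness. -/
theorem openSum_cross_concat (hk : IsDihedral k t) (hc : IsColored col k)
    (hcol : ∀ x, col (t x) = col x) (ha : Alternating col (g ++ w :: (V ++ [v])))
    (hz : Centred k (g ++ w :: (V ++ [v]))) :
    openSum k [x, t w] [] (dag t g ++ (V ++ [v])) =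
      k [x, t w] * pairing k (g.map t) (V ++ [v]) + pairing k (g.map t) V * k [x, t w, v] := by
  have hg := (centred_append.mp hz).1
  have hV := (centred_cons.mp (centred_append.mp hz).2).2
  have haV := ha.right.tail
  rw [openSum_cross hc hcol hk _ (Alternating.left (W := V ++ [v]) (by simpa using ha)) hg,
    openSum_concat hc _ _ _ _ haV hV, mom_dag_append hk hc hcol ha.left hg haV hV,
    mom_dag_append hk hc hcol ha.left hg haV.left (centred_append.mp hV).1]
  rfl

theorem openSum_cross_eq_zero (hk : IsDihedral k t) (hc : IsColored col k)
    (hcol : ∀ x, col (t x) = col x) (ha : Alternating col (g ++ w :: V))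
    (hz : Centred k (g ++ w :: V)) (h1 : V.length ≠ g.length) (h2 : V.length ≠ g.length + 1) :
    openSum k [x, t w] [] (dag t g ++ V) = 0 := by
  rcases List.eq_nil_or_concat' V with rfl | ⟨V, v, rfl⟩
  · rw [openSum_cross_nil hk hc hcol ha (centred_append.mp hz).1, pairing_eq_zero (by simpa using h1.symm),
      mul_zero]
  · rw [openSum_cross_concat hk hc hcol ha hz, pairing_eq_zero (by simpa using h1.symm),
      pairing_eq_zero (by simp at h2 ⊢; omega)]
    ring

/-- Past the middle of the word the gap is longer than what follows, so no pairing of equal lengths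
exists. -/
theorem crossSum_eq_zero (hk : IsDihedral k t) (hc : IsColored col k)
    (hcol : ∀ x, col (t x) = col x) (g W : List X) (ha : Alternating col (g ++ W))
    (hz : Centred k (g ++ W)) (hl : W.length ≤ g.length) : crossSum k t x g W = 0 := by
  induction W generalizing g with
  | nil => rfl
  | cons w W ih =>
    simp only [List.length_cons] at hl
    rw [crossSum, ih (g ++ [w]) (by simpa using ha) (by simpa using hz) (by simp; omega),
      openSum_cross_eq_zero hk hc hcol ha hz (by omega) (by omega), add_zero]

/-- At most one term of `crossSum` is different from zero. -/
theorem crossSum_eq (hk : IsDihedral k t) (hc : IsColored col k)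
    (hcol : ∀ x, col (t x) = col x) (g U V : List X) (ha : Alternating col (g ++ (U ++ w :: V)))
    (hz : Centred k (g ++ (U ++ w :: V)))
    (hl : V.length = (g ++ U).length ∨ V.length = (g ++ U).length + 1) :
    crossSum k t x g (U ++ w :: V) = openSum k [x, t w] [] (dag t (g ++ U) ++ V) := by
  induction U generalizing g with
  | nil =>
    rw [List.append_nil] at hl
    rw [List.nil_append, crossSum, crossSum_eq_zero hk hc hcol (g ++ [w]) V (by simpa using ha)
      (by simpa using hz) (by simp; omega), zero_add, List.append_nil]
  | cons u U ih =>
    simp only [List.length_append, List.length_cons] at hl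
    rw [List.cons_append, crossSum, ih (g ++ [u]) (by simpa using ha) (by simpa using hz)
      (by simp; omega),
      openSum_cross_eq_zero (V := U ++ w :: V) hk hc hcol ha hz (by simp; omega) (by simp; omega),
      add_zero, List.append_assoc, List.singleton_append]

end cross

/-! ### The infinitesimal moment formulas for even and odd length -/

section main

variable {x w v z : X} {U V W : List X}

theorem momInf_concat (hc : IsColored col k) (hc' : IsColored col k')
    (ha : Alternating col (x :: (W ++ [z]))) (hz : Centred k (x :: (W ++ [z]))) :
    momInf k k' t (x :: (W ++ [z])) =
      k [x, z] * momInf k k' t W + crossSum k t x [] (W ++ [z]) := by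
  rw [momInf_cons, openInf_alternating hc hc' [] W ha hz, List.nil_append]

/-- Infinitesimal moments of alternating centred words of even length. -/
theorem momInf_even (hk : IsDihedral k t) (hc : IsColored col k) (hc' : IsColored col k')
    (hcol : ∀ x, col (t x) = col x) (ha : Alternating col (x :: (U ++ w :: V)))
    (hz : Centred k (x :: (U ++ w :: V))) (hW : U ++ w :: V = W ++ [z])
    (hl : U.length = V.length) :
    momInf k k' t (x :: (U ++ w :: V)) =
      k [x, z] * momInf k k' t W + k [x, t w] * pairing k (U.map t) V := by
  have h := momInf_concat (k' := k') (t := t) hc hc' (hW ▸ ha) (hW ▸ hz)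
  rw [← hW, crossSum_eq hk hc hcol [] U V ha.tail (centred_cons.mp hz).2 (by simp [hl])] at h
  rw [h, List.nil_append]
  congr 1
  rcases List.eq_nil_or_concat' V with rfl | ⟨V, v, rfl⟩
  · rw [openSum_cross_nil hk hc hcol ha.tail (centred_append.mp (centred_cons.mp hz).2).1]
  · rw [openSum_cross_concat hk hc hcol ha.tail (centred_cons.mp hz).2,
      pairing_eq_zero (V := V) (by simp at hl ⊢; omega), zero_mul, add_zero]

/-- Infinitesimal moments of alternating centred words of odd length. -/
theorem momInf_odd (hk : IsDihedral k t) (hc : IsColored col k) (hc' : IsColored col k')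
    (hcol : ∀ x, col (t x) = col x) (ha : Alternating col (x :: (U ++ w :: (V ++ [z]))))
    (hz : Centred k (x :: (U ++ w :: (V ++ [z])))) (hl : U.length = V.length) :
    momInf k k' t (x :: (U ++ w :: (V ++ [z]))) =
      k [x, z] * momInf k k' t (U ++ w :: V) + k [x, t w, z] * pairing k (U.map t) V := by
  have e : U ++ w :: (V ++ [z]) = (U ++ w :: V) ++ [z] := by simp
  have h := momInf_concat (k' := k') (t := t) hc hc' (e ▸ ha) (e ▸ hz)
  rw [← e, crossSum_eq hk hc hcol [] U _ ha.tail (centred_cons.mp hz).2 (by simp [hl])] at h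
  rw [h, List.nil_append, openSum_cross_concat hk hc hcol ha.tail (centred_cons.mp hz).2,
    pairing_eq_zero (V := V ++ [z]) (by simp; omega)]
  ring

end main

end alternating

/-! ### Merging neighbouring letters of the same colour -/

section merge

variable {A X ι : Type*} [Ring A] [Algebra ℂ A] {P : RealInfProbSpace A}
variable {k k' : List X → ℂ} {t : X → X} {col : X → ι} {val : X → A}

/-- The letter `z` is the product of the letters `x` and `y`, all of the same colour. -/
structure IsMerge (col : X → ι) (val : X → A) (x y z : X) : Prop where
  left : col x = col z
  right : col y = col z
  val : val z = val x * val y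

/-- The moments of monochromatic words are those of the products of the values. -/
structure HasMoments (P : RealInfProbSpace A) (col : X → ι) (val : X → A) (t : X → X)
    (k k' : List X → ℂ) : Prop where
  mom : ∀ W : List X, (∀ x ∈ W, ∀ y ∈ W, col x = col y) → mom k W = P.τ (W.map val).prod
  momInf : ∀ W : List X, (∀ x ∈ W, ∀ y ∈ W, col x = col y) →
    momInf k k' t W = P.τ' (W.map val).prod

variable {x y z : X}

theorem IsMerge.map (hcol : ∀ x, col (t x) = col x) (hval : ∀ x, val (t x) = P.t (val x))
    (h : IsMerge col val x y z) : IsMerge col val (t y) (t x) (t z) := by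
  refine ⟨?_, ?_, ?_⟩
  · rw [hcol, hcol, h.right]
  · rw [hcol, hcol, h.left]
  · rw [hval, hval, hval, h.val, P.t_mul]

theorem openSum_merge_gap (C g g' W : List X)
    (hm : ∀ U V : List X, (U ++ V).length ≤ (g ++ g' ++ W).length →
      mom k (U ++ x :: y :: V) = mom k (U ++ z :: V)) :
    openSum k C (g ++ x :: y :: g') W = openSum k C (g ++ z :: g') W := by
  induction W generalizing C g' with
  | nil => rw [openSum, openSum, hm g g' (by simp)]
  | cons w W ih =>
    have h := fun C => ih C (g' ++ [w]) (fun U V h => hm U V (by simp at h ⊢; omega))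
    simp only [← List.cons_append, ← List.append_assoc] at h ⊢
    rw [openSum, openSum, h]
    simp only [List.append_assoc, List.cons_append]
    rw [hm g g' (by simp)]

/-- The block contains a letter of another colour, so neither `x`, `y` nor `z` can join it. All of
them fall into gaps, whose moments involve fewer letters and are compared by `hm`. -/
theorem openSum_merge_aux (hc : IsColored col k) (h : IsMerge col val x y z) {C : List X} {d : X}
    (hd : d ∈ C) (hdz : col d ≠ col z) (g U V : List X)
    (hm : ∀ U' V' : List X, (U' ++ V').length ≤ (g ++ U ++ V).length →
      mom k (U' ++ x :: y :: V') = mom k (U' ++ z :: V')) :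
    openSum k C g (U ++ x :: y :: V) = openSum k C g (U ++ z :: V) := by
  induction U generalizing C g with
  | nil =>
    have e : ∀ w, col w = col z → ∀ g W, openSum k (C ++ [w]) g W = 0 := fun w hw g W =>
      openSum_eq_zero hc (x := d) (y := w) (by simp [hd]) (by simp) (by rwa [hw]) g W
    rw [List.nil_append, List.nil_append, openSum, e x h.left, openSum, e y h.right, openSum,
      e z rfl, List.append_assoc]
    simp only [mul_zero, add_zero]
    exact openSum_merge_gap C g [] V fun U' V' h' => hm U' V' (by simpa using h')
  | cons u U ih =>
    rw [List.cons_append, List.cons_append, openSum, openSum,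
      ih hd (g ++ [u]) fun U' V' h' => hm U' V' (by simp at h' ⊢; omega),
      ih (C := C ++ [u]) (by simp [hd]) [] fun U' V' h' => hm U' V' (by simp at h' ⊢; omega)]

/-- The same rotation works for every middle part `m`, so the words before and after a merge can be
rotated alike. -/
theorem exists_rotation_of_not_mono {U V : List X}
    (hd : ¬ ∀ d ∈ U ++ V, col d = col z) : ∃ (d : X) (U' V' : List X), col d ≠ col z ∧
      (U' ++ V').length + 1 = (U ++ V).length ∧
      ∀ m : List X, (∃ R S, U ++ m ++ V = R ++ S ∧ d :: (U' ++ m ++ V') = S ++ R) := by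
  push Not at hd
  obtain ⟨d, hd, hdz⟩ := hd
  rcases List.mem_append.mp hd with hd | hd
  · obtain ⟨U₁, U₂, rfl⟩ := List.append_of_mem hd
    exact ⟨d, U₂, V ++ U₁, hdz, by simp; omega, fun m => ⟨U₁, d :: U₂ ++ m ++ V, by simp, by simp⟩⟩
  · obtain ⟨V₁, V₂, rfl⟩ := List.append_of_mem hd
    exact ⟨d, V₂ ++ U, V₁, hdz, by simp; omega, fun m => ⟨U ++ m ++ V₁, d :: V₂, by simp, by simp⟩⟩

theorem mono_of_merge (h : IsMerge col val x y z) {U V : List X}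
    (hd : ∀ d ∈ U ++ V, col d = col z) :
    (∀ a ∈ U ++ x :: y :: V, ∀ b ∈ U ++ x :: y :: V, col a = col b) ∧
      ∀ a ∈ U ++ z :: V, ∀ b ∈ U ++ z :: V, col a = col b := by
  have h1 : ∀ a ∈ U ++ x :: y :: V, col a = col z := fun a ha => by
    simp only [List.mem_append, List.mem_cons] at ha hd
    rcases ha with ha | rfl | rfl | ha
    · exact hd a (Or.inl ha)
    · exact h.left
    · exact h.right
    · exact hd a (Or.inr ha)
  have h2 : ∀ a ∈ U ++ z :: V, col a = col z := fun a ha => by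
    simp only [List.mem_append, List.mem_cons] at ha hd
    rcases ha with ha | rfl | ha
    · exact hd a (Or.inl ha)
    · rfl
    · exact hd a (Or.inr ha)
  exact ⟨fun a ha b hb => (h1 a ha).trans (h1 b hb).symm,
    fun a ha b hb => (h2 a ha).trans (h2 b hb).symm⟩

/-- On monochromatic words the moments are those of the products, by assumption. Otherwise the word
is rotated to begin with a letter of another colour, whose block avoids the merged letters. -/
theorem mom_merge (hk : IsDihedral k t) (hc : IsColored col k)
    (hM : HasMoments P col val t k k') (h : IsMerge col val x y z) (U V : List X) :
    mom k (U ++ x :: y :: V) = mom k (U ++ z :: V) := by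
  induction hn : (U ++ V).length using Nat.strong_induction_on generalizing U V with
  | _ n ih =>
  by_cases hd : ∀ d ∈ U ++ V, col d = col z
  · obtain ⟨h1, h2⟩ := mono_of_merge h hd
    rw [hM.mom _ h1, hM.mom _ h2]
    simp [h.val, mul_assoc]
  · obtain ⟨d, U', V', hdz, hl, hrot⟩ := exists_rotation_of_not_mono hd
    have key : ∀ m : List X, mom k (U ++ m ++ V) = mom k (d :: (U' ++ m ++ V')) := fun m => by
      obtain ⟨R, S, e1, e2⟩ := hrot m
      rw [e1, e2, mom_rotate hk]
    have k1 := key [x, y]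
    have k2 := key [z]
    simp only [List.append_assoc, List.cons_append, List.nil_append] at k1 k2
    rw [k1, k2, mom_cons, mom_cons]
    refine openSum_merge_aux hc h (d := d) (by simp) hdz [] U' V' fun U'' V'' h' => ?_
    exact ih _ (by simp only [List.nil_append] at h'; omega) U'' V'' rfl

theorem openSum_merge (hk : IsDihedral k t) (hc : IsColored col k)
    (hM : HasMoments P col val t k k') (h : IsMerge col val x y z) {C : List X} {d : X}
    (hd : d ∈ C) (hdz : col d ≠ col z) (g U V : List X) :
    openSum k C g (U ++ x :: y :: V) = openSum k C g (U ++ z :: V) :=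
  openSum_merge_aux hc h hd hdz g U V fun U' V' _ => mom_merge hk hc hM h U' V'

/-- In the crosscap term the gap appears conjugated, where the letters t y and t x merge, in this
order, to t z. -/
theorem openInf_merge_gap
    (hk : IsDihedral k t) (hc : IsColored col k)
    (hcol : ∀ x, col (t x) = col x) (hval : ∀ x, val (t x) = P.t (val x))
    (hM : HasMoments P col val t k k') (h : IsMerge col val x y z)
    {C : List X} {d : X} (hd : d ∈ C) (hdz : col d ≠ col z) (g g' W : List X)
    (hm : ∀ U V : List X, (U ++ V).length ≤ (g ++ g' ++ W).length →
      momInf k k' t (U ++ x :: y :: V) = momInf k k' t (U ++ z :: V)) :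
    openInf k k' t C (g ++ x :: y :: g') W = openInf k k' t C (g ++ z :: g') W := by
  induction W generalizing C g' with
  | nil => rw [openInf, openInf, hm g g' (by simp), mom_merge hk hc hM h]
  | cons w W ih =>
    have h1 := ih hd (g' ++ [w]) (fun U V h => hm U V (by simp at h ⊢; omega))
    have h2 := openSum_merge hk hc hM (h.map hcol hval) (C := C ++ [t w]) (d := d) (by simp [hd])
      (by rwa [hcol]) [] (dag t g') (dag t g ++ W)
    rw [openInf, openInf, hm g g' (by simp), mom_merge hk hc hM h]
    simp only [dag_append, dag_cons, List.append_assoc, List.cons_append, List.nil_append] at h1 h2 ⊢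
    rw [h1, h2]

theorem openInf_merge_aux
    (hk : IsDihedral k t) (hc : IsColored col k) (hc' : IsColored col k')
    (hcol : ∀ x, col (t x) = col x) (hval : ∀ x, val (t x) = P.t (val x))
    (hM : HasMoments P col val t k k') (h : IsMerge col val x y z)
    {C : List X} {d : X} (hd : d ∈ C) (hdz : col d ≠ col z) (g U V : List X)
    (hm : ∀ U' V' : List X, (U' ++ V').length ≤ (g ++ U ++ V).length →
      momInf k k' t (U' ++ x :: y :: V') = momInf k k' t (U' ++ z :: V')) :
    openInf k k' t C g (U ++ x :: y :: V) = openInf k k' t C g (U ++ z :: V) := by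
  induction U generalizing C g with
  | nil =>
    have e : ∀ w, col w = col z → ∀ g W, openSum k (C ++ [w]) g W = 0 := fun w hw g W =>
      openSum_eq_zero hc (x := d) (y := w) (by simp [hd]) (by simp) (by rwa [hw]) g W
    have e' : ∀ w, col w = col z → ∀ g W, openInf k k' t (C ++ [w]) g W = 0 := fun w hw g W =>
      openInf_eq_zero hc hc' (x := d) (y := w) (by simp [hd]) (by simp) (by rwa [hw]) g W
    rw [List.nil_append, List.nil_append, openInf, e x h.left, e' x h.left,
      e (t x) ((hcol x).trans h.left), openInf, e y h.right, e' y h.right,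
      e (t y) ((hcol y).trans h.right), openInf, e z rfl, e' z rfl, e (t z) (hcol z),
      List.append_assoc]
    simp only [mul_zero, add_zero]
    exact openInf_merge_gap hk hc hcol hval hM h hd hdz g [] V fun U' V' h' =>
      hm U' V' (by simpa using h')
  | cons u U ih =>
    have h2 := openSum_merge hk hc hM h (C := C ++ [t u]) (d := d) (by simp [hd]) hdz []
      (dag t g ++ U) V
    simp only [List.append_assoc] at h2
    rw [List.cons_append, List.cons_append, openInf, openInf,
      ih hd (g ++ [u]) fun U' V' h' => hm U' V' (by simp at h' ⊢; omega),
      ih (C := C ++ [u]) (by simp [hd]) [] fun U' V' h' => hm U' V' (by simp at h' ⊢; omega),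
      openSum_merge hk hc hM h (C := C ++ [u]) (d := d) (by simp [hd]) hdz, h2]

/-- The argument of `mom_merge`; the rotation now requires both the dual planar sums and the
crosscap sums to be cyclic. -/
theorem momInf_merge
    (hk : IsDihedral k t) (hc : IsColored col k) (hc' : IsColored col k')
    (hcol : ∀ x, col (t x) = col x) (hval : ∀ x, val (t x) = P.t (val x))
    (hM : HasMoments P col val t k k') (h : IsMerge col val x y z)
    (ht : ∀ x, t (t x) = x) (hn : k' [] = 0)
    (hr : ∀ L M, k' (L ++ M) = k' (M ++ L)) (U V : List X) :
    momInf k k' t (U ++ x :: y :: V) = momInf k k' t (U ++ z :: V) := by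
  induction hn : (U ++ V).length using Nat.strong_induction_on generalizing U V with
  | _ n ih =>
  by_cases hd : ∀ d ∈ U ++ V, col d = col z
  · obtain ⟨h1, h2⟩ := mono_of_merge h hd
    rw [hM.momInf _ h1, hM.momInf _ h2]
    simp [h.val, mul_assoc]
  · obtain ⟨d, U', V', hdz, hl, hrot⟩ := exists_rotation_of_not_mono hd
    have hrotate : ∀ R S, momInf k k' t (R ++ S) = momInf k k' t (S ++ R) := fun R S => by
      unfold momInf infSum
      rw [crosscapSum_rotate hk ht, planarSum_rotate (k := dualPair k k')]
      · ext
        · exact hk.nil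
        · exact ‹k' [] = 0›
      · exact fun L M => TrivSqZeroExt.ext (hk.rotate L M) (hr L M)
    have key : ∀ m : List X, momInf k k' t (U ++ m ++ V) = momInf k k' t (d :: (U' ++ m ++ V')) :=
      fun m => by
        obtain ⟨R, S, e1, e2⟩ := hrot m
        rw [e1, e2, hrotate]
    have k1 := key [x, y]
    have k2 := key [z]
    simp only [List.append_assoc, List.cons_append, List.nil_append] at k1 k2
    rw [k1, k2, momInf_cons, momInf_cons]
    refine openInf_merge_aux hk hc hc' hcol hval hM h (d := d) (by simp) hdz [] U' V'
      fun U'' V'' h' => ?_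
    exact ih _ (by simp only [List.nil_append] at h'; omega) U'' V'' rfl

end merge

/-! ### Centring letters -/

section shift

variable {X : Type*} {k k' : List X → ℂ} {t : X → X} {x u : X} {c : ℂ} {N : ℕ}

/-- Shorter blocks that begin with `u` or `x` have equal values, so the difference can only come
from the block that takes all letters, which requires an empty gap at the start. -/
theorem openSum_shift (hS : ∀ M : List X, M ≠ [] → M.length < N → k (u :: M) = k (x :: M))
    (C g W : List X) (hC : C ≠ []) (hN : (C ++ g ++ W).length ≤ N) :
    openSum k (u :: C) g W - openSum k (x :: C) g W =
      if g = [] then k (u :: (C ++ W)) - k (x :: (C ++ W)) else 0 := by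
  induction W generalizing C g with
  | nil =>
    rw [openSum, openSum, List.append_nil]
    split_ifs with hg
    · simp [hg]
    · have := List.length_pos_iff.mpr hg
      rw [hS C hC (by simp at hN; omega), sub_self]
  | cons w W ih =>
    have h1 := ih C (g ++ [w]) hC (by simp at hN ⊢; omega)
    have h2 := ih (C ++ [w]) [] (by simp) (by simp at hN ⊢; omega)
    rw [if_neg (by simp)] at h1
    rw [if_pos rfl] at h2
    rw [openSum, openSum, List.cons_append, List.cons_append]
    split_ifs with hg
    · subst hg
      rw [mom_nil]
      simp only [List.append_assoc, List.singleton_append] at h2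
      linear_combination h1 + h2
    · have := List.length_pos_iff.mpr hg
      rw [hS (C ++ [w] ++ W) (by simp) (by simp at hN ⊢; omega), sub_self] at h2
      linear_combination h1 + mom k g * h2

/-- Besides the full block only the block of the first letter alone changes, by -c. In
`shift_of_mom` this part cancels the shift of the moment, so the values at the full word agree. -/
theorem openSum_shift_singleton
    (hS : ∀ M : List X, M ≠ [] → M.length < N → k (u :: M) = k (x :: M)) (hx : k [u] = k [x] - c)
    (g W : List X) (hN : (g ++ W).length ≤ N) :
    openSum k [u] g W - openSum k [x] g W = -c * mom k (g ++ W) +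
      if g = [] ∧ W ≠ [] then k (u :: W) - k (x :: W) else 0 := by
  induction W generalizing g with
  | nil =>
    rw [openSum, openSum, if_neg (by simp), hx, List.append_nil]
    ring
  | cons w W ih =>
    have h1 := ih (g ++ [w]) (by simpa using hN)
    have h2 := openSum_shift hS [w] [] W (by simp) (by simp at hN ⊢; omega)
    rw [if_neg (by simp), List.append_assoc, List.singleton_append] at h1
    rw [if_pos rfl, List.singleton_append] at h2
    rw [openSum, openSum, List.singleton_append, List.singleton_append]
    by_cases hg : g = []
    · rw [if_pos ⟨hg, by simp⟩]
      subst hg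
      rw [mom_nil]
      linear_combination h1 + h2
    · have := List.length_pos_iff.mpr hg
      rw [if_neg (by simp [hg])]
      rw [hS (w :: W) (by simp) (by simp at hN ⊢; omega), sub_self] at h2
      linear_combination h1 + mom k g * h2

/-- Values of `k` at words of at least two letters do not change if the first letter is shifted by
a scalar. -/
theorem shift_of_mom (h : ∀ W, mom k (u :: W) = mom k (x :: W) - c * mom k W) (M : List X)
    (hM : M ≠ []) : k (u :: M) = k (x :: M) := by
  have hx : k [u] = k [x] - c := by simpa [mom_cons, openSum] using h []
  induction hn : M.length using Nat.strong_induction_on generalizing M with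
  | _ n ih =>
  have h1 := openSum_shift_singleton (N := n) (fun M hM hl => ih _ hl M hM rfl) hx [] M
    (by simp [hn])
  rw [if_pos ⟨rfl, hM⟩, ← mom_cons, ← mom_cons, h, List.nil_append] at h1
  linear_combination -h1

theorem openSum_eq_of_shift (hS : ∀ M : List X, M ≠ [] → k (u :: M) = k (x :: M))
    (C g W : List X) (hC : C ≠ []) : openSum k (u :: C) g W = openSum k (x :: C) g W := by
  rw [← sub_eq_zero, openSum_shift (fun M hM _ => hS M hM) C g W hC le_rfl,
    hS (C ++ W) (by simp [hC]), sub_self, ite_self]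

/-- Terms in which the infinitesimal part is in a gap, and the crosscap terms, see the first block
only through `k` on words of at least two letters, and there the shift is already known to be
invisible. -/
theorem openInf_shift (hS : ∀ M : List X, M ≠ [] → k (u :: M) = k (x :: M))
    (hS' : ∀ M : List X, M ≠ [] → M.length < N → k' (u :: M) = k' (x :: M))
    (C g W : List X) (hC : C ≠ []) (hN : (C ++ g ++ W).length ≤ N) :
    openInf k k' t (u :: C) g W - openInf k k' t (x :: C) g W =
      if g = [] then k' (u :: (C ++ W)) - k' (x :: (C ++ W)) else 0 := by
  induction W generalizing C g with
  | nil =>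
    rw [openInf, openInf, List.append_nil, hS C hC]
    split_ifs with hg
    · simp [hg]
    · have := List.length_pos_iff.mpr hg
      rw [hS' C hC (by simp at hN; omega), sub_self]
  | cons w W ih =>
    have h1 := ih C (g ++ [w]) hC (by simp at hN ⊢; omega)
    have h2 := ih (C ++ [w]) [] (by simp) (by simp at hN ⊢; omega)
    rw [if_neg (by simp)] at h1
    rw [if_pos rfl] at h2
    rw [openInf, openInf, List.cons_append, List.cons_append, List.cons_append, List.cons_append,
      openSum_eq_of_shift hS (C ++ [w]) _ _ (by simp),
      openSum_eq_of_shift hS (C ++ [t w]) _ _ (by simp)]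
    split_ifs with hg
    · subst hg
      rw [mom_nil]
      simp only [List.append_assoc, List.singleton_append] at h2
      linear_combination h1 + h2
    · have := List.length_pos_iff.mpr hg
      rw [hS' (C ++ [w] ++ W) (by simp) (by simp at hN ⊢; omega), sub_self] at h2
      linear_combination h1 + mom k g * h2

theorem openInf_shift_singleton (hS : ∀ M : List X, M ≠ [] → k (u :: M) = k (x :: M))
    (hS' : ∀ M : List X, M ≠ [] → M.length < N → k' (u :: M) = k' (x :: M))
    (hx : k [u] = k [x] - c) (hx' : k' [u] = k' [x]) (g W : List X) (hN : (g ++ W).length ≤ N) :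
    openInf k k' t [u] g W - openInf k k' t [x] g W = -c * momInf k k' t (g ++ W) +
      if g = [] ∧ W ≠ [] then k' (u :: W) - k' (x :: W) else 0 := by
  induction W generalizing g with
  | nil =>
    rw [openInf, openInf, if_neg (by simp), hx, hx', List.append_nil]
    ring
  | cons w W ih =>
    have h1 := ih (g ++ [w]) (by simpa using hN)
    have h2 := openInf_shift (t := t) hS hS' [w] [] W (by simp) (by simp at hN ⊢; omega)
    rw [if_neg (by simp), List.append_assoc, List.singleton_append] at h1
    rw [if_pos rfl, List.singleton_append] at h2
    rw [openInf, openInf, List.singleton_append, List.singleton_append, List.singleton_append,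
      List.singleton_append, openSum_eq_of_shift hS [w] _ _ (by simp),
      openSum_eq_of_shift hS [t w] _ _ (by simp)]
    by_cases hg : g = []
    · rw [if_pos ⟨hg, by simp⟩]
      subst hg
      rw [mom_nil]
      linear_combination h1 + h2
    · have := List.length_pos_iff.mpr hg
      rw [if_neg (by simp [hg])]
      rw [hS' (w :: W) (by simp) (by simp at hN ⊢; omega), sub_self] at h2
      linear_combination h1 + mom k g * h2

/-- The infinitesimal analogue of `shift_of_mom`. -/
theorem shift_of_momInf (hS : ∀ M : List X, M ≠ [] → k (u :: M) = k (x :: M))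
    (hx : k [u] = k [x] - c) (hx' : k' [u] = k' [x])
    (h : ∀ W, momInf k k' t (u :: W) = momInf k k' t (x :: W) - c * momInf k k' t W) (M : List X)
    (hM : M ≠ []) : k' (u :: M) = k' (x :: M) := by
  induction hn : M.length using Nat.strong_induction_on generalizing M with
  | _ n ih =>
  have h1 := openInf_shift_singleton (t := t) (N := n) hS (fun M hM hl => ih _ hl M hM rfl) hx hx'
    [] M (by simp [hn])
  rw [if_pos ⟨rfl, hM⟩, ← momInf_cons, ← momInf_cons, h, List.nil_append] at h1
  linear_combination -h1

end shift

/-! ### Words of coloured letters -/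

section words

variable {X Y ι R : Type*} [CommRing R]

theorem dag_map {tX : X → X} {tY : Y → Y} {f : X → Y} (hf : ∀ x, f (tX x) = tY (f x))
    (L : List X) : (dag tX L).map f = dag tY (L.map f) := by
  induction L with
  | nil => rfl
  | cons x L ih => simp [ih, hf]

theorem crosscapSum_map {tX : X → X} {tY : Y → Y} {f : X → Y} (hf : ∀ x, f (tX x) = tY (f x))
    (k : List Y → R) (W : List (List X)) :
    crosscapSum k tY (W.map (List.map f)) = crosscapSum (fun L => k (L.map f)) tX W := by
  induction hn : W.length using Nat.strong_induction_on generalizing W with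
  | _ n ih =>
  subst hn
  cases W with
  | nil => simp
  | cons L W =>
    rw [List.map_cons, crosscapSum_cons, crosscapSum_cons, ih W.length (by simp) W rfl]
    congr 1
    refine Fintype.sum_equiv (finCongr (by simp)) _ _ fun i => ?_
    have hi : (i : ℕ) < W.length := by simpa using i.2
    simp only [Fin.getElem_fin, finCongr_apply, Fin.val_cast, List.getElem_map, ← List.map_take,
      ← List.map_drop]
    rw [ih _ (by simp) _ rfl, ← List.map_append, ← List.map_cons, ih _ (by simp; omega) _ rfl,
      planarSum_map, planarSum_map, ← dag_map hf, ← dag_map (dag_map hf), ← List.map_append,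
      ← List.map_append, ← List.map_cons, planarSum_map]

theorem exists_map_subtype_val {p : X → Prop} {W : List (List X)} (hW : ∀ L ∈ W, ∀ x ∈ L, p x) :
    ∃ V : List (List {x // p x}), V.map (List.map Subtype.val) = W := by
  refine ⟨W.pmap (fun L hL => L.attach.map fun x => ⟨x.1, hL x.1 x.2⟩) hW, ?_⟩
  rw [List.map_pmap]
  refine Eq.trans (List.pmap_congr_left (g := fun L _ => L) W (H₂ := hW) fun L _ _ _ => ?_) ?_
  · rw [List.map_map]
    exact List.attach_map_subtype_val L
  · simp

/-- The recursion only concatenates given letters, so it can be carried out over the subtype of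
letters with `p`, on which the two functions coincide. -/
theorem planarSum_congr {k k' : List X → R} {p : X → Prop}
    (h : ∀ L : List X, (∀ x ∈ L, p x) → k L = k' L) (W : List (List X))
    (hW : ∀ L ∈ W, ∀ x ∈ L, p x) : planarSum k W = planarSum k' W := by
  have key : ∀ V : List (List {x // p x}), planarSum k (V.map (List.map Subtype.val)) =
      planarSum k' (V.map (List.map Subtype.val)) := fun V => by
    rw [planarSum_map, planarSum_map]
    congr 1
    funext L
    exact h _ fun x hx => by
      obtain ⟨y, -, rfl⟩ := List.mem_map.mp hx
      exact y.2
  obtain ⟨V, rfl⟩ := exists_map_subtype_val hW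
  exact key V

theorem crosscapSum_congr {t : X → X} {k k' : List X → R} {p : X → Prop} (hp : ∀ x, p x → p (t x))
    (h : ∀ L : List X, (∀ x ∈ L, p x) → k L = k' L) (W : List (List X))
    (hW : ∀ L ∈ W, ∀ x ∈ L, p x) : crosscapSum k t W = crosscapSum k' t W := by
  let tp : {x // p x} → {x // p x} := fun x => ⟨t x.1, hp _ x.2⟩
  have key : ∀ V : List (List {x // p x}), crosscapSum k t (V.map (List.map Subtype.val)) =
      crosscapSum k' t (V.map (List.map Subtype.val)) := fun V => by
    rw [crosscapSum_map (tX := tp) (tY := t) (f := Subtype.val) (fun _ => rfl),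
      crosscapSum_map (tX := tp) (tY := t) (f := Subtype.val) (fun _ => rfl)]
    congr 1
    funext L
    exact h _ fun x hx => by
      obtain ⟨y, -, rfl⟩ := List.mem_map.mp hx
      exact y.2
  obtain ⟨V, rfl⟩ := exists_map_subtype_val hW
  exact key V

end words

/-! ### Low-order moments, differences in top order, and the middle letter -/

section lowOrder

variable {X : Type*} {k k' k'' : List X → ℂ} {t : X → X}

theorem mom_singleton (x : X) : mom k [x] = k [x] := by
  simp [mom_cons, openSum]

theorem mom_pair {x y : X} (hx : k [x] = 0) : mom k [x, y] = k [x, y] := by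
  simp [mom_cons k x, openSum, hx]

/-- For centred letters the cumulants of order two and three are moments; this turns the cumulants
in the computed formulas into the moments occurring in the definition of freeness. -/
theorem mom_triple {x y z : X} (hx : k [x] = 0) (hy : k [y] = 0) (hz : k [z] = 0) :
    mom k [x, y, z] = k [x, y, z] := by
  simp [mom_cons k x, openSum, hx, mom_singleton, hy, hz]

theorem pairing_mom {B V : List X} (hB : Centred k B) : pairing (mom k) B V = pairing k B V := by
  induction B generalizing V with
  | nil => cases V <;> rfl
  | cons a B ih =>
    cases V with
    | nil => rfl
    | cons v V =>
      obtain ⟨h1, h2⟩ := centred_cons.mp hB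
      rw [pairing, pairing, ih h2, mom_pair h1]

theorem mom_sub_mom {N : ℕ} (h : ∀ L, L.length < N → k L = k' L) (hN : N ≠ 0) (W : List X)
    (hW : W.length ≤ N) : mom k W - mom k' W = k W - k' W := by
  have := planarSum_sub_planarSum h (h [] (by simp; omega)) (singles W)
    (fun _ => ne_nil_of_mem_singles) (by simpa using hW)
  rwa [flatten_singles] at this

/-- Both sides use the same `k`, so the crosscap sums cancel and the comparison of planar sums in
dual numbers applies. -/
theorem momInf_sub_momInf {N : ℕ} (h : ∀ L, L.length < N → k' L = k'' L) (hN : N ≠ 0) (W : List X)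
    (hW : W.length ≤ N) : momInf k k' t W - momInf k k'' t W = k' W - k'' W := by
  have := planarSum_sub_planarSum (k := dualPair k k') (k' := dualPair k k'') (N := N)
    (fun L hL => by rw [dualPair, dualPair, h L hL])
    (by rw [dualPair, dualPair, h [] (by simp; omega)]) (singles W)
    (fun _ => ne_nil_of_mem_singles) (by simpa using hW)
  have h2 := congrArg TrivSqZeroExt.snd this
  rw [TrivSqZeroExt.snd_sub, TrivSqZeroExt.snd_sub, flatten_singles] at h2
  rw [momInf, momInf, infSum, infSum, add_sub_add_right_eq_sub, h2]
  rfl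

/-- The letter `w` is the one to which the crosscap term ties the first letter: position k + 1 for
length 2k, and position k for length 2k - 1. -/
theorem exists_split (L : List X) (hL : 2 ≤ L.length) :
    (∃ x U w V, L = x :: (U ++ w :: V) ∧ U.length = V.length) ∨
      ∃ x U w V z, L = x :: (U ++ w :: (V ++ [z])) ∧ U.length = V.length := by
  obtain _ | ⟨x, L⟩ := L
  · simp at hL
  simp only [List.length_cons] at hL
  obtain ⟨q, hq⟩ : ∃ q, L.length = 2 * q + 1 ∨ L.length = 2 * q + 2 := ⟨(L.length - 1) / 2, by omega⟩
  have hql : q < L.length := by omega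
  have e : L = L.take q ++ L[q] :: L.drop (q + 1) := by simp
  rcases hq with hq | hq
  · exact Or.inl ⟨x, L.take q, L[q], L.drop (q + 1), by rw [← e], by simp; omega⟩
  · rcases List.eq_nil_or_concat' (L.drop (q + 1)) with hV | ⟨V, z, hV⟩
    · have := congrArg List.length hV
      simp at this
      omega
    · refine Or.inr ⟨x, L.take q, L[q], V, z, by rw [← hV, ← e], ?_⟩
      have := congrArg List.length hV
      simp at this ⊢
      omega

end lowOrder

/-! ### Freeness and vanishing of mixed cumulants for words of coloured letters -/

section letters

variable {A : Type*} [Ring A] [Algebra ℂ A] (P : RealInfProbSpace A) {s : ℕ}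
  {S : Fin s → Subalgebra ℂ A}

/-- The elements of the subalgebras, with their indices. -/
abbrev Letter (S : Fin s → Subalgebra ℂ A) : Type _ := Σ j, S j

/-- The element of the algebra given by a letter. -/
def Letter.val (x : Letter S) : A := x.2

variable {P} in
/-- The transpose of a letter. -/
def Letter.transpose (hS : ∀ i, ∀ a ∈ S i, P.t a ∈ S i) (x : Letter S) : Letter S :=
  ⟨x.1, P.t x.2, hS _ _ x.2.2⟩

/-- The centring of a letter. -/
def Letter.centre (x : Letter S) : Letter S :=
  ⟨x.1, x.2 - algebraMap ℂ (S x.1) (P.τ x.val)⟩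

/-- The product of two letters of the same colour. -/
def Letter.mul (x y : Letter S) (h : x.1 = y.1) : Letter S :=
  ⟨x.1, x.2 * ⟨y.2.1, by rw [h]; exact y.2.2⟩⟩

/-- The value of `τ` at the product of a word. -/
def wordMoment (W : List (Letter S)) : ℂ := P.τ (W.map Letter.val).prod

/-- The value of `τ'` at the product of a word. -/
def wordInf (W : List (Letter S)) : ℂ := P.τ' (W.map Letter.val).prod

/-- The free cumulant of a word. -/
noncomputable def wordCumulant (W : List (Letter S)) : ℂ := listCumulant P.τ (W.map Letter.val)

/-- The real infinitesimal cumulant of a word. -/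
noncomputable def wordInfCumulant (W : List (Letter S)) : ℂ := listInf P (W.map Letter.val)

variable {P}

theorem singles_map {X Y : Type*} (f : X → Y) (W : List X) :
    singles (W.map f) = (singles W).map (List.map f) := by
  simp [singles]

theorem mom_wordCumulant (W : List (Letter S)) : mom (wordCumulant P) W = wordMoment P W := by
  rw [wordMoment, ← planarSum_listCumulant P.τ_one, singles_map, planarSum_map]
  rfl

theorem val_transpose (hS : ∀ i, ∀ a ∈ S i, P.t a ∈ S i) (x : Letter S) :
    (x.transpose hS).val = P.t x.val := rfl

theorem momInf_wordInfCumulant (hP : P.IsTracial) (hS : ∀ i, ∀ a ∈ S i, P.t a ∈ S i)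
    (W : List (Letter S)) :
    momInf (wordCumulant P) (wordInfCumulant P) (Letter.transpose hS) W = wordInf P W := by
  rw [wordInf, moment_infCumulant P (isDihedral_listCumulant hP), singles_map, planarSum_map,
    crosscapSum_map (val_transpose hS)]
  rfl

theorem isDihedral_wordCumulant (hP : P.IsTracial) (hS : ∀ i, ∀ a ∈ S i, P.t a ∈ S i) :
    IsDihedral (wordCumulant P) (Letter.transpose hS) := by
  have h := isDihedral_listCumulant hP
  refine ⟨h.nil, fun L M => ?_, fun L => ?_⟩
  · rw [wordCumulant, wordCumulant, List.map_append, List.map_append, h.rotate]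
  · rw [wordCumulant, wordCumulant, dag_map (val_transpose hS), h.dag]

theorem wordInfCumulant_rotate (hP : P.IsTracial) (L M : List (Letter S)) :
    wordInfCumulant P (L ++ M) = wordInfCumulant P (M ++ L) := by
  rw [wordInfCumulant, wordInfCumulant, List.map_append, List.map_append, listInf_rotate hP]

theorem wordInfCumulant_nil : wordInfCumulant P ([] : List (Letter S)) = 0 := listInf_nil P

theorem wordCumulant_singleton (x : Letter S) : wordCumulant P [x] = P.τ x.val := by
  rw [← mom_singleton (k := wordCumulant P), mom_wordCumulant]
  simp [wordMoment]

theorem wordInfCumulant_singleton (hP : P.IsTracial) (hS : ∀ i, ∀ a ∈ S i, P.t a ∈ S i)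
    (x : Letter S) : wordInfCumulant P [x] = P.τ' x.val := by
  have h := momInf_wordInfCumulant hP hS [x]
  simpa [momInf_cons, openInf, wordInf] using h

theorem val_centre (x : Letter S) : (x.centre P).val = x.val - algebraMap ℂ A (P.τ x.val) := rfl

theorem tau_algebraMap_mul (c : ℂ) (a : A) : P.τ (algebraMap ℂ A c * a) = c * P.τ a := by
  rw [← Algebra.smul_def, map_smul, smul_eq_mul]

theorem tau'_algebraMap_mul (c : ℂ) (a : A) : P.τ' (algebraMap ℂ A c * a) = c * P.τ' a := by
  rw [← Algebra.smul_def, map_smul, smul_eq_mul]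

theorem tau_centre (x : Letter S) : P.τ (x.centre P).val = 0 := by
  rw [val_centre, map_sub, ← mul_one (algebraMap ℂ A _), tau_algebraMap_mul, P.τ_one, mul_one,
    sub_self]

/-- The moment of a word is linear in its first letter, and a scalar there can be pulled out;
`shift_of_mom` transfers this to cumulants. -/
theorem wordCumulant_centre_cons (x : Letter S) (M : List (Letter S)) (hM : M ≠ []) :
    wordCumulant P (x.centre P :: M) = wordCumulant P (x :: M) := by
  refine shift_of_mom (c := P.τ x.val) (fun W => ?_) M hM
  simp only [mom_wordCumulant, wordMoment, List.map_cons, List.prod_cons, val_centre, sub_mul,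
    map_sub, tau_algebraMap_mul]

/-- Since τ'(1) = 0, centring by τ does not change κ'_1, which is the extra input of
`shift_of_momInf`. -/
theorem wordInfCumulant_centre_cons (hP : P.IsTracial) (hS : ∀ i, ∀ a ∈ S i, P.t a ∈ S i)
    (x : Letter S) (M : List (Letter S)) (hM : M ≠ []) :
    wordInfCumulant P (x.centre P :: M) = wordInfCumulant P (x :: M) := by
  refine shift_of_momInf (c := P.τ x.val) (k := wordCumulant P) (t := Letter.transpose hS)
    (wordCumulant_centre_cons x) ?_ ?_ (fun W => ?_) M hM
  · rw [wordCumulant_singleton, wordCumulant_singleton, tau_centre, sub_self]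
  · rw [wordInfCumulant_singleton hP hS, wordInfCumulant_singleton hP hS, val_centre, map_sub,
      ← mul_one (algebraMap ℂ A _), tau'_algebraMap_mul, P.τ'_one, mul_zero, sub_zero]
  · simp only [momInf_wordInfCumulant hP hS, wordInf, List.map_cons, List.prod_cons, val_centre,
      sub_mul, map_sub, tau'_algebraMap_mul]

/-- A cyclic function which does not change when the first letter is replaced does not change when
all letters are replaced. -/
theorem map_eq_of_cyclic {X : Type*} {k : List X → ℂ} {f : X → X}
    (hr : ∀ L M, k (L ++ M) = k (M ++ L)) (hf : ∀ x M, M ≠ [] → k (f x :: M) = k (x :: M))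
    (L : List X) (hL : 2 ≤ L.length) : k (L.map f) = k L := by
  have key : ∀ U V : List X, 2 ≤ (U ++ V).length → k (U.map f ++ V) = k (U ++ V) := by
    intro U
    induction U with
    | nil => exact fun _ _ => rfl
    | cons x U ih =>
      intro V h
      have hne : U.map f ++ V ≠ [] := by
        intro e
        have := congrArg List.length e
        simp only [List.length_append, List.length_map, List.length_nil, List.length_cons] at this h
        omega
      rw [List.map_cons, List.cons_append, hf x _ hne, ← List.singleton_append, hr,
        List.append_assoc, ih (V ++ [x]) (by simp at h ⊢; omega), ← List.append_assoc, hr]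
      rfl
  simpa using key L [] (by simpa using hL)

/-- Real infinitesimal freeness in terms of words. -/
structure FreeWords (P : RealInfProbSpace A) (hS : ∀ i, ∀ a ∈ S i, P.t a ∈ S i) : Prop where
  zero : ∀ L : List (Letter S), L ≠ [] → Alternating Sigma.fst L → Centred (wordMoment P) L →
    wordMoment P L = 0
  even : ∀ (x w z : Letter S) (U V W : List (Letter S)), U.length = V.length →
    U ++ w :: V = W ++ [z] → Alternating Sigma.fst (x :: (U ++ w :: V)) →
    Centred (wordMoment P) (x :: (U ++ w :: V)) →
    wordInf P (x :: (U ++ w :: V)) = wordMoment P [x, z] * wordInf P W +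
      wordMoment P [x, w.transpose hS] *
        pairing (wordMoment P) (U.map (Letter.transpose hS)) V
  odd : ∀ (x w z : Letter S) (U V : List (Letter S)), U.length = V.length →
    Alternating Sigma.fst (x :: (U ++ w :: (V ++ [z]))) →
    Centred (wordMoment P) (x :: (U ++ w :: (V ++ [z]))) →
    wordInf P (x :: (U ++ w :: (V ++ [z]))) = wordMoment P [x, z] * wordInf P (U ++ w :: V) +
      wordMoment P [x, w.transpose hS, z] *
        pairing (wordMoment P) (U.map (Letter.transpose hS)) V

theorem centred_wordCumulant {L : List (Letter S)} :
    Centred (wordCumulant P) L ↔ Centred (wordMoment P) L := by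
  simp only [Centred, ← mom_wordCumulant, mom_singleton]

theorem mom_wordCumulant_eq : mom (wordCumulant P) = wordMoment (S := S) P :=
  funext mom_wordCumulant

theorem alternating_map_centre {L : List (Letter S)} :
    Alternating Sigma.fst (L.map (Letter.centre P)) ↔ Alternating Sigma.fst L :=
  alternating_map (t := Letter.centre P) fun _ => rfl

theorem centred_map_centre (L : List (Letter S)) :
    Centred (wordMoment P) (L.map (Letter.centre P)) := by
  intro x hx
  obtain ⟨y, -, rfl⟩ := List.mem_map.mp hx
  simpa [wordMoment] using tau_centre y

/-- The infinitesimal moment formulas for the cumulants `wordCumulant` and any infinitesimal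
cumulants vanishing on mixed words, for even length. -/
theorem momInf_wordCumulant_even (hP : P.IsTracial) (hS : ∀ i, ∀ a ∈ S i, P.t a ∈ S i)
    (hc : IsColored Sigma.fst (wordCumulant (S := S) P)) {k' : List (Letter S) → ℂ}
    (hc' : IsColored Sigma.fst k') (x w z : Letter S) (U V W : List (Letter S))
    (hl : U.length = V.length) (hW : U ++ w :: V = W ++ [z])
    (ha : Alternating Sigma.fst (x :: (U ++ w :: V)))
    (hz : Centred (wordMoment P) (x :: (U ++ w :: V))) :
    momInf (wordCumulant P) k' (Letter.transpose hS) (x :: (U ++ w :: V)) =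
      wordMoment P [x, z] * momInf (wordCumulant P) k' (Letter.transpose hS) W +
        wordMoment P [x, w.transpose hS] *
          pairing (wordMoment P) (U.map (Letter.transpose hS)) V := by
  have hk := isDihedral_wordCumulant hP hS
  have hz' := centred_wordCumulant.mpr hz
  have hx := (centred_cons.mp hz').1
  rw [momInf_even hk hc hc' (fun _ => rfl) ha hz' hW hl, ← mom_pair hx, ← mom_pair hx,
    ← pairing_mom ((centred_append.mp (centred_cons.mp hz').2).1.map hk), mom_wordCumulant_eq]

theorem momInf_wordCumulant_odd (hP : P.IsTracial) (hS : ∀ i, ∀ a ∈ S i, P.t a ∈ S i)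
    (hc : IsColored Sigma.fst (wordCumulant (S := S) P)) {k' : List (Letter S) → ℂ}
    (hc' : IsColored Sigma.fst k') (x w z : Letter S) (U V : List (Letter S))
    (hl : U.length = V.length) (ha : Alternating Sigma.fst (x :: (U ++ w :: (V ++ [z]))))
    (hz : Centred (wordMoment P) (x :: (U ++ w :: (V ++ [z])))) :
    momInf (wordCumulant P) k' (Letter.transpose hS) (x :: (U ++ w :: (V ++ [z]))) =
      wordMoment P [x, z] * momInf (wordCumulant P) k' (Letter.transpose hS) (U ++ w :: V) +
        wordMoment P [x, w.transpose hS, z] *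
          pairing (wordMoment P) (U.map (Letter.transpose hS)) V := by
  have hk := isDihedral_wordCumulant hP hS
  have hz' := centred_wordCumulant.mpr hz
  have hx := (centred_cons.mp hz').1
  rw [momInf_odd hk hc hc' (fun _ => rfl) ha hz' hl, ← mom_pair hx,
    ← mom_triple hx ((hk.dag [w]).trans (hz' w (by simp))) (hz' z (by simp)),
    ← pairing_mom ((centred_append.mp (centred_cons.mp hz').2).1.map hk), mom_wordCumulant_eq]

theorem freeWords_of_isColored (hP : P.IsTracial) (hS : ∀ i, ∀ a ∈ S i, P.t a ∈ S i)
    (hc : IsColored Sigma.fst (wordCumulant (S := S) P))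
    (hc' : IsColored Sigma.fst (wordInfCumulant (S := S) P)) : FreeWords P hS where
  zero L hL ha hz := by
    rw [← mom_wordCumulant]
    exact mom_alternating hc hL ha (centred_wordCumulant.mpr hz)
  even x w z U V W hl hW ha hz := by
    simpa only [momInf_wordInfCumulant hP hS] using
      momInf_wordCumulant_even hP hS hc hc' x w z U V W hl hW ha hz
  odd x w z U V hl ha hz := by
    simpa only [momInf_wordInfCumulant hP hS] using
      momInf_wordCumulant_odd hP hS hc hc' x w z U V hl ha hz

end letters

/-! ### Vanishing of mixed cumulants from freeness -/

section monoPart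

variable {X ι : Type*} {k k' : List X → ℂ} {t : X → X} {col : X → ι}

open Classical in
/-- The function which agrees with `k` on monochromatic words and vanishes on the others. -/
noncomputable def monoPart (col : X → ι) (k : List X → ℂ) (L : List X) : ℂ :=
  if ∀ x ∈ L, ∀ y ∈ L, col x = col y then k L else 0

theorem monoPart_of_mono {L : List X} (h : ∀ x ∈ L, ∀ y ∈ L, col x = col y) :
    monoPart col k L = k L := if_pos h

theorem monoPart_of_not_mono {L : List X} (h : ¬ ∀ x ∈ L, ∀ y ∈ L, col x = col y) :
    monoPart col k L = 0 := if_neg h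

theorem isColored_monoPart : IsColored col (monoPart col k) :=
  fun _ x hx y hy hxy => monoPart_of_not_mono fun h => hxy (h x hx y hy)

theorem monoPart_rotate (hr : ∀ L M, k (L ++ M) = k (M ++ L)) (L M : List X) :
    monoPart col k (L ++ M) = monoPart col k (M ++ L) := by
  have : (∀ x ∈ L ++ M, ∀ y ∈ L ++ M, col x = col y) ↔ ∀ x ∈ M ++ L, ∀ y ∈ M ++ L, col x = col y := by
    simp only [List.mem_append, or_comm]
  classical exact if_congr this (hr L M) rfl

theorem isDihedral_monoPart (hk : IsDihedral k t) (hcol : ∀ x, col (t x) = col x) :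
    IsDihedral (monoPart col k) t where
  nil := by rw [monoPart_of_mono (by simp), hk.nil]
  rotate := monoPart_rotate hk.rotate
  dag L := by
    have : (∀ x ∈ dag t L, ∀ y ∈ dag t L, col x = col y) ↔ ∀ x ∈ L, ∀ y ∈ L, col x = col y := by
      simp [dag, hcol]
    classical exact if_congr this (hk.dag L) rfl

theorem monoPart_eq_self (hc : IsColored col k) : monoPart col k = k := by
  funext L
  by_cases h : ∀ x ∈ L, ∀ y ∈ L, col x = col y
  · exact monoPart_of_mono h
  · rw [monoPart_of_not_mono h]
    push Not at h
    obtain ⟨x, hx, y, hy, hxy⟩ := h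
    exact (hc L x hx y hy hxy).symm

theorem isColored_of_monoPart_eq (h : ∀ L, k L = monoPart col k L) : IsColored col k :=
  fun L x hx y hy hxy => (h L).trans (isColored_monoPart L x hx y hy hxy)

theorem momInf_monoPart (hcol : ∀ x, col (t x) = col x) {W : List X}
    (hW : ∀ x ∈ W, ∀ y ∈ W, col x = col y) :
    mom (monoPart col k) W = mom k W ∧
      momInf (monoPart col k) (monoPart col k') t W = momInf k k' t W := by
  obtain _ | ⟨w, V⟩ := W
  · simp
  have h : ∀ κ : List X → ℂ, ∀ L : List X, (∀ x ∈ L, col x = col w) →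
      monoPart col κ L = κ L := fun κ L hL =>
    monoPart_of_mono fun x hx y hy => (hL x hx).trans (hL y hy).symm
  have hs : ∀ L ∈ singles (w :: V), ∀ x ∈ L, col x = col w := by
    intro L hL x hx
    obtain ⟨y, hy, rfl⟩ := List.mem_map.mp hL
    rw [List.mem_singleton] at hx
    exact hx ▸ hW y hy w (by simp)
  refine ⟨planarSum_congr (h k) _ hs, ?_⟩
  rw [momInf, momInf, infSum, infSum, crosscapSum_congr (fun x hx => (hcol x).trans hx) (h k) _ hs,
    planarSum_congr (k' := dualPair k k') (fun L hL => ?_) _ hs]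
  rw [dualPair, dualPair, h k L hL, h k' L hL]

theorem exists_eq_of_not_alternating {L : List X} (h : ¬ Alternating col L) :
    ∃ U x y V, L = U ++ x :: y :: V ∧ col x = col y := by
  induction L with
  | nil => exact absurd List.isChain_nil h
  | cons x L ih =>
    obtain _ | ⟨y, L⟩ := L
    · exact absurd (List.isChain_singleton x) h
    · by_cases hxy : col x = col y
      · exact ⟨[], x, y, L, rfl, hxy⟩
      · obtain ⟨U, x', y', V, e, h'⟩ := ih fun hL => h (List.isChain_cons_cons.mpr ⟨hxy, hL⟩)
        exact ⟨x :: U, x', y', V, by rw [e]; rfl, h'⟩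

theorem two_le_length_of_not_mono {L : List X} (h : ¬ ∀ x ∈ L, ∀ y ∈ L, col x = col y) :
    2 ≤ L.length := by
  obtain _ | ⟨x, _ | ⟨y, L⟩⟩ := L
  · simp at h
  · simp at h
  · simp

end monoPart

section converse

variable {A : Type*} [Ring A] [Algebra ℂ A] {P : RealInfProbSpace A} {s : ℕ}
  {S : Fin s → Subalgebra ℂ A}

theorem hasMoments_monoPart (hP : P.IsTracial) (hS : ∀ i, ∀ a ∈ S i, P.t a ∈ S i) :
    HasMoments P Sigma.fst Letter.val (Letter.transpose hS)
      (monoPart Sigma.fst (wordCumulant (S := S) P))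
      (monoPart Sigma.fst (wordInfCumulant P)) where
  mom W hW := by
    rw [(momInf_monoPart (t := Letter.transpose hS) (k' := wordInfCumulant P)
      (fun _ => rfl) hW).1, mom_wordCumulant]
    rfl
  momInf W hW := by
    rw [(momInf_monoPart (t := Letter.transpose hS) (fun _ => rfl) hW).2, momInf_wordInfCumulant hP hS]
    rfl

theorem isMerge_mul {x y : Letter S} (h : x.1 = y.1) :
    IsMerge Sigma.fst Letter.val x y (x.mul y h) :=
  ⟨rfl, h.symm, rfl⟩

theorem wordMoment_merge {x y : Letter S} (h : x.1 = y.1) (U V : List (Letter S)) :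
    wordMoment P (U ++ x :: y :: V) = wordMoment P (U ++ x.mul y h :: V) := by
  simp [wordMoment, (isMerge_mul h).val, mul_assoc]

theorem wordInf_merge {x y : Letter S} (h : x.1 = y.1) (U V : List (Letter S)) :
    wordInf P (U ++ x :: y :: V) = wordInf P (U ++ x.mul y h :: V) := by
  simp [wordInf, (isMerge_mul h).val, mul_assoc]

/-- By induction the cumulants are monochromatic below length n. At length n, a cumulant minus its
monochromatic part is therefore the true moment minus the moment built from monochromatic cumulants,
and these two moments agree on mixed words. -/
theorem FreeWords.wordCumulant_eq (hP : P.IsTracial) (hS : ∀ i, ∀ a ∈ S i, P.t a ∈ S i)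
    (hF : FreeWords P hS) (L : List (Letter S)) :
    wordCumulant P L = monoPart Sigma.fst (wordCumulant P) L := by
  induction hn : L.length using Nat.strong_induction_on generalizing L with
  | _ n ih =>
  have hk := isDihedral_wordCumulant hP hS
  by_cases hmono : ∀ x ∈ L, ∀ y ∈ L, x.1 = y.1
  · exact (monoPart_of_mono hmono).symm
  have h2 := two_le_length_of_not_mono hmono
  rw [monoPart_of_not_mono hmono]
  have hdiff : ∀ W : List (Letter S), W.length ≤ n →
      wordMoment P W - mom (monoPart Sigma.fst (wordCumulant P)) W =
        wordCumulant P W - monoPart Sigma.fst (wordCumulant P) W := fun W hW => by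
    rw [← mom_wordCumulant]
    exact mom_sub_mom (fun L hL => ih _ hL L rfl) (by omega) W hW
  -- An alternating word may be centred, since cumulants of at least two letters do not notice; then
  -- the true moment vanishes by freeness and the other one by `mom_alternating`.
  by_cases ha : Alternating Sigma.fst L
  · have hmono' : ¬ ∀ x ∈ L.map (Letter.centre P), ∀ y ∈ L.map (Letter.centre P), x.1 = y.1 :=
      fun h => hmono fun x hx y hy => h (Letter.centre P x) (List.mem_map_of_mem hx)
        (Letter.centre P y) (List.mem_map_of_mem hy)
    have hne : L.map (Letter.centre P) ≠ [] := by
      intro e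
      rw [List.map_eq_nil_iff] at e
      simp [e] at h2
    have hz := centred_map_centre (P := P) L
    have ha' := (alternating_map_centre (P := P)).mpr ha
    have h := hdiff (L.map (Letter.centre P)) (by simp [hn])
    rw [hF.zero _ hne ha' hz, monoPart_of_not_mono hmono', mom_alternating isColored_monoPart hne ha',
      map_eq_of_cyclic hk.rotate wordCumulant_centre_cons L h2] at h
    · simpa using h.symm
    · intro x hx
      rw [monoPart_of_mono (by simp)]
      exact centred_wordCumulant.mpr hz x hx
  -- Two neighbours of equal colour are multiplied together. Both moments are unchanged, and for the
  -- shorter word they agree by induction.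
  · obtain ⟨U, x, y, V, rfl, hxy⟩ := exists_eq_of_not_alternating ha
    have hl : (U ++ Letter.mul x y hxy :: V).length < n := by
      rw [← hn]; simp
    have h := hdiff _ hn.le
    have h' := hdiff (U ++ Letter.mul x y hxy :: V) hl.le
    rw [← ih _ hl _ rfl, sub_self, sub_eq_zero] at h'
    rw [monoPart_of_not_mono hmono, wordMoment_merge hxy, h',
      mom_merge (isDihedral_monoPart hk fun _ => rfl) isColored_monoPart
        (hasMoments_monoPart hP hS) (isMerge_mul hxy), sub_self, sub_zero] at h
    exact h.symm

/-- The free cumulants are already known to be monochromatic, so the comparison keeps them and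
truncates only κ'. -/
theorem FreeWords.wordInfCumulant_eq (hP : P.IsTracial) (hS : ∀ i, ∀ a ∈ S i, P.t a ∈ S i)
    (hF : FreeWords P hS) (L : List (Letter S)) :
    wordInfCumulant P L = monoPart Sigma.fst (wordInfCumulant P) L := by
  have hc := isColored_of_monoPart_eq (hF.wordCumulant_eq hP hS)
  have hk := isDihedral_wordCumulant hP hS
  induction hn : L.length using Nat.strong_induction_on generalizing L with
  | _ n ih =>
  by_cases hmono : ∀ x ∈ L, ∀ y ∈ L, x.1 = y.1
  · exact (monoPart_of_mono hmono).symm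
  have h2 := two_le_length_of_not_mono hmono
  rw [monoPart_of_not_mono hmono]
  have hdiff : ∀ W : List (Letter S), W.length ≤ n →
      wordInf P W - momInf (wordCumulant P) (monoPart Sigma.fst (wordInfCumulant P))
        (Letter.transpose hS) W =
        wordInfCumulant P W - monoPart Sigma.fst (wordInfCumulant P) W := fun W hW => by
    rw [← momInf_wordInfCumulant hP hS]
    exact momInf_sub_momInf (fun L hL => ih _ hL L rfl) (by omega) W hW
  have hlow : ∀ W : List (Letter S), W.length < n →
      momInf (wordCumulant P) (monoPart Sigma.fst (wordInfCumulant P)) (Letter.transpose hS) W =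
        wordInf P W := fun W hW => by
    have := hdiff W hW.le
    rw [← ih _ hW W rfl, sub_self, sub_eq_zero] at this
    exact this.symm
  by_cases ha : Alternating Sigma.fst L
  · have hmono' : ¬ ∀ x ∈ L.map (Letter.centre P), ∀ y ∈ L.map (Letter.centre P), x.1 = y.1 :=
      fun h => hmono fun x hx y hy => h (Letter.centre P x) (List.mem_map_of_mem hx)
        (Letter.centre P y) (List.mem_map_of_mem hy)
    have h := hdiff (L.map (Letter.centre P)) (by simp [hn])
    rw [monoPart_of_not_mono hmono', sub_zero, map_eq_of_cyclic (wordInfCumulant_rotate hP)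
      (wordInfCumulant_centre_cons hP hS) L h2] at h
    rw [← h, sub_eq_zero]
    have hz := centred_map_centre (P := P) L
    have ha' := (alternating_map_centre (P := P)).mpr ha
    have hn' : (L.map (Letter.centre P)).length = n := by simp [hn]
    rcases exists_split (L.map (Letter.centre P)) (by simp [h2]) with
      ⟨x, U, w, V, e, hl⟩ | ⟨x, U, w, V, z, e, hl⟩
    · rw [e] at hz ha' hn' ⊢
      obtain ⟨W, z, hW⟩ : ∃ W z, U ++ w :: V = W ++ [z] :=
        (List.eq_nil_or_concat' (U ++ w :: V)).resolve_left (by simp)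
      have hWn : W.length < n := by
        have := congrArg List.length hW
        simp only [List.length_cons, List.length_append, List.length_nil] at this hn'
        omega
      -- Freeness and the cumulant computation give the same formula; the inner infinitesimal
      -- moments belong to the shorter word `W`, where they agree.
      rw [hF.even x w z U V W hl hW ha' hz,
        momInf_wordCumulant_even hP hS hc isColored_monoPart x w z U V W hl hW ha' hz, hlow W hWn]
    · rw [e] at hz ha' hn' ⊢
      rw [hF.odd x w z U V hl ha' hz,
        momInf_wordCumulant_odd hP hS hc isColored_monoPart x w z U V hl ha' hz, hlow]
      simp only [List.length_cons, List.length_append, List.length_nil] at hn' ⊢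
      omega
  · obtain ⟨U, x, y, V, rfl, hxy⟩ := exists_eq_of_not_alternating ha
    have hl : (U ++ Letter.mul x y hxy :: V).length < n := by
      rw [← hn]; simp
    have h := hdiff _ hn.le
    have hM := hasMoments_monoPart hP hS
    rw [monoPart_eq_self hc] at hM
    have ht : ∀ x : Letter S, (x.transpose hS).transpose hS = x := fun x => by
      obtain ⟨j, x, hx⟩ := x
      simp [Letter.transpose, P.t_t]
    rw [monoPart_of_not_mono hmono, wordInf_merge hxy, ← hlow _ hl,
      momInf_merge hk hc isColored_monoPart (fun _ => rfl) (val_transpose hS) hM (isMerge_mul hxy) ht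
        (by rw [monoPart_of_mono (by simp), wordInfCumulant_nil])
        (monoPart_rotate (wordInfCumulant_rotate hP)), sub_self, sub_zero] at h
    exact h.symm

theorem freeWords_iff (hP : P.IsTracial) (hS : ∀ i, ∀ a ∈ S i, P.t a ∈ S i) :
    FreeWords P hS ↔ IsColored Sigma.fst (wordCumulant (S := S) P) ∧
      IsColored Sigma.fst (wordInfCumulant (S := S) P) :=
  ⟨fun h => ⟨isColored_of_monoPart_eq (h.wordCumulant_eq hP hS),
    isColored_of_monoPart_eq (h.wordInfCumulant_eq hP hS)⟩,
    fun h => freeWords_of_isColored hP hS h.1 h.2⟩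

end converse

/-! ### Sequences and words -/

section sequences

variable {A : Type*} [Ring A] [Algebra ℂ A] {P : RealInfProbSpace A} {s : ℕ}
  {S : Fin s → Subalgebra ℂ A}

theorem wordCumulant_ofFn {n : ℕ} (hn : n ≠ 0) (x : Fin n → Letter S) :
    wordCumulant P (List.ofFn x) = freeCumulant P.τ n fun i => (x i).val := by
  rw [wordCumulant, List.map_ofFn, listCumulant_ofFn _ hn]
  rfl

theorem wordInfCumulant_ofFn {n : ℕ} (x : Fin n → Letter S) :
    wordInfCumulant P (List.ofFn x) = P.infCumulant n fun i => (x i).val := by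
  rw [wordInfCumulant, List.map_ofFn, listInf_ofFn]
  rfl

theorem mixedCumulantsVanish_iff : P.MixedCumulantsVanish S ↔
    IsColored Sigma.fst (wordCumulant (S := S) P) ∧
      IsColored Sigma.fst (wordInfCumulant (S := S) P) := by
  constructor
  · intro h
    have key : ∀ L : List (Letter S), ∀ x ∈ L, ∀ y ∈ L, x.1 ≠ y.1 →
        wordCumulant P L = 0 ∧ wordInfCumulant P L = 0 := by
      intro L x hx y hy hxy
      have h2 : 2 ≤ L.length := two_le_length_of_not_mono (col := Sigma.fst)
        fun h => hxy (h x hx y hy)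
      obtain ⟨p, rfl⟩ := List.mem_iff_get.mp hx
      obtain ⟨q, rfl⟩ := List.mem_iff_get.mp hy
      have := h L.length (fun i => (L.get i).val) (fun i => (L.get i).1) h2
        (fun i => (L.get i).2.2) ⟨p, q, hxy⟩
      rw [← wordCumulant_ofFn (by omega), ← wordInfCumulant_ofFn, List.ofFn_get] at this
      exact this
    exact ⟨fun L x hx y hy hxy => (key L x hx y hy hxy).1,
      fun L x hx y hy hxy => (key L x hx y hy hxy).2⟩
  · rintro ⟨h1, h2⟩ n a j hn ha ⟨p, q, hpq⟩
    let x : Fin n → Letter S := fun i => ⟨j i, a i, ha i⟩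
    have hmem : ∀ i, x i ∈ List.ofFn x := fun i => List.mem_ofFn.mpr ⟨i, rfl⟩
    have e1 := wordCumulant_ofFn (P := P) (by omega) x
    have e2 := wordInfCumulant_ofFn (P := P) x
    rw [h1 _ _ (hmem p) _ (hmem q) hpq] at e1
    rw [h2 _ _ (hmem p) _ (hmem q) hpq] at e2
    exact ⟨e1.symm, e2.symm⟩

/-- The letters of the word `L` are given by the terms of the sequences `a` and `j` with indices
`1, 2, …`. -/
structure Represents (a : ℕ → A) (j : ℕ → Fin s) (L : List (Letter S)) : Prop where
  val : ∀ i (h : i < L.length), a (i + 1) = (L[i]).val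
  col : ∀ i (h : i < L.length), j (i + 1) = (L[i]).1

theorem exists_represents_word {L : List (Letter S)} (hL : L ≠ []) :
    ∃ a j, Represents a j L := by
  obtain ⟨x, V, rfl⟩ := List.exists_cons_of_ne_nil hL
  exact ⟨fun i => ((x :: V).getD (i - 1) x).val, fun i => ((x :: V).getD (i - 1) x).1,
    fun i h => by simp only [Nat.add_sub_cancel, List.getD_eq_getElem _ _ h],
    fun i h => by simp only [Nat.add_sub_cancel, List.getD_eq_getElem _ _ h]⟩

theorem exists_represents_seq (n : ℕ) (a : ℕ → A) (j : ℕ → Fin s)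
    (h : ∀ i ∈ Icc 1 n, a i ∈ S (j i)) :
    ∃ L : List (Letter S), L.length = n ∧ Represents a j L :=
  ⟨List.ofFn fun i : Fin n => ⟨j (i + 1), a (i + 1), h _ (by simp)⟩, by simp,
    fun i h => by rw [List.getElem_ofFn]; rfl, fun i h => by simp⟩

namespace Represents

variable {a : ℕ → A} {j : ℕ → Fin s} {L : List (Letter S)}

theorem mem (h : Represents a j L) : ∀ i ∈ Icc 1 L.length, a i ∈ S (j i) := by
  intro i hi
  rw [Finset.mem_Icc] at hi
  obtain ⟨i, rfl⟩ := Nat.exists_eq_add_of_le' hi.1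
  rw [h.val i (by omega), h.col i (by omega)]
  exact (L[i]).2.2

theorem alternating_iff (h : Represents a j L) :
    (∀ i ∈ Ico 1 L.length, j i ≠ j (i + 1)) ↔ Alternating Sigma.fst L := by
  rw [Alternating, List.isChain_iff_getElem]
  constructor
  · intro hj i hi
    rw [← h.col i, ← h.col (i + 1)]
    exact hj (i + 1) (by simp; omega)
  · intro hL i hi
    rw [Finset.mem_Ico] at hi
    obtain ⟨i, rfl⟩ := Nat.exists_eq_add_of_le' hi.1
    rw [h.col i (by omega), h.col (i + 1) (by omega)]
    exact hL i _

theorem centred_iff (h : Represents a j L) :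
    (∀ i ∈ Icc 1 L.length, P.τ (a i) = 0) ↔ Centred (wordMoment P) L := by
  have hw : ∀ x : Letter S, wordMoment P [x] = P.τ x.val := fun x => by simp [wordMoment]
  constructor
  · intro ha x hx
    obtain ⟨i, hi, rfl⟩ := List.mem_iff_getElem.mp hx
    rw [hw, ← h.val i hi]
    exact ha (i + 1) (by simp; omega)
  · intro hL i hi
    rw [Finset.mem_Icc] at hi
    obtain ⟨i, rfl⟩ := Nat.exists_eq_add_of_le' hi.1
    rw [h.val i (by omega), ← hw]
    exact hL _ (List.getElem_mem _)

theorem apply (h : Represents a j L) {U V : List (Letter S)} {x : Letter S} (hL : L = U ++ x :: V) :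
    a (U.length + 1) = x.val := by
  subst hL
  rw [h.val U.length (by simp)]
  simp

theorem apply_getElem (h : Represents a j L) {U W V : List (Letter S)} (hL : L = U ++ W ++ V)
    (i : ℕ) (hi : i < W.length) : (W[i]).val = a (U.length + 1 + i) := by
  subst hL
  rw [show U.length + 1 + i = U.length + i + 1 by ring, h.val (U.length + i) (by simp; omega)]
  congr 1
  rw [List.getElem_append_left (by simp; omega), List.getElem_append_right (by omega)]
  simp

theorem segProd_eq (h : Represents a j L) {U W V : List (Letter S)} (hL : L = U ++ W ++ V)
    {p q : ℕ} (hp : p = U.length + 1) (hq : q = U.length + W.length) :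
    segProd a p q = (W.map Letter.val).prod := by
  subst hp hq
  rw [segProd, show U.length + W.length + 1 - (U.length + 1) = W.length by omega]
  congr 1
  refine List.ext_getElem (by simp) fun i h1 h2 => ?_
  simp only [List.length_map] at h2
  simp [h.apply_getElem hL i h2]

end Represents

/-- The free offsets `p` and `q` allow the induction, in which both words lose their first letter.
-/
theorem pairing_wordMoment (hP : P.IsTracial) (hS : ∀ i, ∀ a ∈ S i, P.t a ∈ S i) (a : ℕ → A)
    (U V : List (Letter S)) (p q : ℕ) (hl : U.length = V.length)
    (hU : ∀ i (h : i < U.length), (U[i]).val = a (p + i))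
    (hV : ∀ i (h : i < V.length), (V[i]).val = a (q + i)) :
    pairing (wordMoment P) (U.map (Letter.transpose hS)) V =
      ∏ i ∈ range U.length, P.τ (a (p + i) * P.t (a (q + i))) := by
  induction U generalizing V p q with
  | nil =>
    obtain rfl := List.length_eq_zero_iff.mp hl.symm
    rfl
  | cons u U ih =>
    obtain _ | ⟨v, V⟩ := V
    · simp at hl
    rw [List.map_cons, pairing, List.length_cons, Finset.prod_range_succ',
      ih V (p + 1) (q + 1) (by simpa using hl)
        (fun i h => by
          have := hU (i + 1) (by simpa using h)
          rw [List.getElem_cons_succ] at this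
          rw [this, add_assoc, add_comm 1 i])
        (fun i h => by
          have := hV (i + 1) (by simpa using h)
          rw [List.getElem_cons_succ] at this
          rw [this, add_assoc, add_comm 1 i]), mul_comm]
    congr 1
    · refine Finset.prod_congr rfl fun i _ => ?_
      rw [add_assoc, add_assoc, add_comm 1 i]
    · have h1 := hU 0 (by simp)
      have h2 := hV 0 (by simp)
      rw [List.getElem_cons_zero] at h1 h2
      -- The pairing transposes the left letter, the definition of freeness the right one; τ(uvᵗ) =
      -- τ(vuᵗ) = τ(uᵗv) by invariance under t and traciality.
      rw [← h1, ← h2, ← P.τ_t (u.val * P.t v.val), P.t_mul, P.t_t, hP.1]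
      simp [wordMoment, val_transpose]

variable {a : ℕ → A} {j : ℕ → Fin s}

/-- The factor with i = 1 is the pair of the first letter with the middle letter `w`; the other k -
1 factors form the pairing of `U` with `V`. -/
theorem Represents.even_eq (hP : P.IsTracial) (hS : ∀ i, ∀ a ∈ S i, P.t a ∈ S i)
    {x w z : Letter S} {U V W : List (Letter S)} (h : Represents a j (x :: (U ++ w :: V)))
    (hl : U.length = V.length) (hW : U ++ w :: V = W ++ [z]) {n k : ℕ} (hn : n = 2 * k)
    (hk : k = U.length + 1) :
    P.τ (a 1 * a n) * P.τ' (segProd a 2 (n - 1)) + ∏ i ∈ Icc 1 k, P.τ (a i * P.t (a (i + k))) =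
      wordMoment P [x, z] * wordInf P W + wordMoment P [x, w.transpose hS] *
        pairing (wordMoment P) (U.map (Letter.transpose hS)) V := by
  have hWl := congrArg List.length hW
  simp only [List.length_append, List.length_cons, List.length_nil] at hWl
  have e1 : a 1 = x.val := h.apply (U := []) rfl
  have e2 : a n = z.val := by
    rw [← h.apply (U := x :: W) (V := []) (by rw [hW]; simp)]
    congr 1
    simp only [List.length_cons]
    omega
  have e3 : a (1 + k) = w.val := by
    rw [← h.apply (U := x :: U) (V := V) rfl, hk, List.length_cons, add_comm]
  have e4 : segProd a 2 (n - 1) = (W.map Letter.val).prod :=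
    h.segProd_eq (U := [x]) (V := [z]) (by rw [hW]; simp) rfl (by
      simp only [List.length_cons, List.length_nil]
      omega)
  have e5 := pairing_wordMoment hP hS a U V 2 (2 + k) hl
    (fun i hi => h.apply_getElem (U := [x]) (V := w :: V) (by simp) i hi)
    (fun i hi => by
      rw [h.apply_getElem (U := x :: (U ++ [w])) (W := V) (V := []) (by simp) i hi]
      congr 1
      simp
      omega)
  rw [e1, e2, e4, e5, ← Finset.Ico_succ_right_eq_Icc, Finset.prod_Ico_eq_prod_range]
  congr 1
  · simp [wordMoment, wordInf]
  · simp only [Nat.succ_eq_succ, Nat.succ_eq_add_one, Nat.add_sub_cancel]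
    nth_rewrite 1 [hk]
    rw [Finset.prod_range_succ', mul_comm, add_zero, e1, e3]
    congr 1
    · simp [wordMoment, val_transpose]
    · refine Finset.prod_congr rfl fun i _ => ?_
      rw [show 1 + (i + 1) = 2 + i by ring, show 2 + i + k = 2 + k + i by ring]

theorem Represents.odd_eq (hP : P.IsTracial) (hS : ∀ i, ∀ a ∈ S i, P.t a ∈ S i)
    {x w z : Letter S} {U V : List (Letter S)} (h : Represents a j (x :: (U ++ w :: (V ++ [z]))))
    (hl : U.length = V.length) {n k : ℕ} (hn : n + 1 = 2 * k) (hk : k = U.length + 2) :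
    P.τ (a 1 * a n) * P.τ' (segProd a 2 (n - 1)) + P.τ (a 1 * P.t (a k) * a n) *
        ∏ i ∈ Icc 2 (k - 1), P.τ (a i * P.t (a (i + k - 1))) =
      wordMoment P [x, z] * wordInf P (U ++ w :: V) + wordMoment P [x, w.transpose hS, z] *
        pairing (wordMoment P) (U.map (Letter.transpose hS)) V := by
  have e1 : a 1 = x.val := h.apply (U := []) rfl
  have e2 : a n = z.val := by
    rw [← h.apply (U := x :: (U ++ w :: V)) (V := []) (by simp)]
    congr 1
    simp only [List.length_cons, List.length_append]
    omega
  have e3 : a k = w.val := by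
    rw [← h.apply (U := x :: U) (V := V ++ [z]) rfl, hk, List.length_cons]
  have e4 : segProd a 2 (n - 1) = ((U ++ w :: V).map Letter.val).prod :=
    h.segProd_eq (U := [x]) (V := [z]) (by simp) rfl (by
      simp only [List.length_cons, List.length_nil, List.length_append]
      omega)
  have e5 := pairing_wordMoment hP hS a U V 2 (1 + k) hl
    (fun i hi => h.apply_getElem (U := [x]) (V := w :: (V ++ [z])) (by simp) i hi)
    (fun i hi => by
      rw [h.apply_getElem (U := x :: (U ++ [w])) (W := V) (V := [z]) (by simp) i hi]
      congr 1
      simp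
      omega)
  rw [e1, e2, e3, e4, e5, ← Finset.Ico_succ_right_eq_Icc, Finset.prod_Ico_eq_prod_range]
  congr 1
  · simp [wordMoment, wordInf]
  · congr 1
    · simp [wordMoment, val_transpose, mul_assoc]
    · rw [show Order.succ (k - 1) - 2 = U.length by rw [Nat.succ_eq_succ]; omega]
      refine Finset.prod_congr rfl fun i _ => ?_
      rw [show 2 + i + k - 1 = 1 + k + i by omega]

/-- For length two the general even formula has right side τ(a₁a₂)τ'(1) + τ(a₁a₂ᵗ), which vanishes
for centred letters of different colours under freeness. So the separate condition for n = 2 is an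
instance of the even case of `FreeWords`. -/
theorem wordInf_pair_eq_zero (x w : Letter S) (hS : ∀ i, ∀ a ∈ S i, P.t a ∈ S i)
    (hz : wordMoment P [x, w.transpose hS] = 0) (z : Letter S) :
    wordMoment P [x, z] * wordInf P ([] : List (Letter S)) + wordMoment P [x, w.transpose hS] *
      pairing (wordMoment P) (([] : List (Letter S)).map (Letter.transpose hS)) [] = 0 := by
  rw [hz]
  simp [wordInf, P.τ'_one]

theorem alternating_transpose (hS : ∀ i, ∀ a ∈ S i, P.t a ∈ S i) {x w : Letter S}
    (ha : Alternating Sigma.fst [x, w]) : Alternating Sigma.fst [x, w.transpose hS] :=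
  List.isChain_cons_cons.mpr ⟨(List.isChain_cons_cons.mp ha).1, List.isChain_singleton _⟩

theorem centred_transpose (hS : ∀ i, ∀ a ∈ S i, P.t a ∈ S i) {x w : Letter S}
    (hz : Centred (wordMoment P) [x, w]) : Centred (wordMoment P) [x, w.transpose hS] := by
  obtain ⟨h1, h2⟩ := centred_cons.mp hz
  have h3 := (centred_cons.mp h2).1
  refine centred_cons.mpr ⟨h1, centred_cons.mpr ⟨?_, by simp [Centred]⟩⟩
  simpa [wordMoment, val_transpose, P.τ_t] using h3

theorem isRealInfFree_iff (hP : P.IsTracial) (hS : ∀ i, ∀ a ∈ S i, P.t a ∈ S i) :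
    P.IsRealInfFree S ↔ FreeWords P hS := by
  have hseg : ∀ {a j} {L : List (Letter S)}, Represents a j L →
      segProd a 1 L.length = (L.map Letter.val).prod := fun h =>
    h.segProd_eq (U := []) (V := []) (by simp) rfl (by simp)
  constructor
  · intro hF
    have zero : ∀ L : List (Letter S), L ≠ [] → Alternating Sigma.fst L →
        Centred (wordMoment P) L → wordMoment P L = 0 := by
      intro L hL ha hz
      obtain ⟨a, j, h⟩ := exists_represents_word hL
      have := (hF L.length a j (List.length_pos_iff.mpr hL) h.mem (h.centred_iff.mpr hz)
        (h.alternating_iff.mpr ha)).1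
      rwa [hseg h] at this
    refine ⟨zero, ?_, ?_⟩
    · intro x w z U V W hl hW ha hz
      obtain ⟨a, j, h⟩ := exists_represents_word (L := x :: (U ++ w :: V)) (by simp)
      obtain ⟨-, h2, -, h4⟩ := hF _ a j (by simp) h.mem (h.centred_iff.mpr hz)
        (h.alternating_iff.mpr ha)
      rw [hseg h] at h4
      rcases Nat.eq_zero_or_pos U.length with hU | hU
      · obtain rfl := List.length_eq_zero_iff.mp hU
        obtain rfl := List.length_eq_zero_iff.mp hl.symm
        obtain rfl : W = [] := by
          have := congrArg List.length hW
          simpa using this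
        rw [List.nil_append] at ha hz ⊢
        rw [wordInf_pair_eq_zero x w hS
          (zero _ (by simp) (alternating_transpose hS ha) (centred_transpose hS hz)) z]
        have := h2 (by simp)
        have e1 : a 1 = x.val := h.apply (U := []) rfl
        have e2 : a 2 = w.val := h.apply (U := [x]) (V := []) rfl
        rw [e1, e2] at this
        simpa [wordInf] using this
      · rw [← h.even_eq hP hS hl hW (n := (x :: (U ++ w :: V)).length) (k := U.length + 1)
          (by simp; omega) rfl]
        exact h4 (U.length + 1) (by simp; omega) (by simp; omega)
    · intro x w z U V hl ha hz
      obtain ⟨a, j, h⟩ := exists_represents_word (L := x :: (U ++ w :: (V ++ [z]))) (by simp)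
      obtain ⟨-, -, h3, -⟩ := hF _ a j (by simp) h.mem (h.centred_iff.mpr hz)
        (h.alternating_iff.mpr ha)
      rw [hseg h] at h3
      rw [← h.odd_eq hP hS hl (n := (x :: (U ++ w :: (V ++ [z]))).length) (k := U.length + 2)
        (by simp; omega) rfl]
      exact h3 (U.length + 2) (by simp; omega) (by simp; omega)
  · intro hF n a j hn hmem hz ha
    obtain ⟨L, rfl, h⟩ := exists_represents_seq n a j hmem
    rw [h.centred_iff] at hz
    rw [h.alternating_iff] at ha
    rw [hseg h]
    refine ⟨hF.zero L (List.length_pos_iff.mp hn) ha hz, fun h2 => ?_, fun k hk h3 => ?_,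
      fun k hk h4 => ?_⟩
    · obtain ⟨x, w, rfl⟩ := List.length_eq_two.mp h2
      have e1 : a 1 = x.val := h.apply (U := []) rfl
      have e2 : a 2 = w.val := h.apply (U := [x]) (V := []) rfl
      rw [e1, e2]
      have := hF.even x w w [] [] [] rfl rfl ha hz
      rw [wordInf_pair_eq_zero x w hS
        (hF.zero _ (by simp) (alternating_transpose hS ha) (centred_transpose hS hz))] at this
      simpa [wordInf] using this
    · rcases exists_split L (by omega) with ⟨x, U, w, V, rfl, hl⟩ | ⟨x, U, w, V, z, rfl, hl⟩
      · simp only [List.length_cons, List.length_append] at hk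
        omega
      · rw [h.odd_eq hP hS hl hk (by
          simp only [List.length_cons, List.length_append, List.length_nil] at hk
          omega)]
        exact hF.odd x w z U V hl ha hz
    · rcases exists_split L (by omega) with ⟨x, U, w, V, rfl, hl⟩ | ⟨x, U, w, V, z, rfl, hl⟩
      · obtain ⟨W, z, hW⟩ : ∃ W z, U ++ w :: V = W ++ [z] :=
          (List.eq_nil_or_concat' (U ++ w :: V)).resolve_left (by simp)
        rw [h.even_eq hP hS hl hW hk (by
          simp only [List.length_cons, List.length_append] at hk
          omega)]
        exact hF.even x w z U V W hl hW ha hz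
      · simp only [List.length_cons, List.length_append, List.length_nil] at hk
        omega

end sequences

theorem mainTheorem2 {A : Type*} [Ring A] [Algebra ℂ A] (P : RealInfProbSpace A)
    (hP : P.IsTracial) {s : ℕ} (S : Fin s → Subalgebra ℂ A)
    (hS : ∀ (i : Fin s) (a : A), a ∈ S i → P.t a ∈ S i) :
    P.IsRealInfFree S ↔ P.MixedCumulantsVanish S := by
  rw [isRealInfFree_iff hP hS, freeWords_iff hP hS, mixedCumulantsVanish_iff]
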